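/- **Continuity of transition maps and the topology of the determinant line bundle.** Let $X$ and $Y$ be real Banach spaces and let $\mathcal F(X,Y)$ be the space of Fredholm operators $D\colon X\to Y$ with the operator-norm topology. For a finite-dimensional real vector space $V$ put $\lambda(V)=\Lambda^{\dim V}V$ and $\lambda^*(V)=\lambda(V)^*$; for a nonzero element $v$ of a line write $v^*$ for the element of the dual line with $v^*(v)=1$. For a Fredholm operator $D$ let $\lambda(D)=\lambda(\ker D)\otimes\lambda^*(\operatorname{coker}D)$, let $\operatorname{ind}D=\dim\ker D-\dim\operatorname{coker}D$, and let $\det_{X,Y}=\bigsqcup_{D\in\mathcal F(X,Y)}\lambda(D)$. *Topology over surjective operators.* Let $\mathcal F^*(X,Y)\subset\mathcal F(X,Y)$ be the subspace of surjective operators. For $D\in\mathcal F^*(X,Y)$ and a bounded right inverse $T\colon Y\to X$ of $D$, let $U_{D,T}$ be the set of the $D'\in\mathcal F^*(X,Y)$ for which $\Phi_{D'}\colon\ker D'\to\ker D$, $x\mapsto x-TDx$, is an isomorphism. The set $\det_{X,Y}|_{\mathcal F^*(X,Y)}$ carries the topology glued from the trivializations $U_{D,T}\times\lambda(D)\to\det_{X,Y}|_{U_{D,T}}$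 induced by $\lambda(\Phi_{D'}^{-1})$. *Compositions.* Every short exact sequence $0\to V'\xrightarrow{i}V\xrightarrow{j}V''\to0$ of finite-dimensional vector spaces induces the isomorphism $\lambda(V')\otimes\lambda(V'')\to\lambda(V)$, $$(v_1'\wedge\dots\wedge v_k')\wedge_V(j v_1\wedge\dots\wedge j v_\ell)=i v_1'\wedge\dots\wedge i v_k'\wedge v_1\wedge\dots\wedge v_\ell .$$ For Fredholm operators $D_1\colon X_1\to X_2$ and $D_2\colon X_2\to X_3$ consider the exact sequence $$0\to\ker D_1\to\ker(D_2D_1)\xrightarrow{D_1}\ker D_2\xrightarrow{\delta}\operatorname{coker}D_1\xrightarrow{D_2}\operatorname{coker}(D_2D_1)\to\operatorname{coker}D_2\to0,\qquad \delta(x_2)=-x_2+\operatorname{Im}D_1 .$$ Let $\mathcal C_{D_1,D_2}\colon\lambda(D_1)\otimes\lambda(D_2)\to\lambda(D_2D_1)$ be the isomorphism with $$\mathcal C_{D_1,D_2}\big(x\otimes(\lambda(\delta)v\wedge w)^*\otimes(\lambda(D_1)u\wedge v)\otimes y^*\big)=(-1)^{\epsilon}\,(x\wedge u)\otimes(\lambda(D_2)w\wedge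 y)^*,$$ $$\epsilon=(\operatorname{ind}D_2)\dim\operatorname{coker}D_1+\dim\operatorname{coker}(D_2D_1)\,\dim\operatorname{Im}\delta,$$ for all nonzero $x\in\lambda(\ker D_1)$, $u\in\lambda(\ker(D_2D_1)/\ker D_1)$, $v\in\lambda(\ker D_2/D_1(\ker(D_2D_1)))$, $w\in\lambda(\operatorname{coker}D_1/\operatorname{Im}\delta)$, $y\in\lambda(\operatorname{coker}D_2)$. *Stabilizations.* For $N\ge0$ and a linear map $\Theta\colon\mathbb R^N\to Y$ let $D_\Theta\colon X\oplus\mathbb R^N\to Y$, $D_\Theta(x,u)=Dx+\Theta(u)$, let $\iota_\Theta(D)=D_\Theta$, and let $$U_{X;\Theta}=\{D\in\mathcal F(X,Y):\ D_\Theta\text{ is surjective}\}.$$ Let $\iota_{X;N}\colon X\to X\oplus\mathbb R^N$ be the inclusion, $\pi_2\colon\operatorname{coker}\iota_{X;N}\to\mathbb R^N$ the isomorphism induced by the projection, and $\Omega_N=e_1\wedge\dots\wedge e_N$. Since $D=D_\Theta\circ\iota_{X;N}$, there is the isomorphism $$\mathcal I_{\Theta;D}\colon\lambda(D_\Theta)\to\lambda(D),\qquad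 \mathcal I_{\Theta;D}(\sigma)=\mathcal C_{\iota_{X;N},D_\Theta}\big(1\otimes(\Omega_N^*\circ\lambda(\pi_2))\otimes\sigma\big).$$ Then the following hold. 1. For all $N_1,N_2\ge0$ and all linear maps $\Theta_1\colon\mathbb R^{N_1}\to Y$ and $\Theta_2\colon\mathbb R^{N_2}\to Y$, the bundle map $$\mathcal I_{\Theta_2;D}^{-1}\circ\mathcal I_{\Theta_1;D}\colon\ \iota_{\Theta_1}^*\det\nolimits_{X\oplus\mathbb R^{N_1},Y}\longrightarrow\iota_{\Theta_2}^*\det\nolimits_{X\oplus\mathbb R^{N_2},Y}$$ is continuous over $U_{X;\Theta_1}\cap U_{X;\Theta_2}$. 2. The sets $U_{X;\Theta}$, over all $N\ge0$ and all linear maps $\Theta\colon\mathbb R^N\to Y$, form an open cover of $\mathcal F(X,Y)$, and there is exactly one topology on $\det_{X,Y}$ for which every bundle map $$\iota_\Theta^*\det\nolimits_{X\oplus\mathbb R^N,Y}\big|_{U_{X;\Theta}}\longrightarrow\det\nolimits_{X,Y},\qquad \sigma\mapsto\mathcal I_{\Theta;D}(\sigma)\quad(\sigma\in\lambda(D_\Theta)),$$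 is a homeomorphism onto the open subset $\det_{X,Y}|_{U_{X;\Theta}}$. With this topology $\det_{X,Y}\to\mathcal F(X,Y)$ is a (locally trivial, real) line bundle. -/

import Mathlib

noncomputable section

open Module TensorProduct Bundle

namespace FredholmDet

/-! ### Top exterior powers of finite-dimensional real vector spaces -/

section TopPower

variable {V V' V'' W : Type*} [AddCommGroup V] [Module ℝ V] [AddCommGroup V'] [Module ℝ V']
  [AddCommGroup V''] [Module ℝ V''] [AddCommGroup W] [Module ℝ W]

/-- The top exterior power `λ(V) = Λ^{dim V} V`, realized inside the exterior algebra of `V`. -/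
abbrev TopPower (V : Type*) [AddCommGroup V] [Module ℝ V] : Type _ :=
  ⋀[ℝ]^(finrank ℝ V) V

theorem finrank_topPower [FiniteDimensional ℝ V] : finrank ℝ (TopPower V) = 1 := by
  rw [exteriorPower.finrank_eq, Nat.choose_self]

theorem map_coe (n : ℕ) (f : V →ₗ[ℝ] W) (x : ⋀[ℝ]^n V) :
    (exteriorPower.map n f x : ExteriorAlgebra ℝ W) = ExteriorAlgebra.map f x := by
  have h : (⋀[ℝ]^n W).subtype ∘ₗ exteriorPower.map n f =
      (ExteriorAlgebra.map f).toLinearMap ∘ₗ (⋀[ℝ]^n V).subtype := by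
    apply exteriorPower.linearMap_ext
    ext v
    simp [ExteriorAlgebra.map_apply_ιMulti]
  exact LinearMap.congr_fun h x

theorem map_mem {n m : ℕ} (f : V →ₗ[ℝ] W) (h : n = m) {x : ExteriorAlgebra ℝ V}
    (hx : x ∈ ⋀[ℝ]^n V) : ExteriorAlgebra.map f x ∈ ⋀[ℝ]^m W := by
  subst h
  have := (exteriorPower.map n f ⟨x, hx⟩).2
  rwa [map_coe] at this

/-- The map `λ(f) : λ(V) → λ(W)`, `v₁ ∧ … ∧ vₙ ↦ f v₁ ∧ … ∧ f vₙ`, induced by a linear map between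
spaces of the same dimension. -/
def topMap (f : V →ₗ[ℝ] W) (h : finrank ℝ V = finrank ℝ W) : TopPower V →ₗ[ℝ] TopPower W :=
  (ExteriorAlgebra.map f).toLinearMap.restrict fun _ hx => map_mem f h hx

theorem topMap_injective {f : V →ₗ[ℝ] W} (h : finrank ℝ V = finrank ℝ W)
    (hf : Function.Injective f) : Function.Injective (topMap f h) := by
  obtain ⟨g, hg⟩ := f.exists_leftInverse_of_injective (LinearMap.ker_eq_bot.mpr hf)
  intro x y hxy
  have key : ∀ z : TopPower V, ExteriorAlgebra.map g (topMap f h z : ExteriorAlgebra ℝ W) = z := by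
    intro z
    change ExteriorAlgebra.map g (ExteriorAlgebra.map f (z : ExteriorAlgebra ℝ V)) = z
    rw [← AlgHom.comp_apply, ExteriorAlgebra.map_comp_map, hg, ExteriorAlgebra.map_id,
      AlgHom.id_apply]
  exact Subtype.ext (by rw [← key x, hxy, key y])

/-- The unit `1 ∈ ℝ = λ(V)` when `V` has dimension `0`. -/
def topOne (V : Type*) [AddCommGroup V] [Module ℝ V] (h : finrank ℝ V = 0) : TopPower V :=
  ⟨1, by
    rw [h, ExteriorAlgebra.exteriorPower, pow_zero]
    exact Submodule.one_le.mp le_rfl⟩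

theorem topOne_ne_zero (h : finrank ℝ V = 0) : topOne V h ≠ 0 := fun h0 =>
  one_ne_zero (α := ExteriorAlgebra ℝ V) (congrArg Subtype.val h0)

/-- The wedge product of a basis is nonzero. -/
theorem ιMulti_basis_ne_zero {n : ℕ} (b : Basis (Fin n) ℝ V) :
    ExteriorAlgebra.ιMulti ℝ n b ≠ 0 := by
  intro h
  have h1 : exteriorPower.ιMulti ℝ n b = 0 := Subtype.ext h
  have h2 := exteriorPower.alternatingMapLinearEquiv_apply_ιMulti b.det b
  rw [h1, map_zero, Basis.det_self] at h2
  exact zero_ne_one h2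

theorem finrank_ses [FiniteDimensional ℝ V] {i : V' →ₗ[ℝ] V} {j : V →ₗ[ℝ] V''}
    (hi : Function.Injective i) (hij : Function.Exact i j) (hj : Function.Surjective j) :
    finrank ℝ V' + finrank ℝ V'' = finrank ℝ V := by
  rw [← j.finrank_range_add_finrank_ker, hij.linearMap_ker_eq,
    LinearMap.finrank_range_of_inj hi, LinearMap.range_eq_top.mpr hj, finrank_top, add_comm]

/-- The isomorphism `∧_V : λ(V') ⊗ λ(V'') → λ(V)` of a short exact sequence
`0 → V' → V → V'' → 0`, as a bilinear map. The element of `λ(V'')` is lifted to `V` through a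
linear section of `j`; by `wedge_lift` every other lift gives the same result, so that
`(v'₁ ∧ … ∧ v'ₖ) ∧_V (j v₁ ∧ … ∧ j vₗ) = i v'₁ ∧ … ∧ i v'ₖ ∧ v₁ ∧ … ∧ vₗ`. -/
def wedge [FiniteDimensional ℝ V] (i : V' →ₗ[ℝ] V) (j : V →ₗ[ℝ] V'')
    (hi : Function.Injective i) (hij : Function.Exact i j) (hj : Function.Surjective j) :
    TopPower V' →ₗ[ℝ] TopPower V'' →ₗ[ℝ] TopPower V :=
  LinearMap.mk₂ ℝ
    (fun x z => ⟨ExteriorAlgebra.map i x *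
        ExteriorAlgebra.map (j.exists_rightInverse_of_surjective
          (LinearMap.range_eq_top.mpr hj)).choose z, by
      rw [← finrank_ses hi hij hj]
      exact SetLike.mul_mem_graded (map_mem i rfl x.2) (map_mem _ rfl z.2)⟩)
    (fun x x' z => Subtype.ext (by simp [add_mul]))
    (fun c x z => Subtype.ext (by simp))
    (fun x z z' => Subtype.ext (by simp [mul_add]))
    (fun c x z => Subtype.ext (by simp))

theorem topPower_mul_ι [FiniteDimensional ℝ V] (x : TopPower V) (v : V) :
    (x : ExteriorAlgebra ℝ V) * ExteriorAlgebra.ι ℝ v = 0 := by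
  have hmem : (x : ExteriorAlgebra ℝ V) * ExteriorAlgebra.ι ℝ v ∈ ⋀[ℝ]^(finrank ℝ V + 1) V :=
    SetLike.mul_mem_graded x.2 (by
      change _ ∈ LinearMap.range (ExteriorAlgebra.ι ℝ (M := V)) ^ 1
      rw [pow_one]
      exact ⟨v, rfl⟩)
  have h0 : finrank ℝ (⋀[ℝ]^(finrank ℝ V + 1) V) = 0 := by
    rw [exteriorPower.finrank_eq, Nat.choose_eq_zero_of_lt (Nat.lt_succ_self _)]
  have := finrank_zero_iff.mp h0
  exact congrArg Subtype.val
    (Subsingleton.elim (⟨_, hmem⟩ : ⋀[ℝ]^(finrank ℝ V + 1) V) 0)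

theorem wedge_lift [FiniteDimensional ℝ V] {i : V' →ₗ[ℝ] V} {j : V →ₗ[ℝ] V''}
    (hi : Function.Injective i) (hij : Function.Exact i j) (hj : Function.Surjective j)
    (x : TopPower V') (w : ExteriorAlgebra ℝ V)
    (hw : ExteriorAlgebra.map j w ∈ ⋀[ℝ]^(finrank ℝ V'') V'') :
    (wedge i j hi hij hj x ⟨ExteriorAlgebra.map j w, hw⟩ : ExteriorAlgebra ℝ V) =
      ExteriorAlgebra.map i x * w := by
  have : FiniteDimensional ℝ V' := FiniteDimensional.of_injective i hi
  have key : ∀ (y : ExteriorAlgebra ℝ V) (a : V'),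
      ExteriorAlgebra.map i x * y * ExteriorAlgebra.ι ℝ (i a) = 0 := by
    intro y a
    induction y using CliffordAlgebra.right_induction with
    | algebraMap r =>
      rw [← Algebra.commutes, mul_assoc, ← ExteriorAlgebra.map_apply_ι, ← map_mul, topPower_mul_ι,
        map_zero, mul_zero]
    | add y z hy hz => rw [mul_add, add_mul, hy, hz, add_zero]
    | mul_ι v y hy =>
      change _ * (y * ExteriorAlgebra.ι ℝ v) * _ = 0
      have hs : ExteriorAlgebra.ι ℝ v * ExteriorAlgebra.ι ℝ (i a) =
          -(ExteriorAlgebra.ι ℝ (i a) * ExteriorAlgebra.ι ℝ v) :=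
        eq_neg_of_add_eq_zero_left (ExteriorAlgebra.ι_add_mul_swap v (i a))
      rw [← mul_assoc, mul_assoc, hs, mul_neg, ← mul_assoc, hy, zero_mul, neg_zero]
  set hs := j.exists_rightInverse_of_surjective (LinearMap.range_eq_top.mpr hj)
  have hsec : j ∘ₗ hs.choose = LinearMap.id := hs.choose_spec
  have main : ∀ y : ExteriorAlgebra ℝ V, ExteriorAlgebra.map i x *
      ExteriorAlgebra.map hs.choose (ExteriorAlgebra.map j y) = ExteriorAlgebra.map i x * y := by
    intro y
    induction y using CliffordAlgebra.right_induction with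
    | algebraMap r => simp
    | add y z hy hz => simp only [map_add, mul_add, hy, hz]
    | mul_ι v y hy =>
      change _ * ExteriorAlgebra.map hs.choose (ExteriorAlgebra.map j
        (y * ExteriorAlgebra.ι ℝ v)) = _ * (y * ExteriorAlgebra.ι ℝ v)
      rw [map_mul, map_mul, ← mul_assoc, hy, ExteriorAlgebra.map_apply_ι,
        ExteriorAlgebra.map_apply_ι, ← mul_assoc, ← sub_eq_zero, ← mul_sub, ← map_sub]
      obtain ⟨a, ha⟩ : hs.choose (j v) - v ∈ Set.range i := by
        rw [← hij]
        have := LinearMap.congr_fun hsec (j v)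
        simp only [LinearMap.comp_apply, LinearMap.id_apply] at this
        rw [map_sub, this, sub_self]
      rw [← ha, key]
  exact main w

theorem exists_smul_eq_of_finrank_one {L : Type*} [AddCommGroup L] [Module ℝ L]
    (h : finrank ℝ L = 1) {v : L} (hv : v ≠ 0) {w : L} (hw : w ≠ 0) :
    ∃ c : ℝ, c ≠ 0 ∧ w = c • v := by
  obtain ⟨c, hc⟩ := exists_smul_eq_of_finrank_eq_one h hv w
  exact ⟨c, fun h0 => hw (by rw [← hc, h0, zero_smul]), hc.symm⟩

theorem wedge_ne_zero [FiniteDimensional ℝ V] {i : V' →ₗ[ℝ] V} {j : V →ₗ[ℝ] V''}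
    (hi : Function.Injective i) (hij : Function.Exact i j) (hj : Function.Surjective j)
    {x : TopPower V'} {z : TopPower V''} (hx : x ≠ 0) (hz : z ≠ 0) :
    wedge i j hi hij hj x z ≠ 0 := by
  have : FiniteDimensional ℝ V' := FiniteDimensional.of_injective i hi
  have : FiniteDimensional ℝ V'' := FiniteDimensional.of_surjective j hj
  obtain ⟨s, hs⟩ := j.exists_rightInverse_of_surjective (LinearMap.range_eq_top.mpr hj)
  have hs' : ∀ c, j (s c) = c := fun c => LinearMap.congr_fun hs c
  have hji : ∀ a, j (i a) = 0 := fun a => (hij (i a)).mpr ⟨a, rfl⟩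
  have hbij : Function.Bijective (i.coprod s) := by
    constructor
    · rw [← LinearMap.ker_eq_bot, LinearMap.ker_eq_bot']
      rintro ⟨a, c⟩ hac
      rw [LinearMap.coprod_apply] at hac
      have hc : c = 0 := by
        have := congrArg j hac
        rwa [map_add, hji, hs', zero_add, map_zero] at this
      have ha : a = 0 := by
        rw [hc, map_zero, add_zero] at hac
        exact hi (hac.trans (map_zero i).symm)
      rw [ha, hc]
      rfl
    · intro v
      obtain ⟨a, ha⟩ : v - s (j v) ∈ Set.range i := by
        rw [← hij, map_sub, hs', sub_self]
      exact ⟨(a, j v), by rw [LinearMap.coprod_apply, ha, sub_add_cancel]⟩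
  let b' := finBasis ℝ V'
  let b'' := finBasis ℝ V''
  let b := ((b'.prod b'').map (LinearEquiv.ofBijective (i.coprod s) hbij)).reindex finSumFinEquiv
  have hb : (b : Fin (finrank ℝ V' + finrank ℝ V'') → V) = Fin.append (i ∘ b') (s ∘ b'') := by
    funext k
    refine Fin.addCases (fun k => ?_) (fun k => ?_) k <;> simp [b]
  let x₀ : TopPower V' := exteriorPower.ιMulti ℝ _ b'
  have hx₀ : x₀ ≠ 0 := fun h => ιMulti_basis_ne_zero b' (congrArg Subtype.val h)
  let w₀ : ExteriorAlgebra ℝ V := ExteriorAlgebra.ιMulti ℝ _ (s ∘ b'')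
  have hw : ExteriorAlgebra.map j w₀ = ExteriorAlgebra.ιMulti ℝ _ b'' := by
    rw [ExteriorAlgebra.map_apply_ιMulti]
    congr 1
    funext k
    exact hs' _
  have hw₀ : ExteriorAlgebra.map j w₀ ∈ ⋀[ℝ]^(finrank ℝ V'') V'' := by
    rw [hw]
    exact (exteriorPower.ιMulti ℝ _ b'').2
  have hz₀ : (⟨_, hw₀⟩ : TopPower V'') ≠ 0 := fun h =>
    ιMulti_basis_ne_zero b'' (hw.symm.trans (congrArg Subtype.val h))
  obtain ⟨c, hc, rfl⟩ := exists_smul_eq_of_finrank_one finrank_topPower hx₀ hx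
  obtain ⟨d, hd, rfl⟩ := exists_smul_eq_of_finrank_one finrank_topPower hz₀ hz
  rw [map_smul, map_smul, LinearMap.smul_apply]
  refine smul_ne_zero hd (smul_ne_zero hc fun h => ιMulti_basis_ne_zero b ?_)
  have h1 := wedge_lift hi hij hj x₀ w₀ hw₀
  rw [h] at h1
  have h2 : ExteriorAlgebra.map i (x₀ : ExteriorAlgebra ℝ V') =
      ExteriorAlgebra.ιMulti ℝ _ (i ∘ b') := by
    rw [← ExteriorAlgebra.map_apply_ιMulti]
    rfl
  rw [hb, ExteriorAlgebra.ιMulti_apply]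
  have h3 : (fun k => ExteriorAlgebra.ι ℝ (Fin.append (i ∘ b') (s ∘ b'') k)) =
      Fin.append (fun k => ExteriorAlgebra.ι ℝ ((i ∘ b') k))
        (fun k => ExteriorAlgebra.ι ℝ ((s ∘ b'') k)) := by
    funext k
    refine Fin.addCases (fun k => ?_) (fun k => ?_) k <;> simp
  rw [h3, List.ofFn_fin_append, List.prod_append]
  rw [h2] at h1
  exact h1.symm

end TopPower

/-! ### Lines and their duals -/

section Line

variable {L M : Type*} [AddCommGroup L] [Module ℝ L] [AddCommGroup M] [Module ℝ M]

open Classical in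
/-- For a nonzero vector `v` of a line `L`, the element `v^*` of the dual line with `v^* v = 1`. -/
def star (v : L) : Dual ℝ L :=
  if h : finrank ℝ L = 1 ∧ v ≠ 0 then (FiniteDimensional.basisSingleton Unit h.1 v h.2).coord () else 0

theorem star_self (h : finrank ℝ L = 1) {v : L} (hv : v ≠ 0) : star v v = 1 := by
  have h1 := (FiniteDimensional.basisSingleton Unit h v hv).repr_self ()
  rw [FiniteDimensional.basisSingleton_apply] at h1
  rw [star, dif_pos ⟨h, hv⟩, Basis.coord_apply, h1, Finsupp.single_eq_same]

theorem star_ne_zero (h : finrank ℝ L = 1) {v : L} (hv : v ≠ 0) : star v ≠ 0 := fun h0 => by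
  have := star_self h hv
  rw [h0] at this
  exact zero_ne_one this

theorem star_smul (h : finrank ℝ L = 1) {v : L} (hv : v ≠ 0) {c : ℝ} (hc : c ≠ 0) :
    star (c • v) = c⁻¹ • star v := by
  ext w
  obtain ⟨d, rfl⟩ := exists_smul_eq_of_finrank_eq_one h hv w
  have h1 := star_self h (smul_ne_zero hc hv)
  rw [map_smul, smul_eq_mul] at h1
  rw [map_smul, map_smul, eq_inv_of_mul_eq_one_right h1,
    LinearMap.smul_apply, star_self h hv, smul_eq_mul, smul_eq_mul, smul_eq_mul, mul_one]

theorem finrank_dual_line (h : finrank ℝ L = 1) : finrank ℝ (Dual ℝ L) = 1 := by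
  rw [Subspace.dual_finrank_eq, h]

theorem finrank_tmul_line (hL : finrank ℝ L = 1) (hM : finrank ℝ M = 1) :
    finrank ℝ (L ⊗[ℝ] M) = 1 := by
  rw [finrank_tensorProduct, hL, hM]

theorem tmul_ne_zero_line (hL : finrank ℝ L = 1) (hM : finrank ℝ M = 1) {v : L} {w : M}
    (hv : v ≠ 0) (hw : w ≠ 0) : v ⊗ₜ[ℝ] w ≠ 0 := by
  intro h
  have := congrArg (TensorProduct.lid ℝ ℝ) (congrArg (TensorProduct.map (star v) (star w)) h)
  rw [TensorProduct.map_tmul, star_self hL hv, star_self hM hw, map_zero, map_zero,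
    TensorProduct.lid_tmul, one_smul] at this
  exact one_ne_zero this

/-- The isomorphism of lines that sends the nonzero vector `v` to the nonzero vector `w`. -/
def lineEquiv (hL : finrank ℝ L = 1) (hM : finrank ℝ M = 1) (v : L) (w : M) (hv : v ≠ 0)
    (hw : w ≠ 0) : L ≃ₗ[ℝ] M :=
  (FiniteDimensional.basisSingleton Unit hL v hv).equiv (FiniteDimensional.basisSingleton Unit hM w hw) (Equiv.refl Unit)

theorem lineEquiv_apply (hL : finrank ℝ L = 1) (hM : finrank ℝ M = 1) {v : L} {w : M}
    (hv : v ≠ 0) (hw : w ≠ 0) : lineEquiv hL hM v w hv hw v = w := by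
  have := (FiniteDimensional.basisSingleton Unit hL v hv).equiv_apply () (FiniteDimensional.basisSingleton Unit hM w hw)
    (Equiv.refl Unit)
  rwa [FiniteDimensional.basisSingleton_apply, FiniteDimensional.basisSingleton_apply] at this

theorem tmul_left_bijective (hL : finrank ℝ L = 1) {v : L} (hv : v ≠ 0) :
    Function.Bijective (TensorProduct.mk ℝ L M v) := by
  constructor
  · intro m m' h
    have := congrArg (TensorProduct.lid ℝ M)
      (congrArg (TensorProduct.map (star v) (LinearMap.id (R := ℝ) (M := M))) h)
    simpa only [TensorProduct.mk_apply, TensorProduct.map_tmul, star_self hL hv,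
      TensorProduct.lid_tmul, one_smul, LinearMap.id_apply] using this
  · intro t
    induction t using TensorProduct.induction_on with
    | zero => exact ⟨0, map_zero _⟩
    | tmul l m =>
      obtain ⟨c, rfl⟩ := exists_smul_eq_of_finrank_eq_one hL hv l
      exact ⟨c • m, by rw [TensorProduct.mk_apply, TensorProduct.smul_tmul]⟩
    | add s t hs ht =>
      obtain ⟨a, rfl⟩ := hs
      obtain ⟨b, rfl⟩ := ht
      exact ⟨a + b, map_add _ _ _⟩

theorem exists_ne_zero_of_line (h : finrank ℝ L = 1) : ∃ v : L, v ≠ 0 :=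
  have := nontrivial_of_finrank_pos (R := ℝ) (M := L) (by rw [h]; exact one_pos)
  exists_ne 0

end Line

/-! ### Six-term exact sequences -/

section DetPair

variable (A B : Type*) [AddCommGroup A] [Module ℝ A] [AddCommGroup B] [Module ℝ B]

/-- The line `λ(A) ⊗ λ^*(B)`. -/
def DetPair : Type _ := TopPower A ⊗[ℝ] Dual ℝ (TopPower B)

instance : AddCommGroup (DetPair A B) :=
  inferInstanceAs (AddCommGroup (TopPower A ⊗[ℝ] Dual ℝ (TopPower B)))

instance : Module ℝ (DetPair A B) :=
  inferInstanceAs (Module ℝ (TopPower A ⊗[ℝ] Dual ℝ (TopPower B)))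

variable {A B}

/-- The element `x ⊗ α` of `λ(A) ⊗ λ^*(B)`. -/
def DetPair.mk (x : TopPower A) (α : Dual ℝ (TopPower B)) : DetPair A B := x ⊗ₜ[ℝ] α

theorem DetPair.mk_smul (c d : ℝ) (x : TopPower A) (α : Dual ℝ (TopPower B)) :
    DetPair.mk (c • x) (d • α) = (c * d) • DetPair.mk x α :=
  TensorProduct.smul_tmul_smul c d x α

theorem finrank_detPair [FiniteDimensional ℝ A] [FiniteDimensional ℝ B] :
    finrank ℝ (DetPair A B) = 1 :=
  finrank_tmul_line finrank_topPower (finrank_dual_line finrank_topPower)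

theorem DetPair.mk_ne_zero [FiniteDimensional ℝ A] [FiniteDimensional ℝ B] {x : TopPower A}
    {α : Dual ℝ (TopPower B)} (hx : x ≠ 0) (hα : α ≠ 0) : DetPair.mk x α ≠ 0 :=
  tmul_ne_zero_line finrank_topPower (finrank_dual_line finrank_topPower) hx hα

end DetPair

section SixTerm

variable {A₁ A₂ A₃ B₁ B₂ B₃ : Type*} [AddCommGroup A₁] [Module ℝ A₁] [AddCommGroup A₂] [Module ℝ A₂]
  [AddCommGroup A₃] [Module ℝ A₃] [AddCommGroup B₁] [Module ℝ B₁] [AddCommGroup B₂] [Module ℝ B₂]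
  [AddCommGroup B₃] [Module ℝ B₃]

/-- For `A → B → C` exact at `B`, the injection `B / im f → C` induced by `g`. -/
def quotLift (f : A₁ →ₗ[ℝ] A₂) (g : A₂ →ₗ[ℝ] A₃) (h : Function.Exact f g) :
    (A₂ ⧸ LinearMap.range f) →ₗ[ℝ] A₃ :=
  (LinearMap.range f).liftQ g h.linearMap_ker_eq.ge

theorem quotLift_injective (f : A₁ →ₗ[ℝ] A₂) (g : A₂ →ₗ[ℝ] A₃) (h : Function.Exact f g) :
    Function.Injective (quotLift f g h) := by
  rw [← LinearMap.ker_eq_bot, quotLift, Submodule.ker_liftQ, h.linearMap_ker_eq,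
    Submodule.mkQ_map_self]

theorem quotLift_range (f : A₁ →ₗ[ℝ] A₂) (g : A₂ →ₗ[ℝ] A₃) (h : Function.Exact f g) :
    LinearMap.range (quotLift f g h) = LinearMap.range g :=
  Submodule.range_liftQ _ _ _

theorem quotLift_exact (f : A₁ →ₗ[ℝ] A₂) (g : A₂ →ₗ[ℝ] A₃) (h : Function.Exact f g) :
    Function.Exact (quotLift f g h) (LinearMap.range g).mkQ := by
  rw [LinearMap.exact_iff, Submodule.ker_mkQ, quotLift_range]

/-- An exact sequence `0 → A₁ → A₂ → A₃ → B₁ → B₂ → B₃ → 0`, with connecting map `δ`. -/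
structure SixTerm (A₁ A₂ A₃ B₁ B₂ B₃ : Type*) [AddCommGroup A₁] [Module ℝ A₁]
    [AddCommGroup A₂] [Module ℝ A₂] [AddCommGroup A₃] [Module ℝ A₃] [AddCommGroup B₁] [Module ℝ B₁]
    [AddCommGroup B₂] [Module ℝ B₂] [AddCommGroup B₃] [Module ℝ B₃] where
  i : A₁ →ₗ[ℝ] A₂
  j : A₂ →ₗ[ℝ] A₃
  δ : A₃ →ₗ[ℝ] B₁
  i' : B₁ →ₗ[ℝ] B₂
  j' : B₂ →ₗ[ℝ] B₃
  inj : Function.Injective i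
  exact_ij : Function.Exact i j
  exact_jδ : Function.Exact j δ
  exact_δi : Function.Exact δ i'
  exact_ij' : Function.Exact i' j'
  surj : Function.Surjective j'

namespace SixTerm

set_option linter.unusedSectionVars false

variable [FiniteDimensional ℝ A₁] [FiniteDimensional ℝ A₂] [FiniteDimensional ℝ A₃]
  [FiniteDimensional ℝ B₁] [FiniteDimensional ℝ B₂] [FiniteDimensional ℝ B₃]
  (S : SixTerm A₁ A₂ A₃ B₁ B₂ B₃)

/-- `λ(i) x ∧ u ∈ λ(A₂)` for `x ∈ λ(A₁)` and `u ∈ λ(A₂ / i A₁)`. -/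
def wedgeA₂ : TopPower A₁ →ₗ[ℝ] TopPower (A₂ ⧸ LinearMap.range S.i) →ₗ[ℝ] TopPower A₂ :=
  wedge S.i (LinearMap.range S.i).mkQ S.inj
    (by rw [LinearMap.exact_iff, Submodule.ker_mkQ]) (Submodule.mkQ_surjective _)

/-- `λ(j) u ∧ v ∈ λ(A₃)` for `u ∈ λ(A₂ / i A₁)` and `v ∈ λ(A₃ / j A₂)`. -/
def wedgeA₃ : TopPower (A₂ ⧸ LinearMap.range S.i) →ₗ[ℝ]
    TopPower (A₃ ⧸ LinearMap.range S.j) →ₗ[ℝ] TopPower A₃ :=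
  wedge (quotLift S.i S.j S.exact_ij) (LinearMap.range S.j).mkQ (quotLift_injective _ _ _)
    (quotLift_exact _ _ _) (Submodule.mkQ_surjective _)

/-- `λ(δ) v ∧ w ∈ λ(B₁)` for `v ∈ λ(A₃ / j A₂)` and `w ∈ λ(B₁ / δ A₃)`. -/
def wedgeB₁ : TopPower (A₃ ⧸ LinearMap.range S.j) →ₗ[ℝ]
    TopPower (B₁ ⧸ LinearMap.range S.δ) →ₗ[ℝ] TopPower B₁ :=
  wedge (quotLift S.j S.δ S.exact_jδ) (LinearMap.range S.δ).mkQ (quotLift_injective _ _ _)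
    (quotLift_exact _ _ _) (Submodule.mkQ_surjective _)

/-- `λ(i') w ∧ y ∈ λ(B₂)` for `w ∈ λ(B₁ / δ A₃)` and `y ∈ λ(B₂ / i' B₁)`. -/
def wedgeB₂ : TopPower (B₁ ⧸ LinearMap.range S.δ) →ₗ[ℝ]
    TopPower (B₂ ⧸ LinearMap.range S.i') →ₗ[ℝ] TopPower B₂ :=
  wedge (quotLift S.δ S.i' S.exact_δi) (LinearMap.range S.i').mkQ (quotLift_injective _ _ _)
    (quotLift_exact _ _ _) (Submodule.mkQ_surjective _)

theorem quotLift_bijective :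
    Function.Bijective (quotLift S.i' S.j' S.exact_ij') :=
  ⟨quotLift_injective _ _ _, by
    rw [← LinearMap.range_eq_top, quotLift_range, LinearMap.range_eq_top]
    exact S.surj⟩

/-- `λ(j') y ∈ λ(B₃)` for `y ∈ λ(B₂ / i' B₁)`. -/
def mapB₃ : TopPower (B₂ ⧸ LinearMap.range S.i') →ₗ[ℝ] TopPower B₃ :=
  topMap (quotLift S.i' S.j' S.exact_ij')
    (LinearEquiv.ofBijective _ S.quotLift_bijective).finrank_eq

/-- The element `(x ⊗ (λ(δ)v ∧ w)^*) ⊗ ((λ(j)u ∧ v) ⊗ (λ(j')y)^*)` of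
`(λ(A₁) ⊗ λ^*(B₁)) ⊗ (λ(A₃) ⊗ λ^*(B₃))`. -/
def source (x : TopPower A₁) (u : TopPower (A₂ ⧸ LinearMap.range S.i))
    (v : TopPower (A₃ ⧸ LinearMap.range S.j)) (w : TopPower (B₁ ⧸ LinearMap.range S.δ))
    (y : TopPower (B₂ ⧸ LinearMap.range S.i')) :
    DetPair A₁ B₁ ⊗[ℝ] DetPair A₃ B₃ :=
  DetPair.mk x (star (S.wedgeB₁ v w)) ⊗ₜ DetPair.mk (S.wedgeA₃ u v) (star (S.mapB₃ y))

/-- The element `(λ(i)x ∧ u) ⊗ (λ(i')w ∧ y)^*` of `λ(A₂) ⊗ λ^*(B₂)`. -/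
def target (x : TopPower A₁) (u : TopPower (A₂ ⧸ LinearMap.range S.i))
    (w : TopPower (B₁ ⧸ LinearMap.range S.δ)) (y : TopPower (B₂ ⧸ LinearMap.range S.i')) :
    DetPair A₂ B₂ :=
  DetPair.mk (S.wedgeA₂ x u) (star (S.wedgeB₂ w y))

/-- The sign exponent `ε = (dim A₃ - dim B₃) dim B₁ + dim B₂ dim (im δ)`. -/
def signExp : ℤ :=
  ((finrank ℝ A₃ : ℤ) - finrank ℝ B₃) * finrank ℝ B₁ +
    finrank ℝ B₂ * finrank ℝ (LinearMap.range S.δ)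

variable {S} in
theorem source_ne_zero {x : TopPower A₁} {u : TopPower (A₂ ⧸ LinearMap.range S.i)}
    {v : TopPower (A₃ ⧸ LinearMap.range S.j)} {w : TopPower (B₁ ⧸ LinearMap.range S.δ)}
    {y : TopPower (B₂ ⧸ LinearMap.range S.i')} (hx : x ≠ 0) (hu : u ≠ 0) (hv : v ≠ 0) (hw : w ≠ 0)
    (hy : y ≠ 0) : S.source x u v w y ≠ 0 := by
  have h1 : S.wedgeB₁ v w ≠ 0 := wedge_ne_zero _ _ _ hv hw
  have h2 : S.wedgeA₃ u v ≠ 0 := wedge_ne_zero _ _ _ hu hv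
  have h3 : S.mapB₃ y ≠ 0 := (map_ne_zero_iff _ (topMap_injective _ S.quotLift_bijective.1)).mpr hy
  exact tmul_ne_zero_line finrank_detPair finrank_detPair
    (DetPair.mk_ne_zero hx (star_ne_zero finrank_topPower h1))
    (DetPair.mk_ne_zero h2 (star_ne_zero finrank_topPower h3))

variable {S} in
theorem target_ne_zero {x : TopPower A₁} {u : TopPower (A₂ ⧸ LinearMap.range S.i)}
    {w : TopPower (B₁ ⧸ LinearMap.range S.δ)} {y : TopPower (B₂ ⧸ LinearMap.range S.i')}
    (hx : x ≠ 0) (hu : u ≠ 0) (hw : w ≠ 0) (hy : y ≠ 0) : S.target x u w y ≠ 0 :=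
  DetPair.mk_ne_zero (wedge_ne_zero _ _ _ hx hu) (star_ne_zero finrank_topPower (wedge_ne_zero _ _ _ hw hy))

theorem exists_top_ne_zero (V : Type*) [AddCommGroup V] [Module ℝ V] [FiniteDimensional ℝ V] :
    ∃ v : TopPower V, v ≠ 0 :=
  exists_ne_zero_of_line finrank_topPower

/-- The isomorphism `Ψ : (λ(A₁) ⊗ λ^*(B₁)) ⊗ (λ(A₃) ⊗ λ^*(B₃)) → λ(A₂) ⊗ λ^*(B₂)` with
`Ψ(x ⊗ (λ(δ)v ∧ w)^* ⊗ (λ(j)u ∧ v) ⊗ (λ(j')y)^*) = (-1)^ε (λ(i)x ∧ u) ⊗ (λ(i')w ∧ y)^*`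
for all nonzero `x, u, v, w, y`. It is defined through one choice of these elements;
`psi_source` shows that the formula holds for all choices. -/
def psi : DetPair A₁ B₁ ⊗[ℝ] DetPair A₃ B₃ ≃ₗ[ℝ]
    DetPair A₂ B₂ :=
  lineEquiv
    (finrank_tmul_line finrank_detPair finrank_detPair) finrank_detPair
    (S.source (exists_top_ne_zero _).choose (exists_top_ne_zero _).choose
      (exists_top_ne_zero _).choose (exists_top_ne_zero _).choose (exists_top_ne_zero _).choose)
    ((-1 : ℝ) ^ S.signExp • S.target (exists_top_ne_zero _).choose (exists_top_ne_zero _).choose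
      (exists_top_ne_zero _).choose (exists_top_ne_zero _).choose)
    (source_ne_zero (exists_top_ne_zero _).choose_spec (exists_top_ne_zero _).choose_spec
      (exists_top_ne_zero _).choose_spec (exists_top_ne_zero _).choose_spec
      (exists_top_ne_zero _).choose_spec)
    (smul_ne_zero (zpow_ne_zero _ (neg_ne_zero.mpr one_ne_zero))
      (target_ne_zero (exists_top_ne_zero _).choose_spec (exists_top_ne_zero _).choose_spec
        (exists_top_ne_zero _).choose_spec (exists_top_ne_zero _).choose_spec))

theorem psi_source {x : TopPower A₁} {u : TopPower (A₂ ⧸ LinearMap.range S.i)}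
    {v : TopPower (A₃ ⧸ LinearMap.range S.j)} {w : TopPower (B₁ ⧸ LinearMap.range S.δ)}
    {y : TopPower (B₂ ⧸ LinearMap.range S.i')} (hx : x ≠ 0) (hu : u ≠ 0) (hv : v ≠ 0) (hw : w ≠ 0)
    (hy : y ≠ 0) : S.psi (S.source x u v w y) = (-1 : ℝ) ^ S.signExp • S.target x u w y := by
  have hx₀ := (exists_top_ne_zero A₁).choose_spec
  have hu₀ := (exists_top_ne_zero (A₂ ⧸ LinearMap.range S.i)).choose_spec
  have hv₀ := (exists_top_ne_zero (A₃ ⧸ LinearMap.range S.j)).choose_spec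
  have hw₀ := (exists_top_ne_zero (B₁ ⧸ LinearMap.range S.δ)).choose_spec
  have hy₀ := (exists_top_ne_zero (B₂ ⧸ LinearMap.range S.i')).choose_spec
  have h0 : S.psi (S.source _ _ _ _ _) = (-1 : ℝ) ^ S.signExp • S.target _ _ _ _ :=
    lineEquiv_apply _ _ (source_ne_zero hx₀ hu₀ hv₀ hw₀ hy₀)
      (smul_ne_zero (zpow_ne_zero _ (neg_ne_zero.mpr one_ne_zero))
        (target_ne_zero hx₀ hu₀ hw₀ hy₀))
  obtain ⟨a, ha, rfl⟩ := exists_smul_eq_of_finrank_one finrank_topPower hx₀ hx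
  obtain ⟨b, hb, rfl⟩ := exists_smul_eq_of_finrank_one finrank_topPower hu₀ hu
  obtain ⟨c, hc, rfl⟩ := exists_smul_eq_of_finrank_one finrank_topPower hv₀ hv
  obtain ⟨d, hd, rfl⟩ := exists_smul_eq_of_finrank_one finrank_topPower hw₀ hw
  obtain ⟨e, he, rfl⟩ := exists_smul_eq_of_finrank_one finrank_topPower hy₀ hy
  have h1 := wedge_ne_zero (quotLift_injective S.j S.δ S.exact_jδ) (quotLift_exact _ _ _)
    (Submodule.mkQ_surjective _) hv₀ hw₀
  have h3 : S.mapB₃ _ ≠ 0 :=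
    (map_ne_zero_iff _ (topMap_injective _ S.quotLift_bijective.1)).mpr hy₀
  have h4 := wedge_ne_zero (quotLift_injective S.δ S.i' S.exact_δi) (quotLift_exact _ _ _)
    (Submodule.mkQ_surjective _) hw₀ hy₀
  have hs : ∀ (x : TopPower A₁) u v w y (_ : S.wedgeB₁ v w ≠ 0) (_ : S.mapB₃ y ≠ 0),
      S.source (a • x) (b • u) (c • v) (d • w) (e • y) =
        (a * b * d⁻¹ * e⁻¹) • S.source x u v w y := by
    intro x u v w y h h'
    have e1 : S.wedgeB₁ (c • v) (d • w) = (d * c) • S.wedgeB₁ v w := by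
      rw [map_smul, map_smul, LinearMap.smul_apply, smul_smul]
    have e2 : S.wedgeA₃ (b • u) (c • v) = (c * b) • S.wedgeA₃ u v := by
      rw [map_smul, map_smul, LinearMap.smul_apply, smul_smul]
    rw [source, source, e1, e2, map_smul, star_smul finrank_topPower h' he,
      star_smul finrank_topPower h (mul_ne_zero hd hc), DetPair.mk_smul, DetPair.mk_smul,
      TensorProduct.smul_tmul_smul]
    congr 1
    field_simp
  have ht : ∀ (x : TopPower A₁) u w y (_ : S.wedgeB₂ w y ≠ 0),
      S.target (a • x) (b • u) (d • w) (e • y) =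
        (a * b * d⁻¹ * e⁻¹) • S.target x u w y := by
    intro x u w y h
    have e1 : S.wedgeB₂ (d • w) (e • y) = (e * d) • S.wedgeB₂ w y := by
      rw [map_smul, map_smul, LinearMap.smul_apply, smul_smul]
    have e2 : S.wedgeA₂ (a • x) (b • u) = (b * a) • S.wedgeA₂ x u := by
      rw [map_smul, map_smul, LinearMap.smul_apply, smul_smul]
    rw [target, target, e1, e2, star_smul finrank_topPower h (mul_ne_zero he hd), DetPair.mk_smul]
    congr 1
    field_simp
  rw [hs _ _ _ _ _ h1 h3, ht _ _ _ _ h4, map_smul, h0, smul_comm]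

end SixTerm

end SixTerm

/-! ### Compositions -/

section Composition

variable {X₁ X₂ X₃ : Type*} [AddCommGroup X₁] [Module ℝ X₁] [AddCommGroup X₂] [Module ℝ X₂]
  [AddCommGroup X₃] [Module ℝ X₃]

/-- The determinant line `λ(D) = λ(ker D) ⊗ λ^*(coker D)`. -/
abbrev DetLine (D : X₁ →ₗ[ℝ] X₂) : Type _ :=
  DetPair (LinearMap.ker D) (X₂ ⧸ LinearMap.range D)

/-- The exact sequence
`0 → ker D₁ → ker D₃ → ker D₂ → coker D₁ → coker D₃ → coker D₂ → 0` of a composition `D₃ = D₂ ∘ D₁`.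
The maps are the inclusion, `D₁`, `x₂ ↦ -x₂ + im D₁`, `D₂` and the projection: this is the snake
sequence of the exact triple `0 → D₁ → D₂D₁ ⊕ id → D₂ → 0` with the maps `x₁ ↦ (x₁, D₁x₁)`,
`(x₁, x₂) ↦ D₁x₁ - x₂`, `x₂ ↦ (D₂x₂, x₂)`, `(x₃, x₂) ↦ x₃ - D₂x₂`. -/
def compSeq (D₁ : X₁ →ₗ[ℝ] X₂) (D₂ : X₂ →ₗ[ℝ] X₃) (D₃ : X₁ →ₗ[ℝ] X₃)
    (h : ∀ x, D₃ x = D₂ (D₁ x)) :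
    SixTerm (LinearMap.ker D₁) (LinearMap.ker D₃) (LinearMap.ker D₂)
      (X₂ ⧸ LinearMap.range D₁) (X₃ ⧸ LinearMap.range D₃) (X₃ ⧸ LinearMap.range D₂) where
  i := Submodule.inclusion fun x hx => by
    rw [LinearMap.mem_ker] at hx ⊢
    rw [h, hx, map_zero]
  j := D₁.restrict fun x hx => by
    rw [LinearMap.mem_ker] at hx ⊢
    rw [← h, hx]
  δ := -((LinearMap.range D₁).mkQ ∘ₗ (LinearMap.ker D₂).subtype)
  i' := Submodule.mapQ _ _ D₂ (by
    rintro _ ⟨x, rfl⟩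
    exact ⟨x, h x⟩)
  j' := Submodule.factor (by
    rintro _ ⟨x, rfl⟩
    exact ⟨D₁ x, (h x).symm⟩)
  inj := Submodule.inclusion_injective _
  exact_ij := by
    rintro ⟨x, hx⟩
    constructor
    · intro hx'
      exact ⟨⟨x, congrArg Subtype.val hx'⟩, rfl⟩
    · rintro ⟨⟨y, hy⟩, hyx⟩
      have : y = x := congrArg Subtype.val hyx
      subst this
      exact Subtype.ext hy
  exact_jδ := by
    rintro ⟨x, hx⟩
    constructor
    · intro hx'
      have h1 : (LinearMap.range D₁).mkQ x = 0 := neg_eq_zero.mp hx'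
      rw [Submodule.mkQ_apply, Submodule.Quotient.mk_eq_zero] at h1
      obtain ⟨y, rfl⟩ := h1
      exact ⟨⟨y, by rw [LinearMap.mem_ker, h]; exact hx⟩, rfl⟩
    · rintro ⟨⟨y, hy⟩, hyx⟩
      have : D₁ y = x := congrArg Subtype.val hyx
      subst this
      change -((LinearMap.range D₁).mkQ (D₁ y)) = 0
      rw [neg_eq_zero]
      exact (Submodule.Quotient.mk_eq_zero _).mpr ⟨y, rfl⟩
  exact_δi := by
    intro q
    obtain ⟨x, rfl⟩ := Submodule.mkQ_surjective _ q
    constructor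
    · intro hx
      have h1 : D₂ x ∈ LinearMap.range D₃ := (Submodule.Quotient.mk_eq_zero _).mp hx
      obtain ⟨y, hy⟩ := h1
      refine ⟨⟨D₁ y - x, by rw [LinearMap.mem_ker, map_sub, ← h, hy, sub_self]⟩, ?_⟩
      change -(LinearMap.range D₁).mkQ (D₁ y - x) = _
      have h2 : (LinearMap.range D₁).mkQ (D₁ y) = 0 :=
        (Submodule.Quotient.mk_eq_zero _).mpr ⟨y, rfl⟩
      rw [map_sub, h2, zero_sub, neg_neg]
    · rintro ⟨⟨y, hy⟩, hyx⟩
      rw [← hyx]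
      change Submodule.mapQ _ _ D₂ _ (-(LinearMap.range D₁).mkQ y) = 0
      rw [map_neg, neg_eq_zero]
      change (LinearMap.range D₃).mkQ (D₂ y) = 0
      rw [LinearMap.mem_ker.mp hy, map_zero]
  exact_ij' := by
    intro q
    obtain ⟨x, rfl⟩ := Submodule.mkQ_surjective _ q
    constructor
    · intro hx
      obtain ⟨y, rfl⟩ : x ∈ LinearMap.range D₂ := (Submodule.Quotient.mk_eq_zero _).mp hx
      exact ⟨(LinearMap.range D₁).mkQ y, rfl⟩
    · rintro ⟨r, hr⟩
      obtain ⟨y, rfl⟩ := Submodule.mkQ_surjective _ r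
      rw [← hr]
      exact (Submodule.Quotient.mk_eq_zero _).mpr ⟨y, rfl⟩
  surj := Submodule.factor_surjective _

/-- The isomorphism `C_{D₁,D₂} : λ(D₁) ⊗ λ(D₂) → λ(D₃)` of a composition `D₃ = D₂ ∘ D₁`. -/
def compIso (D₁ : X₁ →ₗ[ℝ] X₂) (D₂ : X₂ →ₗ[ℝ] X₃) (D₃ : X₁ →ₗ[ℝ] X₃)
    (h : ∀ x, D₃ x = D₂ (D₁ x))
    [FiniteDimensional ℝ (LinearMap.ker D₁)] [FiniteDimensional ℝ (LinearMap.ker D₂)]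
    [FiniteDimensional ℝ (LinearMap.ker D₃)] [FiniteDimensional ℝ (X₂ ⧸ LinearMap.range D₁)]
    [FiniteDimensional ℝ (X₃ ⧸ LinearMap.range D₂)] [FiniteDimensional ℝ (X₃ ⧸ LinearMap.range D₃)] :
    DetLine D₁ ⊗[ℝ] DetLine D₂ ≃ₗ[ℝ] DetLine D₃ :=
  (compSeq D₁ D₂ D₃ h).psi

end Composition

/-! ### Fredholm operators and their stabilizations -/

section Fredholm

variable (X Y : Type*) [NormedAddCommGroup X] [NormedSpace ℝ X] [NormedAddCommGroup Y]
  [NormedSpace ℝ Y]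

/-- The space `F(X, Y)` of Fredholm operators, with the operator norm topology. -/
abbrev Fredholm : Type _ := {D : X →L[ℝ] Y // D.IsFredholm}

/-- The space `F^*(X, Y)` of Fredholm operators with trivial cokernel. -/
abbrev SurjFredholm : Type _ := {D : Fredholm X Y // Function.Surjective D.1}

variable {X Y} {N : ℕ}

theorem finite_ker {D : X →L[ℝ] Y} (hD : D.IsFredholm) :
    FiniteDimensional ℝ (LinearMap.ker D.toLinearMap) := hD.finite_ker

theorem finite_coker {D : X →L[ℝ] Y} (hD : D.IsFredholm) :
    FiniteDimensional ℝ (Y ⧸ LinearMap.range D.toLinearMap) := hD.finite_coker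

/-- The stabilization `D_Θ : X ⊕ ℝ^N → Y`, `D_Θ(x, u) = D x + Θ u`. -/
def stabMap (Θ : (Fin N → ℝ) →L[ℝ] Y) (D : X →L[ℝ] Y) : X × (Fin N → ℝ) →L[ℝ] Y :=
  D.coprod Θ

theorem isFredholm_stabMap (Θ : (Fin N → ℝ) →L[ℝ] Y) {D : X →L[ℝ] Y} (hD : D.IsFredholm) :
    (stabMap Θ D).IsFredholm := by
  obtain ⟨v, hv⟩ := hD.exists_isQuasiInverse
  refine ContinuousLinearMap.IsFredholm.of_isQuasiInverse
    (v := (ContinuousLinearMap.inl ℝ X (Fin N → ℝ)).comp v) ⟨?_, ?_⟩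
  · have h1 := (LinearMap.FiniteRangeSetoid.equiv_iff_hasNoetherianRange.mp hv.1).comp_left
      (LinearMap.inl ℝ X (Fin N → ℝ)) |>.comp_right (LinearMap.fst ℝ X (Fin N → ℝ))
    have h2 := (LinearMap.HasNoetherianRange.of_isNoetherian_dom
      (f := LinearMap.inl ℝ X (Fin N → ℝ) ∘ₗ v.toLinearMap ∘ₗ Θ.toLinearMap -
        LinearMap.inr ℝ X (Fin N → ℝ))).comp_right (LinearMap.snd ℝ X (Fin N → ℝ))
    refine LinearMap.FiniteRangeSetoid.equiv_iff_hasNoetherianRange.mpr ?_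
    have e : ((ContinuousLinearMap.inl ℝ X (Fin N → ℝ)).comp v).toLinearMap ∘ₗ
        (stabMap Θ D).toLinearMap - LinearMap.id =
        (LinearMap.inl ℝ X (Fin N → ℝ) ∘ₗ (v.toLinearMap ∘ₗ D.toLinearMap - LinearMap.id)) ∘ₗ
            LinearMap.fst ℝ X (Fin N → ℝ) +
          (LinearMap.inl ℝ X (Fin N → ℝ) ∘ₗ v.toLinearMap ∘ₗ Θ.toLinearMap -
            LinearMap.inr ℝ X (Fin N → ℝ)) ∘ₗ LinearMap.snd ℝ X (Fin N → ℝ) := by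
      ext x <;> simp [stabMap]
    have h3 := h1.add h2
    rw [← e] at h3
    exact h3
  · have h1 := LinearMap.FiniteRangeSetoid.equiv_iff_hasNoetherianRange.mp hv.2
    refine LinearMap.FiniteRangeSetoid.equiv_iff_hasNoetherianRange.mpr ?_
    have e : (stabMap Θ D).toLinearMap ∘ₗ
        ((ContinuousLinearMap.inl ℝ X (Fin N → ℝ)).comp v).toLinearMap - LinearMap.id =
        D.toLinearMap ∘ₗ v.toLinearMap - LinearMap.id := by
      ext x
      simp [stabMap]
    rw [← e] at h1
    exact h1

/-- The stabilization of a Fredholm operator is Fredholm. -/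
def stab (Θ : (Fin N → ℝ) →L[ℝ] Y) (D : Fredholm X Y) : Fredholm (X × (Fin N → ℝ)) Y :=
  ⟨stabMap Θ D.1, isFredholm_stabMap Θ D.2⟩

variable (X N) in
/-- The isomorphism `coker ι_{X;N} → ℝ^N` induced by the projection `X ⊕ ℝ^N → ℝ^N`, where
`ι_{X;N} : X → X ⊕ ℝ^N` is the inclusion. -/
def cokerInl : ((X × (Fin N → ℝ)) ⧸ LinearMap.range (LinearMap.inl ℝ X (Fin N → ℝ))) →ₗ[ℝ]
    (Fin N → ℝ) :=
  (LinearMap.range (LinearMap.inl ℝ X (Fin N → ℝ))).liftQ (LinearMap.snd ℝ X (Fin N → ℝ)) (by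
    rintro _ ⟨x, rfl⟩
    rfl)

variable (X N) in
theorem cokerInl_bijective : Function.Bijective (cokerInl X N) := by
  constructor
  · rw [← LinearMap.ker_eq_bot, cokerInl, Submodule.ker_liftQ_eq_bot]
    rintro ⟨x, u⟩ hu
    exact ⟨x, Prod.ext rfl (LinearMap.mem_ker.mp hu).symm⟩
  · intro u
    exact ⟨Submodule.Quotient.mk (0, u), rfl⟩

variable (X N) in
theorem finrank_coker_inl :
    finrank ℝ ((X × (Fin N → ℝ)) ⧸ LinearMap.range (LinearMap.inl ℝ X (Fin N → ℝ))) =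
      finrank ℝ (Fin N → ℝ) :=
  (LinearEquiv.ofBijective _ (cokerInl_bijective X N)).finrank_eq

instance : FiniteDimensional ℝ
    ((X × (Fin N → ℝ)) ⧸ LinearMap.range (LinearMap.inl ℝ X (Fin N → ℝ))) :=
  FiniteDimensional.of_injective _ (cokerInl_bijective X N).1

variable (X N) in
theorem ker_inl : LinearMap.ker (LinearMap.inl ℝ X (Fin N → ℝ)) = ⊥ :=
  LinearMap.ker_eq_bot.mpr LinearMap.inl_injective

instance : FiniteDimensional ℝ (LinearMap.ker (LinearMap.inl ℝ X (Fin N → ℝ))) := by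
  rw [ker_inl]
  infer_instance

variable (X N) in
theorem finrank_ker_inl : finrank ℝ (LinearMap.ker (LinearMap.inl ℝ X (Fin N → ℝ))) = 0 := by
  rw [ker_inl, finrank_bot]

/-- The standard volume tensor `Ω_N = e₁ ∧ … ∧ e_N` of `ℝ^N`. -/
def stdVol (N : ℕ) : TopPower (Fin N → ℝ) :=
  ⟨ExteriorAlgebra.ιMulti ℝ N (fun k => Pi.single k (1 : ℝ)), by
    rw [Module.finrank_fin_fun]
    exact (exteriorPower.ιMulti ℝ N (fun k => Pi.single k (1 : ℝ))).2⟩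

theorem stdVol_ne_zero (N : ℕ) : stdVol N ≠ 0 := by
  intro h
  refine ιMulti_basis_ne_zero (Pi.basisFun ℝ (Fin N)) ((congrArg _ ?_).trans
    (congrArg Subtype.val h))
  funext k
  rw [Pi.basisFun_apply]

variable (X N) in
/-- The generator `1 ⊗ (Ω_N^* ∘ λ(π₂))` of the determinant line of `ι_{X;N} : X → X ⊕ ℝ^N`. -/
def inlVol : DetLine (LinearMap.inl ℝ X (Fin N → ℝ)) :=
  DetPair.mk (topOne _ (finrank_ker_inl X N))
    (star (stdVol N) ∘ₗ topMap (cokerInl X N) (finrank_coker_inl X N))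

variable (X N) in
theorem inlVol_ne_zero : inlVol X N ≠ 0 := by
  refine DetPair.mk_ne_zero (topOne_ne_zero _) fun h => ?_
  have h1 := topMap_injective (finrank_coker_inl X N) (cokerInl_bijective X N).1
  obtain ⟨v, hv⟩ := exists_ne_zero_of_line (finrank_topPower
    (V := (X × (Fin N → ℝ)) ⧸ LinearMap.range (LinearMap.inl ℝ X (Fin N → ℝ))))
  have h2 : topMap (cokerInl X N) (finrank_coker_inl X N) v ≠ 0 :=
    (map_ne_zero_iff _ h1).mpr hv
  obtain ⟨c, hc, h3⟩ := exists_smul_eq_of_finrank_one finrank_topPower (stdVol_ne_zero N) h2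
  have h4 := LinearMap.congr_fun h v
  rw [LinearMap.comp_apply, h3, map_smul, star_self finrank_topPower (stdVol_ne_zero N)] at h4
  exact hc (by simpa using h4)

/-- The isomorphism `I_{Θ;D} : λ(D_Θ) → λ(D)`, `σ ↦ C_{ι,D_Θ}((1 ⊗ (Ω_N^* ∘ λ(π₂))) ⊗ σ)`, of the
composition `D = D_Θ ∘ ι`, where `ι = ι_{X;N}`. -/
def stabIso (Θ : (Fin N → ℝ) →L[ℝ] Y) (D : Fredholm X Y) :
    DetLine (stab Θ D).1.toLinearMap ≃ₗ[ℝ] DetLine D.1.toLinearMap :=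
  have := finite_ker D.2
  have := finite_coker D.2
  have := finite_ker (stab Θ D).2
  have := finite_coker (stab Θ D).2
  (LinearEquiv.ofBijective (TensorProduct.mk ℝ (DetLine (LinearMap.inl ℝ X (Fin N → ℝ)))
      (DetLine (stab Θ D).1.toLinearMap) (inlVol X N))
      (tmul_left_bijective finrank_detPair (inlVol_ne_zero X N))).trans
    (compIso (LinearMap.inl ℝ X (Fin N → ℝ)) (stab Θ D).1.toLinearMap D.1.toLinearMap fun x => by
      change D.1 x = D.1 x + Θ 0
      rw [map_zero, add_zero])

end Fredholm

/-! ### The determinant line bundles -/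

section Bundle

variable (X Y : Type*) [NormedAddCommGroup X] [NormedSpace ℝ X] [NormedAddCommGroup Y]
  [NormedSpace ℝ Y]

/-- The family of lines `λ(D)` over `F(X, Y)`; its total space is `det_{X,Y}`. -/
def detFamily (D : Fredholm X Y) : Type _ := DetLine D.1.toLinearMap

instance (D : Fredholm X Y) : AddCommGroup (detFamily X Y D) :=
  inferInstanceAs (AddCommGroup (DetLine D.1.toLinearMap))

instance (D : Fredholm X Y) : Module ℝ (detFamily X Y D) :=
  inferInstanceAs (Module ℝ (DetLine D.1.toLinearMap))

/-- The restriction of the family `λ(D)` to `F^*(X, Y)`. -/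
def surjDetFamily (D : SurjFredholm X Y) : Type _ := DetLine D.1.1.toLinearMap

instance (D : SurjFredholm X Y) : AddCommGroup (surjDetFamily X Y D) :=
  inferInstanceAs (AddCommGroup (DetLine D.1.1.toLinearMap))

instance (D : SurjFredholm X Y) : Module ℝ (surjDetFamily X Y D) :=
  inferInstanceAs (Module ℝ (DetLine D.1.1.toLinearMap))

/-- The standard topology of the finite-dimensional real vector space `λ(D)`. -/
instance (D : SurjFredholm X Y) : TopologicalSpace (surjDetFamily X Y D) :=
  moduleTopology ℝ _

variable {X Y}

/-- Bounded right inverses of `D`. -/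
abbrev RightInv (D : SurjFredholm X Y) : Type _ := {T : Y →L[ℝ] X // ∀ y, D.1.1 (T y) = y}

/-- The map `Φ_{D,T} : ker D' → ker D`, `x ↦ x - T D x`. -/
def kerMap (D : SurjFredholm X Y) (T : RightInv D) (D' : SurjFredholm X Y) :
    LinearMap.ker D'.1.1.toLinearMap →ₗ[ℝ] LinearMap.ker D.1.1.toLinearMap :=
  ((LinearMap.id - T.1.toLinearMap ∘ₗ D.1.1.toLinearMap).codRestrict
      (LinearMap.ker D.1.1.toLinearMap) fun x => by
    change D.1.1 (x - T.1 (D.1.1 x)) = 0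
    rw [map_sub, T.2, sub_self]).domRestrict (LinearMap.ker D'.1.1.toLinearMap)

/-- The neighborhood `U_{D,T}` of `D` in `F^*(X, Y)` where `Φ_{D,T}` is an isomorphism. -/
def kerDomain (D : SurjFredholm X Y) (T : RightInv D) : Set (SurjFredholm X Y) :=
  {D' | Function.Bijective (kerMap D T D')}

theorem finrank_coker_surj (D : SurjFredholm X Y) :
    finrank ℝ (Y ⧸ LinearMap.range D.1.1.toLinearMap) = 0 := by
  have : Subsingleton (Y ⧸ LinearMap.range D.1.1.toLinearMap) :=
    Submodule.Quotient.subsingleton_iff.mpr (LinearMap.range_eq_top.mpr D.2)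
  exact finrank_zero_of_subsingleton

/-- The trivialization `U_{D,T} × λ(D) → det`, `(D', x ⊗ α) ↦ λ(Φ⁻¹)x ⊗ α`, where
`λ^*(coker D) = ℝ^* = λ^*(coker D')`; the latter identification is induced by the zero map
`coker D' = 0 → 0 = coker D`. -/
def surjChart (D : SurjFredholm X Y) (T : RightInv D) (p : kerDomain D T × surjDetFamily X Y D) :
    TotalSpace ℝ (surjDetFamily X Y) :=
  ⟨p.1.1, TensorProduct.map
    (topMap (LinearEquiv.ofBijective (kerMap D T p.1.1) p.1.2).symm.toLinearMap
      (LinearEquiv.ofBijective (kerMap D T p.1.1) p.1.2).symm.finrank_eq)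
    (Dual.transpose (R := ℝ) (topMap
      (0 : (Y ⧸ LinearMap.range p.1.1.1.1.toLinearMap) →ₗ[ℝ] (Y ⧸ LinearMap.range D.1.1.toLinearMap))
      ((finrank_coker_surj p.1.1).trans (finrank_coker_surj D).symm))) p.2⟩

/-- The topology of `det_{X,Y}|_{F^*(X,Y)}` obtained by gluing the trivializations
`U_{D,T} × λ(D) → det_{X,Y}|_{F^*(X,Y)}`: a set is open if and only if its preimage under
every one of them is open. -/
instance : TopologicalSpace (TotalSpace ℝ (surjDetFamily X Y)) :=
  ⨆ (D : SurjFredholm X Y) (T : RightInv D), TopologicalSpace.coinduced (surjChart D T) inferInstance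

variable {N N₁ N₂ : ℕ}

/-- The set `U_{X;Θ}` of the Fredholm operators `D` for which `D_Θ` is surjective. -/
def stabDomain (Θ : (Fin N → ℝ) →L[ℝ] Y) : Set (Fredholm X Y) :=
  {D | Function.Surjective (stab Θ D).1}

/-- The map `ι_Θ : D ↦ D_Θ` on a set `U ⊆ U_{X;Θ}`. -/
def stabOn (Θ : (Fin N → ℝ) →L[ℝ] Y) {U : Set (Fredholm X Y)} (hU : U ⊆ stabDomain Θ) (D : U) :
    SurjFredholm (X × (Fin N → ℝ)) Y :=
  ⟨stab Θ D.1, hU D.2⟩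

/-- The restriction to `U ⊆ U_{X;Θ}` of the pullback bundle `ι_Θ^* det_{X ⊕ ℝ^N, Y}`. -/
abbrev StabBundle (Θ : (Fin N → ℝ) →L[ℝ] Y) {U : Set (Fredholm X Y)} (hU : U ⊆ stabDomain Θ) :
    Type _ :=
  TotalSpace ℝ (stabOn Θ hU *ᵖ (surjDetFamily (X × (Fin N → ℝ)) Y))

/-- The transition map `I_{Θ₂;D}⁻¹ ∘ I_{Θ₁;D}` over `U_{X;Θ₁} ∩ U_{X;Θ₂}`. -/
def transition (Θ₁ : (Fin N₁ → ℝ) →L[ℝ] Y) (Θ₂ : (Fin N₂ → ℝ) →L[ℝ] Y)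
    (p : StabBundle (X := X) Θ₁ (U := stabDomain Θ₁ ∩ stabDomain Θ₂) Set.inter_subset_left) :
    StabBundle (X := X) Θ₂ (U := stabDomain Θ₁ ∩ stabDomain Θ₂) Set.inter_subset_right :=
  ⟨p.proj, (stabIso Θ₂ p.proj.1).symm (stabIso Θ₁ p.proj.1 p.snd)⟩

/-- The bundle map `ι_Θ^* det_{X ⊕ ℝ^N, Y} → det_{X,Y}`, `σ ↦ I_{Θ;D} σ`, over `U_{X;Θ}`. -/
def stabChart (Θ : (Fin N → ℝ) →L[ℝ] Y)
    (p : StabBundle (X := X) Θ (U := stabDomain Θ) subset_rfl) :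
    TotalSpace ℝ (detFamily X Y) :=
  ⟨p.proj.1, stabIso Θ p.proj.1 p.snd⟩

/-- A topology on the total space of a family of real lines makes it a line bundle: near every
point of the base there is a local trivialization that is linear on the fibers. -/
def IsLineBundle {B : Type*} [TopologicalSpace B] (E : B → Type*) [∀ b, AddCommGroup (E b)]
    [∀ b, Module ℝ (E b)] [TopologicalSpace (TotalSpace ℝ E)] : Prop :=
  ∀ b : B, ∃ e : Trivialization ℝ (TotalSpace.proj : TotalSpace ℝ E → B),
    b ∈ e.baseSet ∧ e.IsLinear ℝ

end Bundle

end FredholmDet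

end

/-! Call a surjective operator S : Z → Y framed by a bounded map A : Z → ℝⁿ when (S, A) : Z → Y ⊕ ℝⁿ
is bijective. Then A identifies ker S with ℝⁿ, and Ω_n becomes a generator of λ(S). Between Banach
spaces (S, A) has a bounded inverse, invertibility is an open condition and inversion is continuous,
so a change of framing multiplies the generator by a determinant that varies continuously with S.
These generators therefore glue to a topology. It is the given one, because U_{D,T} is exactly the
set framed by φ ∘ (id - T D) for any coordinates φ : ker D ≃ ℝⁿ (`isOpenEmbedding_surjFrame`).

Over all Fredholm operators the dimensions of ker D and coker D jump, but a framing A of D_Θ still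
gives a generator of λ(D), namely the image under I_{Θ;D} of the generator of λ(D_Θ). The crux is to
compare the generators of (Θ₁, A₁) and (Θ₂, A₂) at one D (`stabFrame_eq_smul_stabFrame`). The
solutions of D x + Θ₁ p₁ + Θ₂ p₂ = 0 carry two coordinate systems, (A₁(x, p₁), p₂) and (A₂(x, p₂),
p₁). The change of coordinates M has the fixed size n₁ + N₂ = n₂ + N₁, its entries are continuous in
D, and the ratio of the generators is ±det M. This is checked pointwise: bases of ker D and coker D
extend to bases adapted to both stabilizations, in which M relates two block triangular matrices.

The sign matters for continuity. The exponent ε and the block permutations each contribute signs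
that depend on the jumping dimensions of ker D and coker D. These combine into one that depends only
on n₁, N₁, N₂, hence is constant over the overlap.

What remains is gluing. The generators define a topology on det in which every stabilization chart
is an open embedding (`isOpenEmbedding_stabChart`). Continuity of the transitions follows, and the
charts cover, so they determine the topology. -/

noncomputable section

open Module TensorProduct Bundle Topology Filter

namespace FredholmDet

/-! ### Wedge products of vectors in top exterior powers -/

section TopWedge

variable {V V' V'' W : Type*} [AddCommGroup V] [Module ℝ V] [AddCommGroup V'] [Module ℝ V']
  [AddCommGroup V''] [Module ℝ V''] [AddCommGroup W] [Module ℝ W] {m n k : ℕ}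

/-- The element `b₁ ∧ … ∧ bₙ` of `λ(V)`, where `n = dim V`. -/
def topWedge (h : finrank ℝ V = n) (b : Fin n → V) : TopPower V :=
  ⟨ExteriorAlgebra.ιMulti ℝ n b, by
    rw [h]
    exact (exteriorPower.ιMulti ℝ n b).2⟩

theorem topMap_topWedge (f : V →ₗ[ℝ] W) (h : finrank ℝ V = finrank ℝ W) (hV : finrank ℝ V = n)
    (hW : finrank ℝ W = n) (b : Fin n → V) :
    topMap f h (topWedge hV b) = topWedge hW (f ∘ b) :=
  Subtype.ext (ExteriorAlgebra.map_apply_ιMulti f b)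

theorem topOne_eq_topWedge (h : finrank ℝ V = 0) (b : Fin 0 → V) : topOne V h = topWedge h b :=
  Subtype.ext (ExteriorAlgebra.ιMulti_zero_apply b).symm

theorem topMap_topOne (f : V →ₗ[ℝ] W) (h : finrank ℝ V = finrank ℝ W) (hV : finrank ℝ V = 0)
    (hW : finrank ℝ W = 0) : topMap f h (topOne V hV) = topOne W hW :=
  Subtype.ext (map_one (ExteriorAlgebra.map f))

theorem topMap_topMap {V₁ V₂ V₃ : Type*} [AddCommGroup V₁] [Module ℝ V₁] [AddCommGroup V₂]
    [Module ℝ V₂] [AddCommGroup V₃] [Module ℝ V₃] (f : V₁ →ₗ[ℝ] V₂) (g : V₂ →ₗ[ℝ] V₃)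
    (h : finrank ℝ V₁ = finrank ℝ V₂) (h' : finrank ℝ V₂ = finrank ℝ V₃) (x : TopPower V₁) :
    topMap g h' (topMap f h x) = topMap (g ∘ₗ f) (h.trans h') x := by
  refine Subtype.ext ?_
  change ExteriorAlgebra.map g (ExteriorAlgebra.map f (x : ExteriorAlgebra ℝ V₁)) =
    ExteriorAlgebra.map (g ∘ₗ f) (x : ExteriorAlgebra ℝ V₁)
  rw [← AlgHom.comp_apply, ExteriorAlgebra.map_comp_map]

theorem ιMulti_append (x : Fin m → V) (z : Fin n → V) :
    ExteriorAlgebra.ιMulti ℝ (m + n) (Fin.append x z) =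
      ExteriorAlgebra.ιMulti ℝ m x * ExteriorAlgebra.ιMulti ℝ n z := by
  have h : (fun k => ExteriorAlgebra.ι ℝ (Fin.append x z k)) =
      Fin.append (fun k => ExteriorAlgebra.ι ℝ (x k)) (fun k => ExteriorAlgebra.ι ℝ (z k)) := by
    funext k
    refine Fin.addCases (fun k => ?_) (fun k => ?_) k <;> simp
  rw [ExteriorAlgebra.ιMulti_apply, h, List.ofFn_fin_append, List.prod_append,
    ← ExteriorAlgebra.ιMulti_apply, ← ExteriorAlgebra.ιMulti_apply]

/-- The vectors z are themselves a lift of their images under j, so `wedge_lift` applies without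
reference to the chosen section. -/
theorem wedge_topWedge [FiniteDimensional ℝ V] {i : V' →ₗ[ℝ] V} {j : V →ₗ[ℝ] V''}
    (hi : Function.Injective i) (hij : Function.Exact i j) (hj : Function.Surjective j)
    (hV' : finrank ℝ V' = m) (hV'' : finrank ℝ V'' = n) (hV : finrank ℝ V = m + n)
    (x : Fin m → V') (z : Fin n → V) :
    wedge i j hi hij hj (topWedge hV' x) (topWedge hV'' (j ∘ z)) =
      topWedge hV (Fin.append (i ∘ x) z) := by
  refine Subtype.ext ?_
  have e : ExteriorAlgebra.map j (ExteriorAlgebra.ιMulti ℝ n z) =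
      ExteriorAlgebra.ιMulti ℝ n (j ∘ z) := ExteriorAlgebra.map_apply_ιMulti j z
  have hw : ExteriorAlgebra.map j (ExteriorAlgebra.ιMulti ℝ n z) ∈ ⋀[ℝ]^(finrank ℝ V'') V'' := by
    rw [e]
    exact (topWedge hV'' (j ∘ z)).2
  have h1 := wedge_lift hi hij hj (topWedge hV' x) _ hw
  have h2 : (⟨_, hw⟩ : TopPower V'') = topWedge hV'' (j ∘ z) := Subtype.ext e
  rw [h2] at h1
  rw [h1]
  change ExteriorAlgebra.map i (ExteriorAlgebra.ιMulti ℝ m x) * _ =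
    ExteriorAlgebra.ιMulti ℝ (m + n) (Fin.append (i ∘ x) z)
  rw [ιMulti_append, ExteriorAlgebra.map_apply_ιMulti]

theorem topWedge_basis_ne_zero (b : Basis (Fin n) ℝ V) (h : finrank ℝ V = n) :
    topWedge h b ≠ 0 := fun h0 =>
  ιMulti_basis_ne_zero b (congrArg Subtype.val h0)

/-- The matrix whose columns are the vectors `b₁, …, bₙ` of `ℝ^m`. -/
abbrev colMatrix {ι κ : Type*} (b : κ → ι → ℝ) : Matrix ι κ ℝ := Matrix.of fun i j => b j i

theorem stdVol_eq_topWedge (n : ℕ) (h : finrank ℝ (Fin n → ℝ) = n) :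
    stdVol n = topWedge h (Pi.basisFun ℝ (Fin n)) := by
  refine Subtype.ext ?_
  change ExteriorAlgebra.ιMulti ℝ n _ = ExteriorAlgebra.ιMulti ℝ n _
  congr 1
  funext k
  rw [Pi.basisFun_apply]

theorem topWedge_eq_det_smul_stdVol (h : finrank ℝ (Fin n → ℝ) = n) (b : Fin n → Fin n → ℝ) :
    topWedge h b = (colMatrix b).det • stdVol n := by
  refine Subtype.ext ?_
  rw [stdVol_eq_topWedge n h]
  change ExteriorAlgebra.ιMulti ℝ n b =
    (colMatrix b).det • ExteriorAlgebra.ιMulti ℝ n (Pi.basisFun ℝ (Fin n))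
  have e : ExteriorAlgebra.ιMulti ℝ n (M := Fin n → ℝ) =
      (LinearMap.toSpanSingleton ℝ (ExteriorAlgebra ℝ (Fin n → ℝ))
        (ExteriorAlgebra.ιMulti ℝ n (Pi.basisFun ℝ (Fin n)))).compAlternatingMap
        (Pi.basisFun ℝ (Fin n)).det := by
    -- Two alternating maps agree once they agree on distinct basis vectors. Here these form a
    -- permutation of the basis, and both sides acquire its sign.
    refine (Pi.basisFun ℝ (Fin n)).ext_alternating fun v hv => ?_
    let σ : Equiv.Perm (Fin n) := Equiv.ofBijective v (Finite.injective_iff_bijective.mp hv)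
    have h1 := (ExteriorAlgebra.ιMulti ℝ n (M := Fin n → ℝ)).map_perm (Pi.basisFun ℝ (Fin n)) σ
    have h2 := (Pi.basisFun ℝ (Fin n)).det.map_perm (Pi.basisFun ℝ (Fin n)) σ
    change ExteriorAlgebra.ιMulti ℝ n (Pi.basisFun ℝ (Fin n) ∘ σ) =
      (Pi.basisFun ℝ (Fin n)).det (Pi.basisFun ℝ (Fin n) ∘ σ) • _
    rw [h2, Basis.det_self, h1, Units.smul_def, Units.smul_def, smul_assoc, one_smul]
  have h3 := congrArg (fun f => f b) e
  change ExteriorAlgebra.ιMulti ℝ n b = (Pi.basisFun ℝ (Fin n)).det b • _ at h3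
  rw [h3, Basis.det_apply]
  congr 2

theorem topWedge_eq_det_smul (φ : V ≃ₗ[ℝ] (Fin n → ℝ)) (h : finrank ℝ V = n) (b : Fin n → V) :
    topWedge h b =
      (colMatrix fun j => φ (b j)).det • topMap φ.symm.toLinearMap φ.symm.finrank_eq (stdVol n) := by
  have hn := finrank_fin_fun ℝ (n := n)
  rw [← map_smul]
  have := topWedge_eq_det_smul_stdVol hn fun j => φ (b j)
  rw [← this, topMap_topWedge _ _ hn h]
  congr 1
  funext j
  exact (φ.symm_apply_apply _).symm

end TopWedge

/-! ### Six-term sequences with vanishing ends -/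

namespace SixTerm

variable {A₁ A₂ A₃ B₁ B₂ B₃ : Type*} [AddCommGroup A₁] [Module ℝ A₁] [AddCommGroup A₂] [Module ℝ A₂]
  [AddCommGroup A₃] [Module ℝ A₃] [AddCommGroup B₁] [Module ℝ B₁] [AddCommGroup B₂] [Module ℝ B₂]
  [AddCommGroup B₃] [Module ℝ B₃]
  [FiniteDimensional ℝ A₁] [FiniteDimensional ℝ A₂] [FiniteDimensional ℝ A₃]
  [FiniteDimensional ℝ B₁] [FiniteDimensional ℝ B₂] [FiniteDimensional ℝ B₃]
  (S : SixTerm A₁ A₂ A₃ B₁ B₂ B₃)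

/-- With vanishing ends the sequence is 0 → A₂ → A₃ → B₁ → B₂ → 0. Every dimension is then
determined by a = dim A₂, r = dim im δ and c = dim B₂, and the defining formula of Ψ can be
evaluated on honest vectors instead of classes in quotients. -/
theorem psi_topWedge (h₁ : finrank ℝ A₁ = 0) (h₃ : finrank ℝ B₃ = 0) {a r c : ℕ}
    (ha : finrank ℝ A₂ = a) (hr : finrank ℝ A₃ = a + r) (hc : finrank ℝ B₁ = r + c)
    (hB₂ : finrank ℝ B₂ = c) (u : Fin a → A₂) (v : Fin r → A₃) (w : Fin c → B₁)
    (huv : topWedge hr (Fin.append (S.j ∘ u) v) ≠ 0)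
    (hvw : topWedge hc (Fin.append (S.δ ∘ v) w) ≠ 0) :
    S.psi (DetPair.mk (topOne A₁ h₁) (star (topWedge hc (Fin.append (S.δ ∘ v) w))) ⊗ₜ
        DetPair.mk (topWedge hr (Fin.append (S.j ∘ u) v)) (star (topOne B₃ h₃))) =
      (-1 : ℝ) ^ (a * (r + c) + r) •
        DetPair.mk (topWedge ha u) (star (topWedge hB₂ (S.i' ∘ w))) := by
  have d₁ : finrank ℝ (LinearMap.range S.i) = 0 := by
    rw [LinearMap.finrank_range_of_inj S.inj, h₁]
  have d₂ : finrank ℝ (A₂ ⧸ LinearMap.range S.i) = a := by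
    have := Submodule.finrank_quotient_add_finrank (LinearMap.range S.i)
    omega
  have d₃ : finrank ℝ (LinearMap.range S.j) = a := by
    have := S.j.finrank_range_add_finrank_ker
    rw [S.exact_ij.linearMap_ker_eq] at this
    omega
  have d₄ : finrank ℝ (A₃ ⧸ LinearMap.range S.j) = r := by
    have := Submodule.finrank_quotient_add_finrank (LinearMap.range S.j)
    omega
  have d₅ : finrank ℝ (LinearMap.range S.δ) = r := by
    have := S.δ.finrank_range_add_finrank_ker
    rw [S.exact_jδ.linearMap_ker_eq] at this
    omega
  have d₆ : finrank ℝ (B₁ ⧸ LinearMap.range S.δ) = c := by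
    have := Submodule.finrank_quotient_add_finrank (LinearMap.range S.δ)
    omega
  have d₇ : finrank ℝ (B₂ ⧸ LinearMap.range S.i') = 0 :=
    (LinearEquiv.ofBijective _ S.quotLift_bijective).finrank_eq.trans h₃
  -- The quotient classes of u, v, w serve as the elements u, v, w in the formula for Ψ; x and y are
  -- units of zero-dimensional spaces.
  set u' := topWedge d₂ ((LinearMap.range S.i).mkQ ∘ u)
  set v' := topWedge d₄ ((LinearMap.range S.j).mkQ ∘ v)
  set w' := topWedge d₆ ((LinearMap.range S.δ).mkQ ∘ w)
  set y' := topOne (B₂ ⧸ LinearMap.range S.i') d₇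
  have e₁ : S.wedgeA₃ u' v' = topWedge hr (Fin.append (S.j ∘ u) v) :=
    wedge_topWedge _ _ _ d₂ d₄ hr _ v
  have e₂ : S.wedgeB₁ v' w' = topWedge hc (Fin.append (S.δ ∘ v) w) :=
    wedge_topWedge _ _ _ d₄ d₆ hc _ w
  have e₃ : S.mapB₃ y' = topOne B₃ h₃ := topMap_topOne _ _ _ _
  have e₄ : S.wedgeA₂ (topOne A₁ h₁) u' = topWedge ha u := by
    rw [topOne_eq_topWedge h₁ Fin.elim0]
    refine (wedge_topWedge _ _ _ h₁ d₂ (ha.trans (zero_add a).symm) _ u).trans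
      (Subtype.ext ?_)
    change ExteriorAlgebra.ιMulti ℝ (0 + a) _ = ExteriorAlgebra.ιMulti ℝ a u
    rw [ιMulti_append, ExteriorAlgebra.ιMulti_zero_apply, one_mul]
  have e₅ : S.wedgeB₂ w' y' = topWedge hB₂ (S.i' ∘ w) := by
    have h0 : y' = topWedge d₇ ((LinearMap.range S.i').mkQ ∘ Fin.elim0) :=
      topOne_eq_topWedge d₇ _
    rw [h0]
    refine (wedge_topWedge _ _ _ d₆ d₇ hB₂ _ Fin.elim0).trans (Subtype.ext ?_)
    change ExteriorAlgebra.ιMulti ℝ (c + 0) _ = ExteriorAlgebra.ιMulti ℝ c (S.i' ∘ w)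
    rw [ιMulti_append, ExteriorAlgebra.ιMulti_zero_apply, mul_one]
    rfl
  rw [← e₁] at huv
  rw [← e₂] at hvw
  have hu : u' ≠ 0 := fun h => huv (by rw [h, map_zero, LinearMap.zero_apply])
  have hv : v' ≠ 0 := fun h => huv (by rw [h, map_zero])
  have hw : w' ≠ 0 := fun h => hvw (by rw [h, map_zero])
  have key := S.psi_source (topOne_ne_zero h₁) hu hv hw (topOne_ne_zero d₇)
  rw [source, target, e₁, e₂, e₃, e₄, e₅] at key
  rw [key]
  congr 1
  rw [signExp, hr, h₃, hc, hB₂, d₅]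
  -- Here ε = (a + r)(r + c) + c r, which has the parity of a(r + c) + r because r² ≡ r mod 2.
  have e₆ : (((a + r : ℕ) : ℤ) - (0 : ℕ)) * ((r + c : ℕ) : ℤ) + (c : ℤ) * (r : ℤ) =
      ((a * (r + c) + r * r + 2 * (r * c) : ℕ) : ℤ) := by
    push_cast
    ring
  rw [e₆, zpow_natCast, pow_add, pow_mul _ 2, neg_one_sq, one_pow, mul_one, pow_add, pow_add]
  congr 1
  rcases Nat.even_or_odd r with h | h
  · rw [h.neg_one_pow, (h.mul_left r).neg_one_pow]
  · rw [h.neg_one_pow, (h.mul h).neg_one_pow]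

end SixTerm

/-! ### Block permutations and block determinants -/

section Blocks

theorem finRotate_pow_val (n k : ℕ) (i : Fin n) :
    ((finRotate n ^ k) i : ℕ) = (i + k) % n := by
  induction k with
  | zero => simp [Nat.mod_eq_of_lt i.2]
  | succ k ih =>
    obtain ⟨m, rfl⟩ : ∃ m, n = m + 1 := ⟨n - 1, by have := i.2; omega⟩
    rw [pow_succ', Equiv.Perm.mul_apply, finRotate_apply, Fin.val_add, ih, Fin.val_one',
      ← Nat.add_mod, add_assoc]

/-- The order preserving identification of `Fin m ⊕ Fin n` with `Fin m' ⊕ Fin n'`. -/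
def sumFinCast {m n m' n' : ℕ} (h : m + n = m' + n') : Fin m ⊕ Fin n ≃ Fin m' ⊕ Fin n' :=
  finSumFinEquiv.trans ((finCongr h).trans finSumFinEquiv.symm)

theorem finSumFinEquiv_sumFinCast_val {m n m' n' : ℕ} (h : m + n = m' + n')
    (x : Fin m ⊕ Fin n) :
    (finSumFinEquiv (sumFinCast h x) : ℕ) = (finSumFinEquiv x : ℕ) := by
  simp [sumFinCast]

/-- Read on Fin (p + q), the exchange of the two blocks is the q-th power of the rotation by one,
whose sign is (-1)^(p+q-1). The exponent (p + q - 1) q has the parity of p q, since q(q - 1) is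
even. -/
theorem sign_sumComm (p q : ℕ) :
    Equiv.Perm.sign ((Equiv.sumComm (Fin p) (Fin q)).trans (sumFinCast (add_comm q p))) =
      (-1) ^ (p * q) := by
  have h : (finSumFinEquiv.symm.trans ((Equiv.sumComm (Fin p) (Fin q)).trans
      (sumFinCast (add_comm q p)))).trans finSumFinEquiv = finRotate (p + q) ^ q := by
    ext i
    obtain ⟨i, rfl⟩ := finSumFinEquiv.surjective i
    simp only [Equiv.trans_apply, Equiv.symm_apply_apply, finSumFinEquiv_sumFinCast_val]
    rw [finRotate_pow_val]
    rcases i with i | i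
    · simp only [Equiv.sumComm_apply, Sum.swap_inl, finSumFinEquiv_apply_right, Fin.val_natAdd,
        finSumFinEquiv_apply_left, Fin.val_castAdd]
      rw [Nat.mod_eq_of_lt (by have := i.2; omega), add_comm]
    · simp only [Equiv.sumComm_apply, Sum.swap_inr, finSumFinEquiv_apply_right, Fin.val_natAdd,
        finSumFinEquiv_apply_left, Fin.val_castAdd]
      rw [show p + (i : ℕ) + q = i + (p + q) by ring, Nat.add_mod_right,
        Nat.mod_eq_of_lt (by have := i.2; omega)]
  have h1 := Equiv.Perm.sign_symm_trans_trans ((Equiv.sumComm (Fin p) (Fin q)).trans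
      (sumFinCast (add_comm q p))) finSumFinEquiv
  rw [← h1, h, map_pow, sign_finRotate, ← pow_mul]
  rcases q with _ | q
  · simp
  · rw [show p + (q + 1) - 1 = p + q by omega, add_mul, pow_add,
      (Nat.even_mul_succ_self q).neg_one_pow, mul_one]

/-- The rearrangement of `(a, r₂), (r₁, c)` into `(a, r₁), (r₂, c)`. -/
def blockSwap (a r₁ r₂ c : ℕ) :
    Fin (a + r₂) ⊕ Fin (r₁ + c) ≃ Fin (a + r₁) ⊕ Fin (r₂ + c) :=
  (Equiv.sumCongr finSumFinEquiv.symm finSumFinEquiv.symm).trans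
    ((Equiv.sumSumSumComm (Fin a) (Fin r₂) (Fin r₁) (Fin c)).trans
      (Equiv.sumCongr finSumFinEquiv finSumFinEquiv))

/-- After flattening, the permutation fixes the outer blocks a and c and exchanges the middle blocks
r₂ and r₁. The regrouping `T` conjugates it to `R`, so that `sign_sumComm` gives the sign. -/
theorem sign_blockSwap {a r₁ r₂ c : ℕ} (h : a + r₁ + (r₂ + c) = a + r₂ + (r₁ + c)) :
    Equiv.Perm.sign ((sumFinCast h).trans (blockSwap a r₁ r₂ c)) = (-1) ^ (r₁ * r₂) := by
  let T (p q : ℕ) : Fin a ⊕ ((Fin p ⊕ Fin q) ⊕ Fin c) ≃ Fin (a + p) ⊕ Fin (q + c) :=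
    (Equiv.sumCongr (Equiv.refl _) (Equiv.sumAssoc _ _ _)).trans
      ((Equiv.sumAssoc _ _ _).symm.trans (Equiv.sumCongr finSumFinEquiv finSumFinEquiv))
  let ρ := (Equiv.sumComm (Fin r₂) (Fin r₁)).trans (sumFinCast (add_comm r₁ r₂))
  let R : Equiv.Perm (Fin a ⊕ ((Fin r₂ ⊕ Fin r₁) ⊕ Fin c)) :=
    Equiv.sumCongr (Equiv.refl _) (Equiv.sumCongr ρ (Equiv.refl _))
  have hval : ∀ (p q : ℕ) (y : Fin a ⊕ ((Fin p ⊕ Fin q) ⊕ Fin c)),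
      (finSumFinEquiv (T p q y) : ℕ) =
        Sum.elim (fun i : Fin a => (i : ℕ)) (Sum.elim
          (fun s : Fin p ⊕ Fin q => a + (finSumFinEquiv s : ℕ))
          (fun k : Fin c => a + p + (q + (k : ℕ)))) y := by
    rintro p q (i | (i | i) | i) <;> simp [T, add_assoc]
  have hT : ∀ y, sumFinCast h ((blockSwap a r₁ r₂ c) (T r₂ r₁ y)) = T r₂ r₁ (R y) := by
    intro y
    apply finSumFinEquiv.injective
    apply Fin.ext
    rw [finSumFinEquiv_sumFinCast_val, hval]
    have hb : blockSwap a r₁ r₂ c (T r₂ r₁ y) =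
        T r₁ r₂ (Sum.map id (Sum.map Sum.swap id) y) := by
      rcases y with i | (i | i) | i <;> simp [T, blockSwap]
    rw [hb, hval]
    rcases y with i | s | i
    · simp [R]
    · change a + _ = a + (finSumFinEquiv (ρ s) : ℕ)
      rw [Equiv.trans_apply, finSumFinEquiv_sumFinCast_val]
      rfl
    · simp [R]
      omega
  have hconj : ((T r₂ r₁).symm.trans R).trans (T r₂ r₁) =
      (blockSwap a r₁ r₂ c).trans (sumFinCast h) := by
    ext1 x
    obtain ⟨y, rfl⟩ := (T r₂ r₁).surjective x
    simp only [Equiv.trans_apply, Equiv.symm_apply_apply]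
    exact (hT y).symm
  have h1 := Equiv.Perm.sign_symm_trans_trans R (T r₂ r₁)
  rw [hconj] at h1
  have h2 := Equiv.Perm.sign_symm_trans_trans ((sumFinCast h).trans (blockSwap a r₁ r₂ c))
    (sumFinCast h)
  have h3 : ((sumFinCast h).symm.trans ((sumFinCast h).trans (blockSwap a r₁ r₂ c))).trans
      (sumFinCast h) = (blockSwap a r₁ r₂ c).trans (sumFinCast h) := by
    ext1 x
    simp
  rw [h3, h1] at h2
  rw [← h2, Equiv.Perm.sign_sumCongr, Equiv.Perm.sign_sumCongr, Equiv.Perm.sign_refl,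
    Equiv.Perm.sign_refl, one_mul, mul_one, sign_sumComm, mul_comm]

theorem det_neg_right_cols {r c : ℕ} (v : Fin r → Fin (r + c) → ℝ) (w : Fin c → Fin (r + c) → ℝ) :
    (colMatrix (Fin.append v (fun k => -w k))).det =
      (-1) ^ c * (colMatrix (Fin.append v w)).det := by
  have h := Matrix.det_mul_row (Fin.append (fun _ : Fin r => (1 : ℝ)) (fun _ : Fin c => -1))
    (colMatrix (Fin.append v w))
  rw [Fin.prod_univ_add] at h
  simp only [Fin.append_left, Fin.append_right, Finset.prod_const_one, Finset.prod_const,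
    Finset.card_univ, Fintype.card_fin, one_mul] at h
  rw [← h]
  congr 1
  ext i j
  refine Fin.addCases (fun j => ?_) (fun j => ?_) j <;> simp

theorem det_neg_left_cols {r c : ℕ} (v : Fin r → Fin (r + c) → ℝ) (w : Fin c → Fin (r + c) → ℝ) :
    (colMatrix (Fin.append (fun k => -v k) w)).det =
      (-1) ^ r * (colMatrix (Fin.append v w)).det := by
  have h := Matrix.det_mul_row (Fin.append (fun _ : Fin r => (-1 : ℝ)) (fun _ : Fin c => 1))
    (colMatrix (Fin.append v w))
  rw [Fin.prod_univ_add] at h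
  simp only [Fin.append_left, Fin.append_right, Finset.prod_const_one, Finset.prod_const,
    Finset.card_univ, Fintype.card_fin, mul_one] at h
  rw [← h]
  congr 1
  ext i j
  refine Fin.addCases (fun j => ?_) (fun j => ?_) j <;> simp

/-- Comparison of determinants: the matrix `M` carries the columns of
`[P₁ Q₁ T₁ Z₁; 0 0 V₂ W₂]` to those of `[P₂ T₂ Q₂ Z₂; 0 V₁ 0 -W₁]`. -/
theorem det_block_comparison {a r₁ r₂ c : ℕ} (h : a + r₁ + (r₂ + c) = a + r₂ + (r₁ + c))
    (M : Matrix (Fin (a + r₂) ⊕ Fin (r₁ + c)) (Fin (a + r₁) ⊕ Fin (r₂ + c)) ℝ)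
    (P₁ : Fin a → Fin (a + r₁) → ℝ) (Q₁ : Fin r₁ → Fin (a + r₁) → ℝ)
    (T₁ : Fin r₂ → Fin (a + r₁) → ℝ) (Z₁ : Fin c → Fin (a + r₁) → ℝ)
    (V₁ : Fin r₁ → Fin (r₁ + c) → ℝ)
    (W₁ : Fin c → Fin (r₁ + c) → ℝ)
    (P₂ : Fin a → Fin (a + r₂) → ℝ) (Q₂ : Fin r₂ → Fin (a + r₂) → ℝ)
    (T₂ : Fin r₁ → Fin (a + r₂) → ℝ) (Z₂ : Fin c → Fin (a + r₂) → ℝ)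
    (V₂ : Fin r₂ → Fin (r₂ + c) → ℝ)
    (W₂ : Fin c → Fin (r₂ + c) → ℝ)
    (hu : ∀ k, M.mulVec (Sum.elim (P₁ k) 0) = Sum.elim (P₂ k) 0)
    (h₁ : ∀ k, M.mulVec (Sum.elim (Q₁ k) 0) = Sum.elim (T₂ k) (V₁ k))
    (h₂ : ∀ k, M.mulVec (Sum.elim (T₁ k) (V₂ k)) = Sum.elim (Q₂ k) 0)
    (hz : ∀ k, M.mulVec (Sum.elim (Z₁ k) (W₂ k)) = Sum.elim (Z₂ k) (-W₁ k)) :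
    (M.submatrix (sumFinCast h) id).det *
        ((colMatrix (Fin.append P₁ Q₁)).det * (colMatrix (Fin.append V₂ W₂)).det) =
      (-1) ^ (r₁ * r₂ + c) *
        ((colMatrix (Fin.append P₂ Q₂)).det * (colMatrix (Fin.append V₁ W₁)).det) := by
  -- The four families of columns are grouped so that both matrices are block upper triangular. In
  -- `C₂` the blocks of sizes r₁ and r₂ then stand in the opposite order, which accounts for
  -- `blockSwap`.
  let C₁ : Matrix (Fin (a + r₁) ⊕ Fin (r₂ + c)) (Fin (a + r₁) ⊕ Fin (r₂ + c)) ℝ :=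
    Matrix.fromBlocks (colMatrix (Fin.append P₁ Q₁)) (colMatrix (Fin.append T₁ Z₁)) 0
      (colMatrix (Fin.append V₂ W₂))
  let C₂ : Matrix (Fin (a + r₂) ⊕ Fin (r₁ + c)) (Fin (a + r₂) ⊕ Fin (r₁ + c)) ℝ :=
    Matrix.fromBlocks (colMatrix (Fin.append P₂ Q₂)) (colMatrix (Fin.append T₂ Z₂)) 0
      (colMatrix (Fin.append V₁ (fun k => -W₁ k)))
  have hcol : ∀ (k) (x : Fin (a + r₁) ⊕ Fin (r₂ + c) → ℝ) (y : Fin (a + r₂) ⊕ Fin (r₁ + c) → ℝ),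
      (∀ i, C₁ i (blockSwap a r₁ r₂ c k) = x i) → (∀ i, C₂ i k = y i) → M.mulVec x = y →
      ∀ i, (M * C₁) i (blockSwap a r₁ r₂ c k) = C₂ i k := by
    intro k x y hx hy hxy i
    rw [hy, ← hxy, Matrix.mul_apply, Matrix.mulVec, dotProduct]
    exact Finset.sum_congr rfl fun l _ => by rw [hx]
  have hM : (M * C₁).submatrix id (blockSwap a r₁ r₂ c) = C₂ := by
    ext i k
    rw [Matrix.submatrix_apply, id]
    rcases k with k | k
    · refine Fin.addCases (fun k => ?_) (fun k => ?_) k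
      · refine hcol _ _ _ (fun i => ?_) (fun i => ?_) (hu k) i <;>
          rcases i with i | i <;> simp [C₁, C₂, blockSwap]
      · refine hcol _ _ _ (fun i => ?_) (fun i => ?_) (h₂ k) i <;>
          rcases i with i | i <;> simp [C₁, C₂, blockSwap]
    · refine Fin.addCases (fun k => ?_) (fun k => ?_) k
      · refine hcol _ _ _ (fun i => ?_) (fun i => ?_) (h₁ k) i <;>
          rcases i with i | i <;> simp [C₁, C₂, blockSwap]
      · refine hcol _ _ _ (fun i => ?_) (fun i => ?_) (hz k) i <;>
          rcases i with i | i <;> simp [C₁, C₂, blockSwap]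
  have d₁ : C₁.det = (colMatrix (Fin.append P₁ Q₁)).det * (colMatrix (Fin.append V₂ W₂)).det :=
    Matrix.det_fromBlocks_zero₂₁ _ _ _
  have d₂ : C₂.det = (colMatrix (Fin.append P₂ Q₂)).det *
      ((-1) ^ c * (colMatrix (Fin.append V₁ W₁)).det) := by
    rw [← det_neg_right_cols]
    exact Matrix.det_fromBlocks_zero₂₁ _ _ _
  -- The row and column index types of `M` differ; the order preserving identification of rows with
  -- columns makes its determinant meaningful.
  have d₃ : (M.submatrix (sumFinCast h) id).det * C₁.det =
      ((M * C₁).submatrix (sumFinCast h) id).det := by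
    rw [← Matrix.det_mul]
    congr 1
  have d₄ : C₂.det = (-1) ^ (r₁ * r₂) * ((M * C₁).submatrix (sumFinCast h) id).det := by
    have := Matrix.det_permute' ((sumFinCast h).trans (blockSwap a r₁ r₂ c))
      ((M * C₁).submatrix (sumFinCast h) id)
    rw [sign_blockSwap] at this
    rw [← Matrix.det_submatrix_equiv_self (sumFinCast h) C₂, ← hM]
    refine Eq.trans ?_ (this.trans ?_)
    · congr 1
    · push_cast
      rfl
  rw [← d₁, d₃, pow_add]
  have h5 : ((-1 : ℝ) ^ (r₁ * r₂)) * (-1) ^ (r₁ * r₂) = 1 := by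
    rw [← mul_pow]
    norm_num
  rw [d₂] at d₄
  linear_combination (-1 : ℝ) ^ (r₁ * r₂) * (-d₄) -
    ((M * C₁).submatrix (sumFinCast h) id).det * h5

end Blocks

/-! ### Frames of determinant lines of surjective operators -/

section Frame

variable {Z Y : Type*} [NormedAddCommGroup Z] [NormedSpace ℝ Z] [NormedAddCommGroup Y]
  [NormedSpace ℝ Y] {n : ℕ}

/-- `S` is surjective and `A` restricts to an isomorphism of its kernel with `ℝ^n`. -/
def IsFraming (S : Z →L[ℝ] Y) (A : Z →L[ℝ] (Fin n → ℝ)) : Prop :=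
  Function.Bijective (S.prod A)

theorem IsFraming.surjective {S : Z →L[ℝ] Y} {A : Z →L[ℝ] (Fin n → ℝ)} (h : IsFraming S A) :
    Function.Surjective S := fun y => by
  obtain ⟨z, hz⟩ := h.2 (y, 0)
  exact ⟨z, congrArg Prod.fst hz⟩

theorem bijective_ker_of_isFraming {S : Z →L[ℝ] Y} {A : Z →L[ℝ] (Fin n → ℝ)} (h : IsFraming S A) :
    Function.Bijective (A.toLinearMap ∘ₗ (LinearMap.ker S.toLinearMap).subtype) := by
  constructor
  · rintro ⟨x, hx⟩ ⟨y, hy⟩ hxy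
    exact Subtype.ext (h.1 (Prod.ext ((LinearMap.mem_ker.mp hx).trans
      (LinearMap.mem_ker.mp hy).symm) hxy))
  · intro q
    obtain ⟨z, hz⟩ := h.2 (0, q)
    exact ⟨⟨z, LinearMap.mem_ker.mpr (congrArg Prod.fst hz)⟩, congrArg Prod.snd hz⟩

theorem isFraming_of_bijective_ker {S : Z →L[ℝ] Y} {A : Z →L[ℝ] (Fin n → ℝ)}
    (hS : Function.Surjective S)
    (h : Function.Bijective (A.toLinearMap ∘ₗ (LinearMap.ker S.toLinearMap).subtype)) :
    IsFraming S A := by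
  constructor
  · intro x y hxy
    have h1 : S x = S y := congrArg Prod.fst hxy
    have h2 : A x = A y := congrArg Prod.snd hxy
    have h3 : (⟨x - y, by rw [LinearMap.mem_ker]; exact (map_sub S x y).trans (sub_eq_zero.mpr h1)⟩ :
        LinearMap.ker S.toLinearMap) = 0 := by
      apply h.1
      rw [map_zero]
      exact (map_sub A x y).trans (sub_eq_zero.mpr h2)
    exact sub_eq_zero.mp (congrArg Subtype.val h3)
  · rintro ⟨y, q⟩
    obtain ⟨x, rfl⟩ := hS y
    obtain ⟨k, hk⟩ := h.2 (q - A x)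
    refine ⟨x + k, Prod.ext ?_ ?_⟩
    · change S (x + k) = S x
      rw [map_add, show S k = 0 from LinearMap.mem_ker.mp k.2, add_zero]
    · change A (x + k) = q
      rw [map_add, show A k = q - A x from hk, add_sub_cancel]

/-- The isomorphism `ker S ≃ ℝ^n` given by a framing. -/
def IsFraming.kerEquiv {S : Z →L[ℝ] Y} {A : Z →L[ℝ] (Fin n → ℝ)} (h : IsFraming S A) :
    LinearMap.ker S.toLinearMap ≃ₗ[ℝ] (Fin n → ℝ) :=
  LinearEquiv.ofBijective _ (bijective_ker_of_isFraming h)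

theorem IsFraming.finrank_ker {S : Z →L[ℝ] Y} {A : Z →L[ℝ] (Fin n → ℝ)} (h : IsFraming S A) :
    finrank ℝ (LinearMap.ker S.toLinearMap) = n :=
  h.kerEquiv.finrank_eq.trans (finrank_fin_fun ℝ)

theorem finrank_coker_of_surjective {S : Z →L[ℝ] Y} (hS : Function.Surjective S) :
    finrank ℝ (Y ⧸ LinearMap.range S.toLinearMap) = 0 := by
  have : Subsingleton (Y ⧸ LinearMap.range S.toLinearMap) :=
    Submodule.Quotient.subsingleton_iff.mpr (LinearMap.range_eq_top.mpr hS)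
  exact finrank_zero_of_subsingleton

/-- The generator of `λ(S)` determined by a framing `A`: the image of `Ω_n` under
`λ((A|_{ker S})⁻¹)`. -/
def frame {S : Z →L[ℝ] Y} {A : Z →L[ℝ] (Fin n → ℝ)} (h : IsFraming S A) :
    DetLine S.toLinearMap :=
  DetPair.mk (topMap h.kerEquiv.symm.toLinearMap h.kerEquiv.symm.finrank_eq (stdVol n))
    (star (topOne _ (finrank_coker_of_surjective h.surjective)))

theorem finiteDimensional_ker_of_isFraming {S : Z →L[ℝ] Y} {A : Z →L[ℝ] (Fin n → ℝ)}
    (h : IsFraming S A) : FiniteDimensional ℝ (LinearMap.ker S.toLinearMap) :=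
  FiniteDimensional.of_injective h.kerEquiv.toLinearMap h.kerEquiv.injective

theorem finiteDimensional_coker_of_surjective {S : Z →L[ℝ] Y} (hS : Function.Surjective S) :
    FiniteDimensional ℝ (Y ⧸ LinearMap.range S.toLinearMap) := by
  have : Subsingleton (Y ⧸ LinearMap.range S.toLinearMap) :=
    Submodule.Quotient.subsingleton_iff.mpr (LinearMap.range_eq_top.mpr hS)
  infer_instance

theorem frame_ne_zero {S : Z →L[ℝ] Y} {A : Z →L[ℝ] (Fin n → ℝ)} (h : IsFraming S A) :
    frame h ≠ 0 := by
  have := finiteDimensional_ker_of_isFraming h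
  have := finiteDimensional_coker_of_surjective h.surjective
  exact DetPair.mk_ne_zero
    ((map_ne_zero_iff _ (topMap_injective _ h.kerEquiv.symm.injective)).mpr (stdVol_ne_zero n))
    (star_ne_zero finrank_topPower (topOne_ne_zero _))

/-- In the coordinates of ker S given by the framing, the wedge of n vectors is their determinant
times Ω_n. -/
theorem mk_topWedge_eq_det_smul_frame {S : Z →L[ℝ] Y} {A : Z →L[ℝ] (Fin n → ℝ)}
    (h : IsFraming S A) (hn : finrank ℝ (LinearMap.ker S.toLinearMap) = n)
    (h₀ : finrank ℝ (Y ⧸ LinearMap.range S.toLinearMap) = 0)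
    (b : Fin n → LinearMap.ker S.toLinearMap) :
    DetPair.mk (topWedge hn b) (star (topOne _ h₀)) =
      (colMatrix fun j => A (b j)).det • frame h := by
  rw [topWedge_eq_det_smul h.kerEquiv, frame]
  have := DetPair.mk_smul ((colMatrix fun j => h.kerEquiv (b j)).det) 1
    (topMap h.kerEquiv.symm.toLinearMap h.kerEquiv.symm.finrank_eq (stdVol n))
    (star (topOne _ h₀))
  rw [one_smul, mul_one] at this
  exact this

/-- Change of framing. -/
theorem frame_eq_det_smul_frame {S : Z →L[ℝ] Y} {A A' : Z →L[ℝ] (Fin n → ℝ)}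
    (h : IsFraming S A) (h' : IsFraming S A') (R : Y × (Fin n → ℝ) →L[ℝ] Z)
    (hR : ∀ z, R (S z, A z) = z) :
    frame h = (colMatrix fun j => A' (R (0, Pi.single j 1))).det • frame h' := by
  have hn := finrank_fin_fun ℝ (n := n)
  rw [frame, stdVol_eq_topWedge n hn, topMap_topWedge _ _ hn h.finrank_ker,
    mk_topWedge_eq_det_smul_frame h']
  congr 4
  funext j
  have hb : h.kerEquiv (h.kerEquiv.symm (Pi.basisFun ℝ (Fin n) j)) = Pi.single j 1 := by
    rw [LinearEquiv.apply_symm_apply, Pi.basisFun_apply]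
  -- Since R is a left inverse of (S, A), R(0, e_j) is the vector of ker S with A-coordinate e_j.
  have h1 := hR (h.kerEquiv.symm (Pi.basisFun ℝ (Fin n) j)).1
  have h2 : S (h.kerEquiv.symm (Pi.basisFun ℝ (Fin n) j)).1 = 0 :=
    LinearMap.mem_ker.mp (h.kerEquiv.symm (Pi.basisFun ℝ (Fin n) j)).2
  have h3 : A (h.kerEquiv.symm (Pi.basisFun ℝ (Fin n) j)).1 = Pi.single j 1 := hb
  rw [h2, h3] at h1
  rw [h1]
  rfl

end Frame

/-! ### The stabilization isomorphism on wedge products -/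

section StabIso

variable {X Y : Type*} [NormedAddCommGroup X] [NormedSpace ℝ X] [NormedAddCommGroup Y]
  [NormedSpace ℝ Y] {N : ℕ}

/-- The inclusion `ker D → ker D_Θ`. -/
def kerIncl (Θ : (Fin N → ℝ) →L[ℝ] Y) (D : X →L[ℝ] Y) :
    LinearMap.ker D.toLinearMap →ₗ[ℝ] LinearMap.ker (stabMap Θ D).toLinearMap :=
  (LinearMap.inl ℝ X (Fin N → ℝ)).restrict fun x hx => by
    rw [LinearMap.mem_ker] at hx ⊢
    change D x + Θ 0 = 0
    rw [map_zero, add_zero]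
    exact hx

/-- For D = D_Θ ∘ ι the six-term sequence reduces to 0 → ker D → ker D_Θ → ℝ^N → coker D → 0, so
`psi_topWedge` applies. The connecting map is minus the projection; its sign (-1)^r cancels the one
in `psi_topWedge` and leaves (-1)^(a(r+c)). -/
theorem stabIso_topWedge {a r c : ℕ} (Θ : (Fin (r + c) → ℝ) →L[ℝ] Y) (D : Fredholm X Y)
    (h₃ : finrank ℝ (Y ⧸ LinearMap.range (stab Θ D).1.toLinearMap) = 0)
    (ha : finrank ℝ (LinearMap.ker D.1.toLinearMap) = a)
    (hr : finrank ℝ (LinearMap.ker (stab Θ D).1.toLinearMap) = a + r)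
    (hc : finrank ℝ (Y ⧸ LinearMap.range D.1.toLinearMap) = c)
    (u : Fin a → LinearMap.ker D.1.toLinearMap)
    (v : Fin r → LinearMap.ker (stab Θ D).1.toLinearMap) (ω : Fin c → Fin (r + c) → ℝ)
    (huv : topWedge hr (Fin.append (kerIncl Θ D.1 ∘ u) v) ≠ 0)
    (hω : (colMatrix (Fin.append (fun k => (v k).1.2) ω)).det ≠ 0) :
    stabIso Θ D (DetPair.mk (topWedge hr (Fin.append (kerIncl Θ D.1 ∘ u) v))
        (star (topOne _ h₃))) =
      ((-1) ^ (a * (r + c)) * (colMatrix (Fin.append (fun k => (v k).1.2) ω)).det) •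
        DetPair.mk (topWedge ha u)
          (star (topWedge hc fun k => (LinearMap.range D.1.toLinearMap).mkQ (Θ (ω k)))) := by
  have := finite_ker D.2
  have := finite_coker D.2
  have := finite_ker (stab Θ D).2
  have := finite_coker (stab Θ D).2
  let S := compSeq (LinearMap.inl ℝ X (Fin (r + c) → ℝ)) (stab Θ D).1.toLinearMap
    D.1.toLinearMap fun x => by
      change D.1 x = D.1 x + Θ 0
      rw [map_zero, add_zero]
  let w : Fin c → (X × (Fin (r + c) → ℝ)) ⧸ LinearMap.range (LinearMap.inl ℝ X (Fin (r + c) → ℝ)) :=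
    fun k => Submodule.Quotient.mk (0, ω k)
  have hd := finrank_fin_fun ℝ (n := r + c)
  have hB₁ := (finrank_coker_inl X (r + c)).trans hd
  set m := (colMatrix (Fin.append (fun k => (v k).1.2) ω)).det
  set ζ := topWedge hB₁ (Fin.append (S.δ ∘ v) w)
  -- Under π₂ the vectors δ v become the negatives of the ℝ^N-components of v, and the classes `w`
  -- become ω.
  have hζ : (star (stdVol (r + c)) ∘ₗ topMap (cokerInl X (r + c)) (finrank_coker_inl X (r + c))) ζ =
      (-1) ^ r * m := by
    rw [LinearMap.comp_apply, topMap_topWedge _ _ hB₁ hd, topWedge_eq_det_smul_stdVol, map_smul,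
      star_self finrank_topPower (stdVol_ne_zero _), smul_eq_mul, mul_one, ← det_neg_left_cols]
    congr 2
    funext k
    refine Fin.addCases (fun k => ?_) (fun k => ?_) k
    · simp only [Function.comp_apply, Fin.append_left]
      rfl
    · simp only [Function.comp_apply, Fin.append_right]
      rfl
  have hm : (-1) ^ r * m ≠ 0 := mul_ne_zero (pow_ne_zero _ (by norm_num)) hω
  have hζ₀ : ζ ≠ 0 := fun h0 => hm (by rw [← hζ, h0, map_zero])
  -- Elements of a dual line are determined by their value on `ζ`; this puts the generator of λ(ι)
  -- in the form that the formula for Ψ requires.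
  have hvol : inlVol X (r + c) = ((-1) ^ r * m) •
      DetPair.mk (topOne _ (finrank_ker_inl X (r + c))) (star ζ) := by
    have h1 : star (stdVol (r + c)) ∘ₗ
        topMap (cokerInl X (r + c)) (finrank_coker_inl X (r + c)) = ((-1) ^ r * m) • star ζ := by
      refine LinearMap.ext fun x => ?_
      obtain ⟨d, rfl⟩ := exists_smul_eq_of_finrank_eq_one finrank_topPower hζ₀ x
      rw [map_smul, map_smul, hζ, LinearMap.smul_apply, star_self finrank_topPower hζ₀, smul_eq_mul,
        smul_eq_mul, smul_eq_mul, mul_one]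
    rw [inlVol, h1]
    have := DetPair.mk_smul 1 ((-1) ^ r * m) (topOne _ (finrank_ker_inl X (r + c))) (star ζ)
    rwa [one_smul, one_mul] at this
  have key := S.psi_topWedge (finrank_ker_inl X (r + c)) h₃ ha hr hB₁ hc u v w huv hζ₀
  have h2 : stabIso Θ D (DetPair.mk (topWedge hr (Fin.append (kerIncl Θ D.1 ∘ u) v))
      (star (topOne _ h₃))) = S.psi (inlVol X (r + c) ⊗ₜ
        DetPair.mk (topWedge hr (Fin.append (kerIncl Θ D.1 ∘ u) v)) (star (topOne _ h₃))) := rfl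
  rw [h2, hvol, ← TensorProduct.smul_tmul', map_smul]
  refine (congrArg _ key).trans ?_
  have h3 : S.i' ∘ w = fun k => (LinearMap.range D.1.toLinearMap).mkQ (Θ (ω k)) := by
    funext k
    change (LinearMap.range D.1.toLinearMap).mkQ (D.1 0 + Θ (ω k)) = _
    rw [map_zero, zero_add]
  rw [h3, smul_smul]
  congr 1
  have h4 : (-1 : ℝ) ^ r * (-1) ^ r = 1 := by
    rw [← mul_pow]
    norm_num
  rw [pow_add]
  linear_combination ((-1 : ℝ) ^ (a * (r + c)) * m) * h4

/-- The generator of `λ(D)` obtained from a framing of `D_Θ`. -/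
def stabFrame (Θ : (Fin N → ℝ) →L[ℝ] Y) {n : ℕ} (A : X × (Fin N → ℝ) →L[ℝ] (Fin n → ℝ))
    (D : Fredholm X Y) (h : IsFraming (stabMap Θ D.1) A) : DetLine D.1.toLinearMap :=
  stabIso Θ D (frame h)

theorem stabFrame_ne_zero (Θ : (Fin N → ℝ) →L[ℝ] Y) {n : ℕ}
    (A : X × (Fin N → ℝ) →L[ℝ] (Fin n → ℝ)) (D : Fredholm X Y)
    (h : IsFraming (stabMap Θ D.1) A) : stabFrame Θ A D h ≠ 0 :=
  (map_ne_zero_iff _ (stabIso Θ D).injective).mpr (frame_ne_zero h)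

end StabIso

/-! ### Comparison of two stabilizations -/

section Comparison

variable {X Y : Type*} [NormedAddCommGroup X] [NormedSpace ℝ X] [NormedAddCommGroup Y]
  [NormedSpace ℝ Y] {N : ℕ}

/-- The map `ℝ^N → coker D` induced by `Θ`. -/
def cokerMap (Θ : (Fin N → ℝ) →L[ℝ] Y) (D : X →L[ℝ] Y) :
    (Fin N → ℝ) →ₗ[ℝ] Y ⧸ LinearMap.range D.toLinearMap :=
  (LinearMap.range D.toLinearMap).mkQ ∘ₗ Θ.toLinearMap

theorem cokerMap_surjective {Θ : (Fin N → ℝ) →L[ℝ] Y} {D : X →L[ℝ] Y}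
    (h : Function.Surjective (stabMap Θ D)) : Function.Surjective (cokerMap Θ D) := by
  intro q
  obtain ⟨y, rfl⟩ := Submodule.mkQ_surjective _ q
  obtain ⟨⟨x, p⟩, rfl⟩ := h y
  refine ⟨p, ((Submodule.Quotient.eq _).mpr ⟨-x, ?_⟩)⟩
  change D (-x) = Θ p - (D x + Θ p)
  rw [map_neg]
  abel

/-- The projection `ker D_Θ → ker (ℝ^N → coker D)`. -/
def kerProj (Θ : (Fin N → ℝ) →L[ℝ] Y) (D : X →L[ℝ] Y) :
    LinearMap.ker (stabMap Θ D).toLinearMap →ₗ[ℝ] LinearMap.ker (cokerMap Θ D) :=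
  (LinearMap.snd ℝ X (Fin N → ℝ)).restrict fun z hz => by
    refine LinearMap.mem_ker.mpr ((Submodule.Quotient.mk_eq_zero _).mpr ⟨-z.1, ?_⟩)
    have h : D z.1 + Θ z.2 = 0 := LinearMap.mem_ker.mp hz
    change D (-z.1) = Θ z.2
    rw [map_neg]
    exact neg_eq_of_add_eq_zero_right h

theorem kerProj_surjective (Θ : (Fin N → ℝ) →L[ℝ] Y) (D : X →L[ℝ] Y) :
    Function.Surjective (kerProj Θ D) := by
  rintro ⟨p, hp⟩
  obtain ⟨x, hx⟩ := (Submodule.Quotient.mk_eq_zero _).mp (LinearMap.mem_ker.mp hp)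
  refine ⟨⟨(-x, p), LinearMap.mem_ker.mpr ?_⟩, rfl⟩
  change D (-x) + Θ p = 0
  rw [map_neg, show D x = Θ p from hx, neg_add_cancel]

theorem kerIncl_injective (Θ : (Fin N → ℝ) →L[ℝ] Y) (D : X →L[ℝ] Y) :
    Function.Injective (kerIncl Θ D) := fun _ _ h =>
  Subtype.ext (congrArg (fun z => z.1.1) h)

/-- Let K be the kernel of ℝ^N → coker D. The four-term sequence 0 → ker D → ker D_Θ → ℝ^N → coker D
→ 0 splits at K into two short exact sequences; this is the first, and 0 → K → ℝ^N → coker D → 0 is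
the second. -/
theorem exact_kerIncl_kerProj (Θ : (Fin N → ℝ) →L[ℝ] Y) (D : X →L[ℝ] Y) :
    Function.Exact (kerIncl Θ D) (kerProj Θ D) := by
  rintro ⟨⟨x, p⟩, hz⟩
  constructor
  · intro h
    have hp : p = 0 := congrArg Subtype.val h
    subst hp
    refine ⟨⟨x, LinearMap.mem_ker.mpr ?_⟩, rfl⟩
    have h1 : D x + Θ 0 = 0 := LinearMap.mem_ker.mp hz
    rwa [map_zero, add_zero] at h1
  · rintro ⟨x', h⟩
    exact Subtype.ext (congrArg (fun z => z.1.2) h).symm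

theorem finrank_ker_cokerMap_add {Θ : (Fin N → ℝ) →L[ℝ] Y} {D : X →L[ℝ] Y}
    (h : Function.Surjective (stabMap Θ D)) :
    finrank ℝ (LinearMap.ker (cokerMap Θ D)) + finrank ℝ (Y ⧸ LinearMap.range D.toLinearMap) = N :=
  (finrank_ses (Submodule.subtype_injective _) (LinearMap.exact_subtype_ker_map _)
    (cokerMap_surjective h)).trans (finrank_fin_fun ℝ)

theorem finrank_ker_add_finrank_ker_cokerMap (Θ : (Fin N → ℝ) →L[ℝ] Y) (D : Fredholm X Y) :
    finrank ℝ (LinearMap.ker D.1.toLinearMap) + finrank ℝ (LinearMap.ker (cokerMap Θ D.1)) =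
      finrank ℝ (LinearMap.ker (stab Θ D).1.toLinearMap) :=
  have := finite_ker (stab Θ D).2
  finrank_ses (kerIncl_injective Θ D.1) (exact_kerIncl_kerProj Θ D.1) (kerProj_surjective Θ D.1)

/-- Bases of `ker D_Θ` and `ℝ^N` adapted to given bases of `ker D` and `coker D`. -/
theorem exists_adapted {a r c : ℕ} {Θ : (Fin (r + c) → ℝ) →L[ℝ] Y} {D : Fredholm X Y}
    (hsurj : Function.Surjective (stabMap Θ D.1))
    (ha : finrank ℝ (LinearMap.ker D.1.toLinearMap) = a)
    (hr : finrank ℝ (LinearMap.ker (stab Θ D).1.toLinearMap) = a + r)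
    (hc : finrank ℝ (Y ⧸ LinearMap.range D.1.toLinearMap) = c)
    {u : Fin a → LinearMap.ker D.1.toLinearMap} (hu : topWedge ha u ≠ 0)
    {y : Fin c → Y ⧸ LinearMap.range D.1.toLinearMap} (hy : topWedge hc y ≠ 0) :
    ∃ (v : Fin r → LinearMap.ker (stab Θ D).1.toLinearMap) (ω : Fin c → Fin (r + c) → ℝ),
      (∀ k, cokerMap Θ D.1 (ω k) = y k) ∧ topWedge hr (Fin.append (kerIncl Θ D.1 ∘ u) v) ≠ 0 ∧
        (colMatrix (Fin.append (fun k => (v k).1.2) ω)).det ≠ 0 := by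
  have : FiniteDimensional ℝ (LinearMap.ker (stabMap Θ D.1).toLinearMap) := finite_ker (stab Θ D).2
  have hk : finrank ℝ (LinearMap.ker (cokerMap Θ D.1)) = r := by
    have := finrank_ker_cokerMap_add hsurj
    omega
  -- A single basis of K serves both short exact sequences: lifted to ker D_Θ it complements u, and
  -- included in ℝ^N it complements the lifts ω of y.
  let b := finBasisOfFinrankEq ℝ (LinearMap.ker (cokerMap Θ D.1)) hk
  choose v hv using fun k => kerProj_surjective Θ D.1 (b k)
  choose ω hω using fun k => cokerMap_surjective hsurj (y k)
  have hb := topWedge_basis_ne_zero b hk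
  refine ⟨v, ω, hω, ?_, ?_⟩
  · have h1 := wedge_topWedge (kerIncl_injective Θ D.1) (exact_kerIncl_kerProj Θ D.1)
      (kerProj_surjective Θ D.1) ha hk hr u v
    rw [show kerProj Θ D.1 ∘ v = b from funext hv] at h1
    refine h1 ▸ wedge_ne_zero _ _ _ hu hb
  · have hd := finrank_fin_fun ℝ (n := r + c)
    have h1 := wedge_topWedge (Submodule.subtype_injective _)
      (LinearMap.exact_subtype_ker_map (cokerMap Θ D.1)) (cokerMap_surjective hsurj) hk hc hd b ω
    rw [show cokerMap Θ D.1 ∘ ω = y from funext hω] at h1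
    have h2 : (LinearMap.ker (cokerMap Θ D.1)).subtype ∘ b = fun k => (v k).1.2 := by
      funext k
      exact (congrArg Subtype.val (hv k)).symm
    rw [h2, topWedge_eq_det_smul_stdVol] at h1
    intro h0
    rw [h0, zero_smul] at h1
    exact wedge_ne_zero _ _ _ hb hy h1

/-- With `R = (D_{Θ₁}, A₁)⁻¹` and `(x, p₁) = R(-Θ₂p₂, q)`, the map `(q, p₂) ↦ (A₂(x, p₂), p₁)`. -/
def transMap {N₁ N₂ n₁ n₂ : ℕ} (R : Y × (Fin n₁ → ℝ) →L[ℝ] X × (Fin N₁ → ℝ))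
    (Θ₂ : (Fin N₂ → ℝ) →L[ℝ] Y) (A₂ : X × (Fin N₂ → ℝ) →L[ℝ] (Fin n₂ → ℝ)) :
    (Fin n₁ ⊕ Fin N₂ → ℝ) →ₗ[ℝ] (Fin n₂ ⊕ Fin N₁ → ℝ) where
  toFun q := Sum.elim (A₂ ((R (-Θ₂ (q ∘ Sum.inr), q ∘ Sum.inl)).1, q ∘ Sum.inr))
    (R (-Θ₂ (q ∘ Sum.inr), q ∘ Sum.inl)).2
  map_add' q q' := by
    have h1 : (q + q') ∘ Sum.inr = q ∘ Sum.inr + q' ∘ Sum.inr := rfl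
    have h2 : (q + q') ∘ Sum.inl = q ∘ Sum.inl + q' ∘ Sum.inl := rfl
    rw [h1, h2, map_add, neg_add, ← Prod.mk_add_mk, map_add, Prod.fst_add, Prod.snd_add,
      ← Prod.mk_add_mk, map_add]
    ext (i | i) <;> rfl
  map_smul' t q := by
    have h1 : (t • q) ∘ Sum.inr = t • (q ∘ Sum.inr) := rfl
    have h2 : (t • q) ∘ Sum.inl = t • (q ∘ Sum.inl) := rfl
    rw [h1, h2, map_smul, ← smul_neg, ← Prod.smul_mk, map_smul, Prod.smul_fst, Prod.smul_snd,
      ← Prod.smul_mk, map_smul]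
    ext (i | i) <;> rfl

/-- The ratio of the generators of `λ(D)` obtained from framings of two stabilizations. -/
def transRatio {N₁ N₂ n₁ n₂ : ℕ} (h : n₁ + N₂ = n₂ + N₁)
    (R : Y × (Fin n₁ → ℝ) →L[ℝ] X × (Fin N₁ → ℝ))
    (Θ₂ : (Fin N₂ → ℝ) →L[ℝ] Y) (A₂ : X × (Fin N₂ → ℝ) →L[ℝ] (Fin n₂ → ℝ)) : ℝ :=
  (-1) ^ (N₁ * N₂ + (n₁ + N₁) * (N₁ + N₂)) *
    ((LinearMap.toMatrix' (transMap R Θ₂ A₂)).submatrix (sumFinCast h) id).det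

/-- The number r is the dimension of the kernel of ℝ^N → coker D, common to the two short exact
sequences. -/
theorem exists_eq_add_of_isFraming {n : ℕ} {Θ : (Fin N → ℝ) →L[ℝ] Y}
    {A : X × (Fin N → ℝ) →L[ℝ] (Fin n → ℝ)} {D : Fredholm X Y} (h : IsFraming (stabMap Θ D.1) A) :
    ∃ r, N = r + finrank ℝ (Y ⧸ LinearMap.range D.1.toLinearMap) ∧
      n = finrank ℝ (LinearMap.ker D.1.toLinearMap) + r :=
  ⟨finrank ℝ (LinearMap.ker (cokerMap Θ D.1)), (finrank_ker_cokerMap_add h.surjective).symm,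
    h.finrank_ker.symm.trans (finrank_ker_add_finrank_ker_cokerMap Θ D).symm⟩

/-- Both differences nᵢ - Nᵢ equal the index of D. -/
theorem add_eq_add_of_isFraming {N₁ N₂ n₁ n₂ : ℕ} {Θ₁ : (Fin N₁ → ℝ) →L[ℝ] Y}
    {A₁ : X × (Fin N₁ → ℝ) →L[ℝ] (Fin n₁ → ℝ)} {Θ₂ : (Fin N₂ → ℝ) →L[ℝ] Y}
    {A₂ : X × (Fin N₂ → ℝ) →L[ℝ] (Fin n₂ → ℝ)} {D : Fredholm X Y}
    (h₁ : IsFraming (stabMap Θ₁ D.1) A₁) (h₂ : IsFraming (stabMap Θ₂ D.1) A₂) :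
    n₁ + N₂ = n₂ + N₁ := by
  obtain ⟨r₁, e₁, e₁'⟩ := exists_eq_add_of_isFraming h₁
  obtain ⟨r₂, e₂, e₂'⟩ := exists_eq_add_of_isFraming h₂
  omega

/-- The generator (∧u) ⊗ (∧y)^* of λ(D) does not involve Θ or A. It is the common reference against
which two stabilizations are compared. -/
theorem det_smul_stabFrame {a r c : ℕ} {Θ : (Fin (r + c) → ℝ) →L[ℝ] Y} {D : Fredholm X Y}
    {A : X × (Fin (r + c) → ℝ) →L[ℝ] (Fin (a + r) → ℝ)} (h : IsFraming (stabMap Θ D.1) A)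
    (ha : finrank ℝ (LinearMap.ker D.1.toLinearMap) = a)
    (hc : finrank ℝ (Y ⧸ LinearMap.range D.1.toLinearMap) = c)
    {u : Fin a → LinearMap.ker D.1.toLinearMap} (hu : topWedge ha u ≠ 0)
    {y : Fin c → Y ⧸ LinearMap.range D.1.toLinearMap} (hy : topWedge hc y ≠ 0) :
    ∃ (v : Fin r → LinearMap.ker (stab Θ D).1.toLinearMap) (ω : Fin c → Fin (r + c) → ℝ),
      (∀ k, cokerMap Θ D.1 (ω k) = y k) ∧
      (colMatrix (Fin.append (fun k => A (u k, 0)) (fun k => A (v k).1))).det ≠ 0 ∧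
      (colMatrix (Fin.append (fun k => (v k).1.2) ω)).det ≠ 0 ∧
      (colMatrix (Fin.append (fun k => A (u k, 0)) (fun k => A (v k).1))).det • stabFrame Θ A D h =
        ((-1) ^ (a * (r + c)) * (colMatrix (Fin.append (fun k => (v k).1.2) ω)).det) •
          DetPair.mk (topWedge ha u) (star (topWedge hc y)) := by
  obtain ⟨v, ω, hω, huv, hm⟩ := exists_adapted h.surjective ha h.finrank_ker hc hu hy
  have h₃ := finrank_coker_of_surjective h.surjective
  have key := stabIso_topWedge Θ D h₃ ha h.finrank_ker hc u v ω huv hm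
  have e := mk_topWedge_eq_det_smul_frame h h.finrank_ker h₃ (Fin.append (kerIncl Θ D.1 ∘ u) v)
  have e₁ : (fun j => A (Fin.append (kerIncl Θ D.1 ∘ u) v j).1) =
      Fin.append (fun k => A (u k, 0)) (fun k => A (v k).1) := by
    funext j
    refine Fin.addCases (fun j => ?_) (fun j => ?_) j
    · rw [Fin.append_left]
      exact congrArg (fun z => A z.1) (Fin.append_left _ v j)
    · rw [Fin.append_right]
      exact congrArg (fun z => A z.1) (Fin.append_right (kerIncl Θ D.1 ∘ u) v j)
  rw [e₁] at e
  have e₂ : (fun k => (LinearMap.range D.1.toLinearMap).mkQ (Θ (ω k))) = y := funext hω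
  rw [e₂] at key
  refine ⟨v, ω, hω, fun h0 => ?_, hm, ?_⟩
  · have : FiniteDimensional ℝ (LinearMap.ker (stab Θ D).1.toLinearMap) :=
      finiteDimensional_ker_of_isFraming h
    have := finiteDimensional_coker_of_surjective h.surjective
    rw [h0, zero_smul] at e
    exact DetPair.mk_ne_zero huv (star_ne_zero finrank_topPower (topOne_ne_zero _)) e
  · rw [← key, stabFrame, ← map_smul]
    exact congrArg _ e.symm

/-- The generators of `λ(D)` obtained from framings of two stabilizations are proportional, with
an explicit ratio. -/
theorem stabFrame_eq_smul_stabFrame {N₁ N₂ n₁ n₂ : ℕ} {Θ₁ : (Fin N₁ → ℝ) →L[ℝ] Y}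
    {A₁ : X × (Fin N₁ → ℝ) →L[ℝ] (Fin n₁ → ℝ)} {Θ₂ : (Fin N₂ → ℝ) →L[ℝ] Y}
    {A₂ : X × (Fin N₂ → ℝ) →L[ℝ] (Fin n₂ → ℝ)} {D : Fredholm X Y}
    (h₁ : IsFraming (stabMap Θ₁ D.1) A₁) (h₂ : IsFraming (stabMap Θ₂ D.1) A₂)
    (h : n₁ + N₂ = n₂ + N₁) {R : Y × (Fin n₁ → ℝ) →L[ℝ] X × (Fin N₁ → ℝ)}
    (hR : ∀ z, R (stabMap Θ₁ D.1 z, A₁ z) = z) :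
    stabFrame Θ₁ A₁ D h₁ = transRatio h R Θ₂ A₂ • stabFrame Θ₂ A₂ D h₂ := by
  have := finite_ker D.2
  have := finite_coker D.2
  obtain ⟨r₁, e₁, e₁'⟩ := exists_eq_add_of_isFraming h₁
  obtain ⟨r₂, e₂, e₂'⟩ := exists_eq_add_of_isFraming h₂
  -- With the dimensions as variables, Nᵢ = rᵢ + c and nᵢ = a + rᵢ can be substituted.
  generalize ha : finrank ℝ (LinearMap.ker D.1.toLinearMap) = a at e₁' e₂'
  generalize hc : finrank ℝ (Y ⧸ LinearMap.range D.1.toLinearMap) = c at e₁ e₂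
  subst e₁ e₂ e₁' e₂'
  let u := finBasisOfFinrankEq ℝ _ ha
  let y := finBasisOfFinrankEq ℝ _ hc
  have hu := topWedge_basis_ne_zero u ha
  have hy := topWedge_basis_ne_zero y hc
  obtain ⟨v₁, ω₁, hω₁, hα₁, hm₁, k₁⟩ := det_smul_stabFrame h₁ ha hc hu hy
  obtain ⟨v₂, ω₂, hω₂, hα₂, hm₂, k₂⟩ := det_smul_stabFrame h₂ ha hc hu hy
  -- Both ω₁ and ω₂ lift the same y, so Θ₁ω₁ and Θ₂ω₂ differ by an element of im D.
  have hξ : ∀ k, ∃ ξ, D.1 ξ = Θ₁ (ω₁ k) - Θ₂ (ω₂ k) := fun k => by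
    obtain ⟨ξ, h⟩ := (Submodule.Quotient.eq _).mp ((hω₁ k).trans (hω₂ k).symm)
    exact ⟨ξ, h⟩
  choose ξ hξ using hξ
  -- On solutions of D x + Θ₁ p₁ + Θ₂ p₂ = 0 the matrix exchanges the two coordinate systems, since
  -- R recovers (x, p₁) from (-Θ₂ p₂, A₁(x, p₁)).
  have hM : ∀ x p₁ p₂, D.1 x + Θ₁ p₁ + Θ₂ p₂ = 0 →
      (LinearMap.toMatrix' (transMap R Θ₂ A₂)).mulVec (Sum.elim (A₁ (x, p₁)) p₂) =
        Sum.elim (A₂ (x, p₂)) p₁ := by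
    intro x p₁ p₂ h0
    rw [LinearMap.toMatrix'_mulVec]
    have h1 := hR (x, p₁)
    have h2 : stabMap Θ₁ D.1 (x, p₁) = -Θ₂ p₂ := eq_neg_of_add_eq_zero_left h0
    rw [h2] at h1
    change Sum.elim (A₂ ((R (-Θ₂ p₂, A₁ (x, p₁))).1, p₂)) (R (-Θ₂ p₂, A₁ (x, p₁))).2 = _
    rw [h1]
  -- The relation `hM` is evaluated on four families of solutions (x, p₁, p₂): (u, 0, 0), the
  -- vectors v₁ with p₂ = 0, the vectors v₂ with p₁ = 0, and (ξ, -ω₁, ω₂).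
  have block := det_block_comparison h (LinearMap.toMatrix' (transMap R Θ₂ A₂))
    (fun k => A₁ (u k, 0)) (fun k => A₁ (v₁ k).1) (fun k => A₁ ((v₂ k).1.1, 0))
    (fun k => A₁ (ξ k, -ω₁ k)) (fun k => (v₁ k).1.2) ω₁
    (fun k => A₂ (u k, 0)) (fun k => A₂ (v₂ k).1) (fun k => A₂ ((v₁ k).1.1, 0))
    (fun k => A₂ (ξ k, ω₂ k)) (fun k => (v₂ k).1.2) ω₂
    (fun k => by
      refine hM _ 0 0 ?_
      rw [map_zero, map_zero, add_zero, add_zero]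
      exact LinearMap.mem_ker.mp (u k).2)
    (fun k => by
      refine hM (v₁ k).1.1 (v₁ k).1.2 0 ?_
      rw [map_zero, add_zero]
      exact LinearMap.mem_ker.mp (v₁ k).2)
    (fun k => by
      refine hM (v₂ k).1.1 0 (v₂ k).1.2 ?_
      rw [map_zero, add_zero]
      exact LinearMap.mem_ker.mp (v₂ k).2)
    (fun k => by
      refine hM _ _ _ ?_
      rw [hξ, map_neg]
      abel)
  rw [transRatio]
  generalize (LinearMap.toMatrix' (transMap R Θ₂ A₂)).submatrix (sumFinCast h) id = M at block ⊢
  generalize (colMatrix (Fin.append (fun k => A₁ (u k, 0)) (fun k => A₁ (v₁ k).1))).det = α₁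
    at block hα₁ k₁
  generalize (colMatrix (Fin.append (fun k => A₂ (u k, 0)) (fun k => A₂ (v₂ k).1))).det = α₂
    at block hα₂ k₂
  generalize (colMatrix (Fin.append (fun k => (v₁ k).1.2) ω₁)).det = m₁ at block hm₁ k₁
  generalize (colMatrix (Fin.append (fun k => (v₂ k).1.2) ω₂)).det = m₂ at block hm₂ k₂
  generalize DetPair.mk (topWedge ha u) (star (topWedge hc y)) = τ at k₁ k₂
  have f₁ : stabFrame Θ₁ A₁ D h₁ = (α₁⁻¹ * ((-1) ^ (a * (r₁ + c)) * m₁)) • τ := by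
    rw [mul_smul, ← k₁, inv_smul_smul₀ hα₁]
  have f₂ : stabFrame Θ₂ A₂ D h₂ = (α₂⁻¹ * ((-1) ^ (a * (r₂ + c)) * m₂)) • τ := by
    rw [mul_smul, ← k₂, inv_smul_smul₀ hα₂]
  rw [f₁, f₂, smul_smul]
  congr 1
  have hdet : M.det = (-1) ^ (r₁ * r₂ + c) * (α₂ * m₁) / (α₁ * m₂) := by
    rw [← block]
    field_simp
  -- This parity computation trades the signs that involve a, r₁, r₂, c separately for N₁N₂ + (n₁ +
  -- N₁)(N₁ + N₂). The difference of exponents is even because c(c + 1) is.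
  have hsign : (-1 : ℝ) ^ (a * (r₁ + c)) =
      (-1) ^ ((r₁ + c) * (r₂ + c) + (a + r₁ + (r₁ + c)) * (r₁ + c + (r₂ + c))) *
        (-1) ^ (r₁ * r₂ + c) * (-1) ^ (a * (r₂ + c)) := by
    have e : (r₁ + c) * (r₂ + c) + (a + r₁ + (r₁ + c)) * (r₁ + c + (r₂ + c)) + (r₁ * r₂ + c) +
        a * (r₂ + c) = a * (r₁ + c) + 2 * (r₁ * r₂ + c * r₁ + c * r₂ + c * c + a * r₂ + a * c +
          r₁ * (r₁ + r₂ + 2 * c)) + c * (c + 1) := by ring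
    rw [← pow_add, ← pow_add, e, pow_add, pow_add, pow_mul _ 2, neg_one_sq, one_pow, mul_one,
      (Nat.even_mul_succ_self c).neg_one_pow, mul_one]
  rw [hdet, hsign]
  field_simp

end Comparison

/-! ### Gluing topologies -/

section Gluing

variable {ι E : Type*} {Z : ι → Type*} [∀ i, TopologicalSpace (Z i)]

/-- A set is open in the glued topology when all its preimages are open, so `h` says precisely that
every `f j` is an open map. -/
theorem isOpenEmbedding_iSup_coinduced (f : ∀ i, Z i → E) (hinj : ∀ i, Function.Injective (f i))
    (h : ∀ i j (s : Set (Z j)), IsOpen s → IsOpen (f i ⁻¹' (f j '' s))) (j : ι) :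
    @IsOpenEmbedding _ _ _ (⨆ i, TopologicalSpace.coinduced (f i) inferInstance) (f j) := by
  let _ : TopologicalSpace E := ⨆ i, TopologicalSpace.coinduced (f i) inferInstance
  refine .of_continuous_injective_isOpenMap
    (continuous_iff_coinduced_le.mpr (le_iSup
      (fun i => TopologicalSpace.coinduced (f i) inferInstance) j)) (hinj j) fun s hs => ?_
  exact isOpen_iSup_iff.mpr fun i => isOpen_coinduced.mpr (h i j s hs)

/-- Any set is the union of the images of its preimages under the covering charts. Hence openness is
detected in the charts, and a covering family of open embeddings admits only one topology. -/
theorem eq_iSup_coinduced {τ : TopologicalSpace E} (f : ∀ i, Z i → E)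
    (hf : ∀ i, IsOpenEmbedding (f i)) (hcov : ∀ e, ∃ i, e ∈ Set.range (f i)) :
    τ = ⨆ i, TopologicalSpace.coinduced (f i) inferInstance := by
  refine TopologicalSpace.ext_iff.mpr fun s => ?_
  rw [isOpen_iSup_iff]
  refine ⟨fun hs i => isOpen_coinduced.mpr (hs.preimage (hf i).continuous), fun hs => ?_⟩
  have e : s = ⋃ i, f i '' (f i ⁻¹' s) := by
    ext x
    rw [Set.mem_iUnion]
    constructor
    · intro hx
      obtain ⟨i, z, rfl⟩ := hcov x
      exact ⟨i, z, hx, rfl⟩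
    · rintro ⟨i, z, hz, rfl⟩
      exact hz
  rw [e]
  exact isOpen_iUnion fun i => (hf i).isOpenMap _ (isOpen_coinduced.mp (hs i))

/-- For an injective map, continuity and openness are both local on the source, so they may be
tested on an open cover. -/
theorem isOpenEmbedding_of_cover [TopologicalSpace E] {W : Type*} [TopologicalSpace W] {f : W → E}
    (hinj : Function.Injective f) (g : ∀ i, Z i → W) (hg : ∀ i, IsOpenEmbedding (g i))
    (hfg : ∀ i, IsOpenEmbedding (f ∘ g i)) (hcov : ∀ w, ∃ i, w ∈ Set.range (g i)) :
    IsOpenEmbedding f := by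
  refine .of_continuous_injective_isOpenMap ?_ hinj fun s hs => ?_
  · refine continuous_iff_continuousAt.mpr fun w => ?_
    obtain ⟨i, z, rfl⟩ := hcov w
    exact (hg i).continuousAt_iff.mp (hfg i).continuous.continuousAt
  · have e : f '' s = ⋃ i, (f ∘ g i) '' (g i ⁻¹' s) := by
      ext x
      rw [Set.mem_iUnion]
      constructor
      · rintro ⟨w, hw, rfl⟩
        obtain ⟨i, z, rfl⟩ := hcov w
        exact ⟨i, z, hw, rfl⟩
      · rintro ⟨i, z, hz, rfl⟩
        exact ⟨g i z, hz, rfl⟩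
    rw [e]
    exact isOpen_iUnion fun i => (hfg i).isOpenMap _ (hs.preimage (hg i).continuous)

end Gluing

/-! ### Frames of families of lines -/

section Frames

variable {B : Type*} {E : B → Type*} [∀ b, AddCommGroup (E b)] [∀ b, Module ℝ (E b)]

/-- The parametrization `(b, t) ↦ t s(b)` of a family of lines over `U` by a generator `s`. -/
def frameChart {U : Set B} (s : ∀ b : U, E b) (p : U × ℝ) : TotalSpace ℝ E :=
  ⟨p.1, p.2 • s p.1⟩

theorem frameChart_injective {U : Set B} {s : ∀ b : U, E b} (hs : ∀ b, s b ≠ 0) :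
    Function.Injective (frameChart s) := by
  rintro ⟨⟨b, hb⟩, t⟩ ⟨⟨b', hb'⟩, t'⟩ h
  obtain rfl : b = b' := congrArg TotalSpace.proj h
  have h2 : t • s ⟨b, hb⟩ = t' • s ⟨b, hb⟩ := TotalSpace.mk_injective b h
  rw [smul_left_injective ℝ (hs _) h2]

theorem mem_range_frameChart {U : Set B} {s : ∀ b : U, E b} (hs : ∀ b, s b ≠ 0)
    (hE : ∀ b, finrank ℝ (E b) = 1) {p : TotalSpace ℝ E} :
    p ∈ Set.range (frameChart s) ↔ p.proj ∈ U := by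
  constructor
  · rintro ⟨q, rfl⟩
    exact q.1.2
  · intro hp
    obtain ⟨b, x⟩ := p
    obtain ⟨t, ht⟩ := exists_smul_eq_of_finrank_eq_one (hE b) (hs ⟨b, hp⟩) x
    exact ⟨(⟨b, hp⟩, t), congrArg (TotalSpace.mk b) ht⟩

/-- The parametrization of a pullback of a family of lines by the pullback of a generator. -/
def pullbackFrameChart {B' : Type*} (f : B' → B) {U : Set B} (s : ∀ b : U, E b)
    (p : (f ⁻¹' U : Set B') × ℝ) : TotalSpace ℝ (f *ᵖ E) :=
  ⟨p.1.1, (p.2 • s ⟨f p.1, p.1.2⟩ : E (f p.1))⟩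

theorem mem_range_pullbackFrameChart {B' : Type*} {f : B' → B} {U : Set B} {s : ∀ b : U, E b}
    (hs : ∀ b, s b ≠ 0) (hE : ∀ b, finrank ℝ (E b) = 1) {p : TotalSpace ℝ (f *ᵖ E)} :
    p ∈ Set.range (pullbackFrameChart f s) ↔ f p.proj ∈ U := by
  constructor
  · rintro ⟨q, rfl⟩
    exact q.1.2
  · intro hp
    obtain ⟨b, x⟩ := p
    obtain ⟨t, ht⟩ := exists_smul_eq_of_finrank_eq_one (hE (f b)) (hs ⟨f b, hp⟩) x
    exact ⟨(⟨b, hp⟩, t), congrArg (TotalSpace.mk b) ht⟩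

variable [TopologicalSpace B]

/-- The change of frame is (b, t) ↦ (b, t c(b)). Only continuity of c at points of the overlap is
needed, because a point of the preimage already lies over the open set V. -/
theorem isOpen_preimage_image_frameChart {U V : Set B} (hV : IsOpen V) {s : ∀ b : U, E b}
    {s' : ∀ b : V, E b} (hs' : ∀ b, s' b ≠ 0) (c : B → ℝ)
    (hc : ∀ b, b ∈ U → b ∈ V → ContinuousAt c b)
    (h : ∀ b (hU : b ∈ U) (hV : b ∈ V), s ⟨b, hU⟩ = c b • s' ⟨b, hV⟩) {W : Set (V × ℝ)}
    (hW : IsOpen W) : IsOpen (frameChart s ⁻¹' (frameChart s' '' W)) := by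
  have hW' := (hV.isOpenEmbedding_subtypeVal.prodMap (.id (X := ℝ))).isOpenMap _ hW
  set W' := Prod.map Subtype.val id '' W
  have e : ∀ p : U × ℝ, p ∈ frameChart s ⁻¹' (frameChart s' '' W) ↔
      ((p.1 : B), p.2 * c p.1) ∈ W' := by
    rintro ⟨⟨b, hb⟩, t⟩
    constructor
    · rintro ⟨⟨⟨b', hb'⟩, t'⟩, hw, hx⟩
      obtain rfl : b' = b := congrArg TotalSpace.proj hx
      refine ⟨_, hw, Prod.ext rfl ?_⟩
      have h2 : t' • s' ⟨b', hb'⟩ = t • s ⟨b', hb⟩ := TotalSpace.mk_injective b' hx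
      rw [h b' hb hb', smul_smul] at h2
      exact smul_left_injective ℝ (hs' _) h2
    · rintro ⟨⟨⟨b', hb'⟩, t'⟩, hw, hx⟩
      obtain rfl : b' = b := congrArg Prod.fst hx
      obtain rfl : t' = t * c b' := congrArg Prod.snd hx
      refine ⟨_, hw, ?_⟩
      change (⟨b', (t * c b') • s' ⟨b', hb'⟩⟩ : TotalSpace ℝ E) = ⟨b', t • s ⟨b', hb⟩⟩
      rw [h b' hb hb', smul_smul]
  refine isOpen_iff_mem_nhds.mpr fun p hp => ?_
  have hp' := (e p).mp hp
  have hpV : (p.1 : B) ∈ V := by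
    obtain ⟨q, -, hq⟩ := hp'
    have h0 : (q.1 : B) = p.1 := congrArg Prod.fst hq
    rw [← h0]
    exact q.1.2
  have h1 : ContinuousAt (fun p : U × ℝ => ((p.1 : B), p.2 * c p.1)) p := by
    have h2 : ContinuousAt (fun p : U × ℝ => (p.1 : B)) p :=
      (continuous_subtype_val.comp continuous_fst).continuousAt
    exact h2.prodMk (continuous_snd.continuousAt.mul
      (ContinuousAt.comp (f := fun p : U × ℝ => (p.1 : B)) (hc _ p.1.2 hpV) h2))
  filter_upwards [h1.preimage_mem_nhds (hW'.mem_nhds hp')] with q hq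
  exact (e q).mpr hq

/-- The trivialization is the inverse of the frame chart followed by the inclusion U × ℝ → B × ℝ. It
is linear because it reads off the coefficient of s. -/
theorem exists_trivialization_of_frame [TopologicalSpace (TotalSpace ℝ E)] {U : Set B}
    (hU : IsOpen U) {s : ∀ b : U, E b} (hs : ∀ b, s b ≠ 0) (hE : ∀ b, finrank ℝ (E b) = 1)
    (hf : IsOpenEmbedding (frameChart s)) {b : B} (hb : b ∈ U) :
    ∃ e : Trivialization ℝ (TotalSpace.proj : TotalSpace ℝ E → B),
      b ∈ e.baseSet ∧ e.IsLinear ℝ := by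
  have : Nonempty (U × ℝ) := ⟨(⟨b, hb⟩, 0)⟩
  have hg : IsOpenEmbedding (Prod.map Subtype.val id : U × ℝ → B × ℝ) :=
    hU.isOpenEmbedding_subtypeVal.prodMap .id
  let φ := hf.toOpenPartialHomeomorph
  let ψ := hg.toOpenPartialHomeomorph
  have hval : ∀ q : U × ℝ, (φ.symm.trans ψ) (frameChart s q) = (q.1.1, q.2) := by
    intro q
    have h1 : φ.symm (frameChart s q) = q := φ.left_inv (Set.mem_univ q)
    change ψ (φ.symm (frameChart s q)) = _
    rw [h1]
    rfl
  have hsource : (φ.symm.trans ψ).source = TotalSpace.proj ⁻¹' U := by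
    ext p
    have h1 : p ∈ (φ.symm.trans ψ).source ↔ p ∈ Set.range (frameChart s) := by
      simp [φ, ψ]
    rw [h1, mem_range_frameChart hs hE]
    rfl
  let e : Trivialization ℝ (TotalSpace.proj : TotalSpace ℝ E → B) :=
    { φ.symm.trans ψ with
      baseSet := U
      open_baseSet := hU
      source_eq := hsource
      target_eq := by
        ext ⟨b, t⟩
        simp [φ, ψ]
      proj_toFun := by
        intro p hp
        rw [hsource] at hp
        obtain ⟨q, rfl⟩ := (mem_range_frameChart hs hE).mpr hp
        exact congrArg Prod.fst (hval q) }
  have he : ∀ (b : B) (hb : b ∈ U) (t : ℝ), (e ⟨b, t • s ⟨b, hb⟩⟩).2 = t := fun b hb t =>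
    congrArg Prod.snd (hval (⟨b, hb⟩, t))
  refine ⟨e, hb, ⟨fun b hb => ⟨fun x y => ?_, fun c x => ?_⟩⟩⟩
  · obtain ⟨t, rfl⟩ := exists_smul_eq_of_finrank_eq_one (hE b) (hs ⟨b, hb⟩) x
    obtain ⟨t', rfl⟩ := exists_smul_eq_of_finrank_eq_one (hE b) (hs ⟨b, hb⟩) y
    rw [← add_smul, he b hb, he b hb, he b hb]
  · obtain ⟨t, rfl⟩ := exists_smul_eq_of_finrank_eq_one (hE b) (hs ⟨b, hb⟩) x
    rw [smul_smul, he b hb, he b hb, smul_eq_mul]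

theorem isOpenEmbedding_pullbackFrameChart [TopologicalSpace (TotalSpace ℝ E)] {B' : Type*}
    [TopologicalSpace B'] {f : B' → B} (hf : Continuous f) {U : Set B} (hU : IsOpen U)
    {s : ∀ b : U, E b} (hs : ∀ b, s b ≠ 0) (hE : ∀ b, finrank ℝ (E b) = 1)
    (hemb : IsOpenEmbedding (frameChart s)) : IsOpenEmbedding (pullbackFrameChart f s) := by
  -- The pullback carries the topology induced from the product of B' with the total space. There
  -- the pulled back frame chart is the graph embedding `g` of f followed by a product of
  -- embeddings.
  let g : (f ⁻¹' U : Set B') × ℝ → (f ⁻¹' U : Set B') × (U × ℝ) :=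
    fun p => (p.1, (⟨f p.1, p.1.2⟩, p.2))
  have hg : IsEmbedding g := by
    refine Function.LeftInverse.isEmbedding (f := fun q => (q.1, q.2.2)) (fun p => rfl)
      (by fun_prop) ?_
    refine continuous_fst.prodMk (Continuous.prodMk ?_ continuous_snd)
    exact (hf.comp (continuous_subtype_val.comp continuous_fst)).subtype_mk _
  have h1 : IsEmbedding (pullbackTotalSpaceEmbedding f ∘ pullbackFrameChart f s) :=
    (IsEmbedding.subtypeVal.prodMap hemb.isEmbedding).comp hg
  have h2 : IsEmbedding (pullbackFrameChart f s) :=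
    ⟨((inducing_pullbackTotalSpaceEmbedding ℝ E f).of_comp_iff).mp h1.isInducing,
      h1.injective.of_comp⟩
  refine ⟨h2, ?_⟩
  have h3 : Set.range (pullbackFrameChart f s) = TotalSpace.proj ⁻¹' (f ⁻¹' U) := by
    ext p
    exact mem_range_pullbackFrameChart hs hE
  rw [h3]
  exact (hU.preimage hf).preimage (Pullback.continuous_proj ℝ E f)

end Frames

/-! ### Continuity of framings -/

section Continuity

variable {Z Y : Type*} [NormedAddCommGroup Z] [NormedSpace ℝ Z] [NormedAddCommGroup Y]
  [NormedSpace ℝ Y]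

theorem continuous_prod_framing {n : ℕ} (A : Z →L[ℝ] (Fin n → ℝ)) :
    Continuous fun S : Z →L[ℝ] Y => S.prod A := by
  have h : Continuous fun p : (Z →L[ℝ] Y) × (Z →L[ℝ] (Fin n → ℝ)) => p.1.prod p.2 :=
    (ContinuousLinearMap.prodₗᵢ ℝ).continuous
  exact h.comp (continuous_id.prodMk continuous_const)

theorem continuous_stabMap {N : ℕ} (Θ : (Fin N → ℝ) →L[ℝ] Y) :
    Continuous fun D : Z →L[ℝ] Y => stabMap Θ D := by
  have h : (fun D : Z →L[ℝ] Y => stabMap Θ D) = fun D =>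
      D.comp (ContinuousLinearMap.fst ℝ Z (Fin N → ℝ)) +
        Θ.comp (ContinuousLinearMap.snd ℝ Z (Fin N → ℝ)) := by
    funext D
    ext x <;> simp [stabMap]
  rw [h]
  fun_prop

/-- The ratio of the generators of `λ(S)` given by two framings depends continuously on
`(S, A)⁻¹`. -/
theorem continuous_det_framing {n : ℕ} (A : Z →L[ℝ] (Fin n → ℝ)) :
    Continuous fun R : Y × (Fin n → ℝ) →L[ℝ] Z =>
      (colMatrix fun j => A (R (0, Pi.single j 1))).det := by
  refine Continuous.matrix_det (continuous_matrix fun i j => ?_)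
  change Continuous fun R : Y × (Fin n → ℝ) →L[ℝ] Z => A (R (0, Pi.single j 1)) i
  fun_prop

/-- The operator D enters only through R, and each entry of the matrix is an evaluation of R
followed by bounded maps. -/
theorem continuous_transRatio {N₁ N₂ n₁ n₂ : ℕ} (h : n₁ + N₂ = n₂ + N₁)
    (Θ₂ : (Fin N₂ → ℝ) →L[ℝ] Y) (A₂ : Z × (Fin N₂ → ℝ) →L[ℝ] (Fin n₂ → ℝ)) :
    Continuous fun R : Y × (Fin n₁ → ℝ) →L[ℝ] Z × (Fin N₁ → ℝ) => transRatio h R Θ₂ A₂ := by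
  refine continuous_const.mul (Continuous.matrix_det (continuous_matrix fun i j => ?_))
  have hi : ∀ i, Continuous fun R : Y × (Fin n₁ → ℝ) →L[ℝ] Z × (Fin N₁ → ℝ) =>
      transMap R Θ₂ A₂ (Pi.single j 1) i := by
    rintro (i | i)
    · change Continuous fun R : Y × (Fin n₁ → ℝ) →L[ℝ] Z × (Fin N₁ → ℝ) => A₂ ((R _).1, _) i
      fun_prop
    · change Continuous fun R : Y × (Fin n₁ → ℝ) →L[ℝ] Z × (Fin N₁ → ℝ) => (R _).2 i
      fun_prop
  exact (hi (sumFinCast h i)).congr fun R =>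
    (LinearMap.toMatrix'_apply (transMap R Θ₂ A₂) (sumFinCast h i) j).symm

/-- The finite-dimensional kernel is complemented: a bounded projection onto it followed by
coordinates is a framing. -/
theorem exists_isFraming (S : SurjFredholm Z Y) :
    ∃ (n : ℕ) (A : Z →L[ℝ] (Fin n → ℝ)), IsFraming S.1.1 A := by
  have := finite_ker S.1.2
  obtain ⟨p, hp⟩ := S.1.2.closedComplemented_ker
  let φ : LinearMap.ker S.1.1.toLinearMap ≃L[ℝ]
      (Fin (finrank ℝ (LinearMap.ker S.1.1.toLinearMap)) → ℝ) :=
    (finBasis ℝ (LinearMap.ker S.1.1.toLinearMap)).equivFun.toContinuousLinearEquiv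
  refine ⟨_, φ.toContinuousLinearMap.comp p, isFraming_of_bijective_ker S.2 ?_⟩
  have h : (φ.toContinuousLinearMap.comp p).toLinearMap ∘ₗ
      (LinearMap.ker S.1.1.toLinearMap).subtype = φ.toLinearMap := by
    ext1 x
    exact congrArg φ (hp x)
  rw [h]
  exact φ.bijective

variable [CompleteSpace Z] [CompleteSpace Y]

/-- The open mapping theorem makes the bijection (S, A) a homeomorphism; completeness enters here.
-/
theorem IsFraming.exists_equiv {n : ℕ} {S : Z →L[ℝ] Y} {A : Z →L[ℝ] (Fin n → ℝ)}
    (h : IsFraming S A) : ∃ e : Z ≃L[ℝ] Y × (Fin n → ℝ), (e : Z →L[ℝ] Y × (Fin n → ℝ)) = S.prod A :=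
  ⟨.ofBijective (S.prod A) (LinearMap.ker_eq_bot.mpr h.1) (LinearMap.range_eq_top.mpr h.2),
    ContinuousLinearMap.ext fun _ => rfl⟩

theorem IsFraming.inverse_apply {n : ℕ} {S : Z →L[ℝ] Y} {A : Z →L[ℝ] (Fin n → ℝ)}
    (h : IsFraming S A) (z : Z) : (S.prod A).inverse (S z, A z) = z := by
  obtain ⟨e, he⟩ := h.exists_equiv
  have h1 : (S z, A z) = e z := congrArg (fun L : Z →L[ℝ] Y × (Fin n → ℝ) => L z) he.symm
  rw [← he, ContinuousLinearMap.inverse_equiv, h1]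
  exact e.symm_apply_apply z

theorem IsFraming.apply_inverse {n : ℕ} {S : Z →L[ℝ] Y} {A : Z →L[ℝ] (Fin n → ℝ)}
    (h : IsFraming S A) (y : Y) : S ((S.prod A).inverse (y, 0)) = y := by
  obtain ⟨z, hz⟩ := h.2 (y, 0)
  rw [← hz]
  exact (congrArg S (h.inverse_apply z)).trans (congrArg Prod.fst hz)

theorem isOpen_isFraming {n : ℕ} (A : Z →L[ℝ] (Fin n → ℝ)) :
    IsOpen {S : Z →L[ℝ] Y | IsFraming S A} := by
  have h : {S : Z →L[ℝ] Y | IsFraming S A} = (fun S : Z →L[ℝ] Y => S.prod A) ⁻¹'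
      Set.range ((↑) : (Z ≃L[ℝ] Y × (Fin n → ℝ)) → Z →L[ℝ] Y × (Fin n → ℝ)) := by
    ext S
    refine ⟨fun h => h.exists_equiv, ?_⟩
    rintro ⟨e, he⟩
    exact (congrArg (fun L : Z →L[ℝ] Y × (Fin n → ℝ) => Function.Bijective L) he).mp e.bijective
  rw [h]
  have h1 : IsOpen (Set.range ((↑) : (Z ≃L[ℝ] Y × (Fin n → ℝ)) → Z →L[ℝ] Y × (Fin n → ℝ))) :=
    ContinuousLinearEquiv.isOpen
  exact h1.preimage (continuous_prod_framing A)

theorem IsFraming.continuousAt_inverse {n : ℕ} {S : Z →L[ℝ] Y} {A : Z →L[ℝ] (Fin n → ℝ)}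
    (h : IsFraming S A) : ContinuousAt (fun S : Z →L[ℝ] Y => (S.prod A).inverse) S := by
  obtain ⟨e, he⟩ := h.exists_equiv
  have h1 : ContinuousAt (ContinuousLinearMap.inverse (R := ℝ) (M := Z) (M₂ := Y × (Fin n → ℝ)))
      (S.prod A) := by
    rw [← he]
    exact (contDiffAt_map_inverse (𝕜 := ℝ) (n := 0) e).continuousAt
  exact ContinuousAt.comp (f := fun S : Z →L[ℝ] Y => S.prod A) h1
    (continuous_prod_framing A).continuousAt

end Continuity

/-! ### The line bundle over surjective Fredholm operators -/

section SurjBundle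

variable {Z Y : Type*} [NormedAddCommGroup Z] [NormedSpace ℝ Z] [NormedAddCommGroup Y]
  [NormedSpace ℝ Y] {n : ℕ}

theorem finrank_surjDetFamily (S : SurjFredholm Z Y) : finrank ℝ (surjDetFamily Z Y S) = 1 :=
  have := finite_ker S.1.2
  have := finite_coker S.1.2
  finrank_detPair (A := LinearMap.ker S.1.1.toLinearMap)
    (B := Y ⧸ LinearMap.range S.1.1.toLinearMap)

theorem finrank_detFamily (D : Fredholm Z Y) : finrank ℝ (detFamily Z Y D) = 1 :=
  have := finite_ker D.2
  have := finite_coker D.2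
  finrank_detPair (A := LinearMap.ker D.1.toLinearMap) (B := Y ⧸ LinearMap.range D.1.toLinearMap)

/-- The surjective Fredholm operators framed by `A`. -/
def framedSet (Y : Type*) [NormedAddCommGroup Y] [NormedSpace ℝ Y] (A : Z →L[ℝ] (Fin n → ℝ)) :
    Set (SurjFredholm Z Y) :=
  {S | IsFraming S.1.1 A}

/-- The generator of `λ(S)` over the operators framed by `A`. -/
def surjFrame (A : Z →L[ℝ] (Fin n → ℝ)) (S : framedSet Y A) : surjDetFamily Z Y S :=
  frame (S := S.1.1.1) S.2

theorem surjFrame_ne_zero (A : Z →L[ℝ] (Fin n → ℝ)) (S : framedSet Y A) : surjFrame A S ≠ 0 :=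
  frame_ne_zero (S := S.1.1.1) S.2

/-- The framing `φ ∘ (id - T D)` given by a right inverse `T` of `D`, where `φ : ker D ≃ ℝ^n`. -/
def rightInvFraming (D : SurjFredholm Z Y) (T : RightInv D)
    (φ : LinearMap.ker D.1.1.toLinearMap ≃L[ℝ] (Fin n → ℝ)) : Z →L[ℝ] (Fin n → ℝ) :=
  φ.toContinuousLinearMap.comp
    ((ContinuousLinearMap.id ℝ Z - T.1.comp D.1.1).codRestrict (LinearMap.ker D.1.1.toLinearMap)
      fun x => by
        change D.1.1 (x - T.1 (D.1.1 x)) = 0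
        rw [map_sub, T.2, sub_self])

theorem rightInvFraming_comp_subtype (D : SurjFredholm Z Y) (T : RightInv D)
    (φ : LinearMap.ker D.1.1.toLinearMap ≃L[ℝ] (Fin n → ℝ)) (S : SurjFredholm Z Y) :
    (rightInvFraming D T φ).toLinearMap ∘ₗ (LinearMap.ker S.1.1.toLinearMap).subtype =
      φ.toLinearMap ∘ₗ kerMap D T S := rfl

/-- On ker S the framing φ ∘ (id - T D) restricts to φ after Φ_S, which is bijective exactly when
Φ_S is. -/
theorem framedSet_rightInvFraming (D : SurjFredholm Z Y) (T : RightInv D)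
    (φ : LinearMap.ker D.1.1.toLinearMap ≃L[ℝ] (Fin n → ℝ)) :
    framedSet Y (rightInvFraming D T φ) = kerDomain D T := by
  ext S
  have h : Function.Bijective ((rightInvFraming D T φ).toLinearMap ∘ₗ
      (LinearMap.ker S.1.1.toLinearMap).subtype) ↔ Function.Bijective (kerMap D T S) := by
    rw [rightInvFraming_comp_subtype]
    exact φ.bijective.of_comp_iff' _
  exact ⟨fun hS => h.mp (bijective_ker_of_isFraming hS),
    fun hS => isFraming_of_bijective_ker S.2 (h.mpr hS)⟩

theorem topMap_symm_kerMap {D : SurjFredholm Z Y} {T : RightInv D}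
    (φ : LinearMap.ker D.1.1.toLinearMap ≃L[ℝ] (Fin n → ℝ)) {S : SurjFredholm Z Y}
    (h : S ∈ kerDomain D T) (hS : IsFraming S.1.1 (rightInvFraming D T φ)) :
    topMap (LinearEquiv.ofBijective (kerMap D T S) h).symm.toLinearMap
      (LinearEquiv.ofBijective (kerMap D T S) h).symm.finrank_eq
      (topMap φ.symm.toLinearEquiv.toLinearMap φ.symm.toLinearEquiv.finrank_eq (stdVol n)) =
      topMap hS.kerEquiv.symm.toLinearMap hS.kerEquiv.symm.finrank_eq (stdVol n) := by
  rw [topMap_topMap]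
  have e : (LinearEquiv.ofBijective (kerMap D T S) h).symm.toLinearMap ∘ₗ
      φ.symm.toLinearEquiv.toLinearMap = hS.kerEquiv.symm.toLinearMap := by
    refine LinearMap.ext fun q => hS.kerEquiv.injective ?_
    refine Eq.trans ?_ (hS.kerEquiv.apply_symm_apply q).symm
    refine Eq.trans ?_ (φ.apply_symm_apply q)
    exact congrArg φ ((LinearEquiv.ofBijective (kerMap D T S) h).apply_symm_apply (φ.symm q))
  simp only [e]

theorem transpose_topMap_star_topOne {V W : Type*} [AddCommGroup V] [Module ℝ V] [AddCommGroup W]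
    [Module ℝ W] [FiniteDimensional ℝ V] [FiniteDimensional ℝ W] (f : V →ₗ[ℝ] W)
    (h : finrank ℝ V = finrank ℝ W) (hV : finrank ℝ V = 0) (hW : finrank ℝ W = 0) :
    Dual.transpose (R := ℝ) (topMap f h) (star (topOne W hW)) = star (topOne V hV) := by
  refine LinearMap.ext fun x => ?_
  obtain ⟨d, rfl⟩ := exists_smul_eq_of_finrank_eq_one finrank_topPower (topOne_ne_zero hV) x
  rw [map_smul, map_smul, star_self finrank_topPower (topOne_ne_zero _), Dual.transpose_apply,
    LinearMap.comp_apply, topMap_topOne _ _ _ hW, star_self finrank_topPower (topOne_ne_zero _)]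

/-- The generator of `λ(D)` given by an isomorphism `φ : ker D ≃ ℝ^n`. -/
def kerGenerator (D : SurjFredholm Z Y) (φ : LinearMap.ker D.1.1.toLinearMap ≃L[ℝ] (Fin n → ℝ)) :
    surjDetFamily Z Y D :=
  DetPair.mk (topMap φ.symm.toLinearEquiv.toLinearMap φ.symm.toLinearEquiv.finrank_eq (stdVol n))
    (star (topOne _ (finrank_coker_surj D)))

theorem kerGenerator_ne_zero (D : SurjFredholm Z Y)
    (φ : LinearMap.ker D.1.1.toLinearMap ≃L[ℝ] (Fin n → ℝ)) : kerGenerator D φ ≠ 0 := by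
  have := finite_ker D.1.2
  have := finite_coker D.1.2
  exact DetPair.mk_ne_zero ((map_ne_zero_iff _ (topMap_injective _ φ.symm.injective)).mpr
    (stdVol_ne_zero n)) (star_ne_zero finrank_topPower (topOne_ne_zero _))

/-- This identifies the two families of charts: with t as coordinate on λ(D), the chart over U_{D,T}
is the frame chart of φ ∘ (id - T D). -/
theorem surjChart_eq_frameChart (D : SurjFredholm Z Y) (T : RightInv D)
    (φ : LinearMap.ker D.1.1.toLinearMap ≃L[ℝ] (Fin n → ℝ)) (S : kerDomain D T) (t : ℝ) :
    surjChart D T (S, t • kerGenerator D φ) =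
      frameChart (surjFrame (rightInvFraming D T φ))
        (⟨S.1, (framedSet_rightInvFraming D T φ).ge S.2⟩, t) := by
  have := finite_coker D.1.2
  have := finite_coker S.1.1.2
  have hS : IsFraming S.1.1.1 (rightInvFraming D T φ) := (framedSet_rightInvFraming D T φ).ge S.2
  refine congrArg (TotalSpace.mk S.1) ?_
  refine (map_smul _ t _).trans (congrArg (t • ·) ?_)
  refine (TensorProduct.map_tmul _ _ _ _).trans ?_
  refine congrArg₂ (fun x α => DetPair.mk x α) (topMap_symm_kerMap φ S.2 hS)
    (transpose_topMap_star_topOne _ _ _ _)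

instance (D : SurjFredholm Z Y) : IsModuleTopology ℝ (surjDetFamily Z Y D) := ⟨rfl⟩

/-- The linear homeomorphism `ℝ ≃ λ(D)` given by a generator. -/
def lineHomeomorph (D : SurjFredholm Z Y) (v : surjDetFamily Z Y D) (hv : v ≠ 0) :
    ℝ ≃ₜ surjDetFamily Z Y D :=
  have := IsModuleTopology.toContinuousAdd ℝ (surjDetFamily Z Y D)
  have := IsModuleTopology.toContinuousSMul ℝ (surjDetFamily Z Y D)
  let e := lineEquiv (finrank_self ℝ) (finrank_surjDetFamily D) 1 v one_ne_zero hv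
  { e.toEquiv with
    continuous_toFun := IsModuleTopology.continuous_of_linearMap e.toLinearMap
    continuous_invFun := IsModuleTopology.continuous_of_linearMap e.symm.toLinearMap }

theorem lineHomeomorph_apply (D : SurjFredholm Z Y) (v : surjDetFamily Z Y D) (hv : v ≠ 0)
    (t : ℝ) : lineHomeomorph D v hv t = t • v := by
  change lineEquiv (finrank_self ℝ) (finrank_surjDetFamily D) 1 v one_ne_zero hv t = t • v
  have h := lineEquiv_apply (finrank_self ℝ) (finrank_surjDetFamily D) one_ne_zero hv
  refine Eq.trans ?_ (congrArg (t • ·) h)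
  rw [← map_smul, smul_eq_mul, mul_one]

/-- The domain of a trivialization over `U_{D,T}` identified with that of a frame. -/
def kerChartHomeomorph (D : SurjFredholm Z Y) (T : RightInv D)
    (φ : LinearMap.ker D.1.1.toLinearMap ≃L[ℝ] (Fin n → ℝ)) :
    framedSet Y (rightInvFraming D T φ) × ℝ ≃ₜ kerDomain D T × surjDetFamily Z Y D :=
  (Homeomorph.setCongr (framedSet_rightInvFraming D T φ)).prodCongr
    (lineHomeomorph D (kerGenerator D φ) (kerGenerator_ne_zero D φ))

theorem surjChart_comp_kerChartHomeomorph (D : SurjFredholm Z Y) (T : RightInv D)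
    (φ : LinearMap.ker D.1.1.toLinearMap ≃L[ℝ] (Fin n → ℝ)) :
    surjChart D T ∘ kerChartHomeomorph D T φ =
      frameChart (surjFrame (rightInvFraming D T φ)) := by
  funext p
  rw [← surjChart_eq_frameChart D T φ ⟨p.1.1, (framedSet_rightInvFraming D T φ).le p.1.2⟩ p.2,
    ← lineHomeomorph_apply _ _ (kerGenerator_ne_zero D φ)]
  rfl

variable [CompleteSpace Z] [CompleteSpace Y]

theorem isOpen_framedSet (A : Z →L[ℝ] (Fin n → ℝ)) : IsOpen (framedSet Y A) :=
  (isOpen_isFraming A).preimage (continuous_subtype_val.comp continuous_subtype_val)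

theorem exists_surjFrame_eq_smul {n n' : ℕ} (A : Z →L[ℝ] (Fin n → ℝ)) (A' : Z →L[ℝ] (Fin n' → ℝ)) :
    ∃ c : SurjFredholm Z Y → ℝ, (∀ S, S ∈ framedSet Y A → S ∈ framedSet Y A' → ContinuousAt c S) ∧
      ∀ S (h : S ∈ framedSet Y A) (h' : S ∈ framedSet Y A'),
        surjFrame A ⟨S, h⟩ = c S • surjFrame A' ⟨S, h'⟩ := by
  by_cases hn : n = n'
  · subst hn
    -- `inverse` takes the value 0 at non-invertible maps, so the ratio is defined everywhere;
    -- continuity is claimed only on the overlap.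
    refine ⟨fun S => (colMatrix fun j => A' ((S.1.1.prod A).inverse (0, Pi.single j 1))).det,
      fun S h _ => ?_, fun S h h' => frame_eq_det_smul_frame (S := S.1.1) h h' _ h.inverse_apply⟩
    have h1 : ContinuousAt (fun S : SurjFredholm Z Y => (S.1.1.prod A).inverse) S :=
      ContinuousAt.comp (f := fun S : SurjFredholm Z Y => S.1.1) h.continuousAt_inverse
        (continuous_subtype_val.comp continuous_subtype_val).continuousAt
    exact ContinuousAt.comp (f := fun S : SurjFredholm Z Y => (S.1.1.prod A).inverse)
      (continuous_det_framing A').continuousAt h1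
  -- A framing into ℝⁿ forces dim ker S = n, so for n ≠ n' the overlap is empty.
  · have h0 : ∀ S, S ∈ framedSet Y A → S ∉ framedSet Y A' := fun S h h' =>
      hn ((IsFraming.finrank_ker h).symm.trans (IsFraming.finrank_ker h'))
    exact ⟨0, fun S h h' => (h0 S h h').elim, fun S h h' => (h0 S h h').elim⟩

/-- The frames of all framings glue to a topology `τ` in which they are open embeddings. The charts
over the U_{D,T} are reparametrized frames and already cover, so by `eq_iSup_coinduced` they
determine the same `τ`. -/
theorem isOpenEmbedding_surjFrame (A : Z →L[ℝ] (Fin n → ℝ)) :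
    IsOpenEmbedding (frameChart (surjFrame (Y := Y) A)) := by
  let f : ∀ i : (Σ m, Z →L[ℝ] (Fin m → ℝ)), framedSet Y i.2 × ℝ → TotalSpace ℝ (surjDetFamily Z Y) :=
    fun i => frameChart (surjFrame i.2)
  have hf := isOpenEmbedding_iSup_coinduced f
    (fun i => frameChart_injective (surjFrame_ne_zero i.2)) fun i j s hs => by
      obtain ⟨c, hc, h⟩ := exists_surjFrame_eq_smul (Y := Y) i.2 j.2
      exact isOpen_preimage_image_frameChart (isOpen_framedSet j.2) (surjFrame_ne_zero j.2) c hc h hs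
  let τ : TopologicalSpace (TotalSpace ℝ (surjDetFamily Z Y)) :=
    ⨆ i, TopologicalSpace.coinduced (f i) inferInstance
  let g : ∀ i : (Σ D : SurjFredholm Z Y, RightInv D), kerDomain i.1 i.2 × surjDetFamily Z Y i.1 →
    TotalSpace ℝ (surjDetFamily Z Y) := fun i => surjChart i.1 i.2
  have hg : ∀ i, @IsOpenEmbedding _ _ _ τ (g i) := by
    rintro ⟨D, T⟩
    have := finite_ker D.1.2
    let φ : LinearMap.ker D.1.1.toLinearMap ≃L[ℝ]
        (Fin (finrank ℝ (LinearMap.ker D.1.1.toLinearMap)) → ℝ) :=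
      (finBasis ℝ (LinearMap.ker D.1.1.toLinearMap)).equivFun.toContinuousLinearEquiv
    let κ := kerChartHomeomorph D T φ
    have h1 : g ⟨D, T⟩ ∘ κ = f ⟨_, rightInvFraming D T φ⟩ :=
      surjChart_comp_kerChartHomeomorph D T φ
    have h2 : g ⟨D, T⟩ = f ⟨_, rightInvFraming D T φ⟩ ∘ κ.symm := by
      rw [← h1, Function.comp_assoc, κ.self_comp_symm, Function.comp_id]
    rw [h2]
    exact (hf _).comp κ.symm.isOpenEmbedding
  have hcov : ∀ p, ∃ i, p ∈ Set.range (g i) := by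
    rintro ⟨S, x⟩
    obtain ⟨m, A', hA'⟩ := exists_isFraming S
    -- A framing supplies a bounded right inverse, y ↦ (S, A')⁻¹(y, 0).
    let T : RightInv S := ⟨(S.1.1.prod A').inverse.comp (.inl ℝ Y (Fin m → ℝ)), hA'.apply_inverse⟩
    have := finite_ker S.1.2
    let φ : LinearMap.ker S.1.1.toLinearMap ≃L[ℝ]
        (Fin (finrank ℝ (LinearMap.ker S.1.1.toLinearMap)) → ℝ) :=
      (finBasis ℝ (LinearMap.ker S.1.1.toLinearMap)).equivFun.toContinuousLinearEquiv
    have hS : S ∈ framedSet Y (rightInvFraming S T φ) := by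
      rw [framedSet_rightInvFraming]
      have h : kerMap S T S = LinearMap.id := by
        refine LinearMap.ext fun x => Subtype.ext ?_
        change x.1 - T.1 (S.1.1 x.1) = x.1
        rw [show S.1.1 x.1 = 0 from LinearMap.mem_ker.mp x.2, map_zero, sub_zero]
      change Function.Bijective (kerMap S T S)
      rw [h]
      exact Function.bijective_id
    obtain ⟨p, hp⟩ := (mem_range_frameChart (surjFrame_ne_zero (rightInvFraming S T φ))
      finrank_surjDetFamily (p := ⟨S, x⟩)).mpr hS
    refine ⟨⟨S, T⟩, (⟨p.1.1, (framedSet_rightInvFraming S T φ).le p.1.2⟩,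
      p.2 • kerGenerator S φ), ?_⟩
    exact (surjChart_eq_frameChart S T φ _ p.2).trans hp
  have h1 : τ = ⨆ i, TopologicalSpace.coinduced (g i) inferInstance :=
    @eq_iSup_coinduced _ _ _ _ τ g hg hcov
  have h2 : τ = ⨆ (D : SurjFredholm Z Y) (T : RightInv D),
      TopologicalSpace.coinduced (surjChart D T) inferInstance := h1.trans iSup_sigma
  change @IsOpenEmbedding _ _ _ (⨆ (D : SurjFredholm Z Y) (T : RightInv D),
    TopologicalSpace.coinduced (surjChart D T) inferInstance) _
  rw [← h2]
  exact hf ⟨n, A⟩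

end SurjBundle

/-! ### The determinant line bundle -/

section DetBundle

variable {X Y : Type*} [NormedAddCommGroup X] [NormedSpace ℝ X] [NormedAddCommGroup Y]
  [NormedSpace ℝ Y] {N n : ℕ}

/-- The Fredholm operators whose stabilization by `Θ` is framed by `A`. -/
def stabFramedSet (Θ : (Fin N → ℝ) →L[ℝ] Y) (A : X × (Fin N → ℝ) →L[ℝ] (Fin n → ℝ)) :
    Set (Fredholm X Y) :=
  {D | IsFraming (stabMap Θ D.1) A}

/-- The generator of `λ(D)` over the operators whose stabilization by `Θ` is framed by `A`. -/
def detFrame (Θ : (Fin N → ℝ) →L[ℝ] Y) (A : X × (Fin N → ℝ) →L[ℝ] (Fin n → ℝ))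
    (D : stabFramedSet Θ A) : detFamily X Y D :=
  stabFrame Θ A D.1 D.2

theorem detFrame_ne_zero (Θ : (Fin N → ℝ) →L[ℝ] Y) (A : X × (Fin N → ℝ) →L[ℝ] (Fin n → ℝ))
    (D : stabFramedSet Θ A) : detFrame Θ A D ≠ 0 :=
  stabFrame_ne_zero Θ A D.1 D.2

theorem stabFramedSet_subset_stabDomain (Θ : (Fin N → ℝ) →L[ℝ] Y)
    (A : X × (Fin N → ℝ) →L[ℝ] (Fin n → ℝ)) : stabFramedSet Θ A ⊆ stabDomain Θ :=
  fun _ hD => IsFraming.surjective hD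

theorem exists_mem_stabFramedSet {Θ : (Fin N → ℝ) →L[ℝ] Y} {D : Fredholm X Y}
    (hD : D ∈ stabDomain Θ) :
    ∃ (n : ℕ) (A : X × (Fin N → ℝ) →L[ℝ] (Fin n → ℝ)), D ∈ stabFramedSet Θ A :=
  exists_isFraming ⟨stab Θ D, hD⟩

/-- Lifts to Y of a basis of coker D serve as the images under Θ of the standard basis. -/
theorem exists_mem_stabDomain (D : Fredholm X Y) :
    ∃ (N : ℕ) (Θ : (Fin N → ℝ) →L[ℝ] Y), D ∈ stabDomain Θ := by
  have := finite_coker D.2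
  let b := finBasis ℝ (Y ⧸ LinearMap.range D.1.toLinearMap)
  choose y hy using fun k => Submodule.mkQ_surjective _ (b k)
  let Θ : (Fin _ → ℝ) →L[ℝ] Y := (Fintype.linearCombination ℝ y).toContinuousLinearMap
  refine ⟨_, Θ, fun z => ?_⟩
  have h1 : (LinearMap.range D.1.toLinearMap).mkQ (Θ (b.equivFun (Submodule.Quotient.mk z))) =
      Submodule.Quotient.mk z := by
    change (LinearMap.range D.1.toLinearMap).mkQ
      (Fintype.linearCombination ℝ y (b.equivFun (Submodule.Quotient.mk z))) = _
    rw [Fintype.linearCombination_apply, map_sum]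
    simp only [map_smul, hy]
    exact b.sum_equivFun _
  obtain ⟨x, hx⟩ := (Submodule.Quotient.eq _).mp h1.symm
  refine ⟨(x, b.equivFun (Submodule.Quotient.mk z)), ?_⟩
  change D.1 x + Θ _ = z
  rw [show D.1 x = _ from hx]
  exact sub_add_cancel _ _

theorem stabChart_injective (Θ : (Fin N → ℝ) →L[ℝ] Y) :
    Function.Injective (stabChart (X := X) Θ) := by
  rintro ⟨⟨D, hD⟩, x⟩ ⟨⟨D', hD'⟩, x'⟩ h
  obtain rfl : D = D' := congrArg TotalSpace.proj h
  have h2 : stabIso Θ D x = stabIso Θ D x' := TotalSpace.mk_injective D h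
  exact congrArg (TotalSpace.mk _) ((stabIso Θ D).injective h2)

theorem mem_range_stabChart {Θ : (Fin N → ℝ) →L[ℝ] Y} {p : TotalSpace ℝ (detFamily X Y)}
    (hp : p.proj ∈ stabDomain Θ) : p ∈ Set.range (stabChart (X := X) Θ) :=
  ⟨⟨⟨p.proj, hp⟩, (stabIso Θ p.proj).symm p.snd⟩,
    congrArg (TotalSpace.mk p.proj) ((stabIso Θ p.proj).apply_symm_apply p.snd)⟩

theorem continuous_stabOn (Θ : (Fin N → ℝ) →L[ℝ] Y) {U : Set (Fredholm X Y)}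
    (hU : U ⊆ stabDomain Θ) : Continuous (stabOn Θ hU) :=
  (((continuous_stabMap Θ).comp (continuous_subtype_val.comp continuous_subtype_val)).subtype_mk
    _).subtype_mk _

/-- The inclusion of the restriction of `ι_Θ^* det` to `U ⊆ U_{X;Θ}`. -/
def stabRestrict (Θ : (Fin N → ℝ) →L[ℝ] Y) {U : Set (Fredholm X Y)} (hU : U ⊆ stabDomain Θ)
    (p : StabBundle Θ hU) : StabBundle (X := X) Θ (U := stabDomain Θ) subset_rfl :=
  ⟨⟨p.proj.1, hU p.proj.2⟩, p.snd⟩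

theorem isInducing_stabRestrict (Θ : (Fin N → ℝ) →L[ℝ] Y) {U : Set (Fredholm X Y)}
    (hU : U ⊆ stabDomain Θ) : IsInducing (stabRestrict Θ hU) := by
  rw [← (inducing_pullbackTotalSpaceEmbedding ℝ (surjDetFamily (X × (Fin N → ℝ)) Y)
    (stabOn (X := X) Θ (U := stabDomain Θ) subset_rfl)).of_comp_iff]
  exact ((IsEmbedding.inclusion hU).isInducing.prodMap .id).comp
    (inducing_pullbackTotalSpaceEmbedding ℝ (surjDetFamily (X × (Fin N → ℝ)) Y) (stabOn Θ hU))

variable [CompleteSpace X] [CompleteSpace Y]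

theorem isOpen_stabFramedSet (Θ : (Fin N → ℝ) →L[ℝ] Y) (A : X × (Fin N → ℝ) →L[ℝ] (Fin n → ℝ)) :
    IsOpen (stabFramedSet Θ A) :=
  (isOpen_isFraming A).preimage ((continuous_stabMap Θ).comp continuous_subtype_val)

/-- A surjective D_Θ has a framing A, and A still frames the stabilizations of all nearby operators.
-/
theorem isOpen_stabDomain (Θ : (Fin N → ℝ) →L[ℝ] Y) : IsOpen (stabDomain (X := X) Θ) := by
  refine isOpen_iff_mem_nhds.mpr fun D hD => ?_
  obtain ⟨n, A, hA⟩ := exists_mem_stabFramedSet hD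
  exact Filter.mem_of_superset ((isOpen_stabFramedSet Θ A).mem_nhds hA)
    (stabFramedSet_subset_stabDomain Θ A)

theorem exists_detFrame_eq_smul {N₁ N₂ n₁ n₂ : ℕ} (Θ₁ : (Fin N₁ → ℝ) →L[ℝ] Y)
    (A₁ : X × (Fin N₁ → ℝ) →L[ℝ] (Fin n₁ → ℝ)) (Θ₂ : (Fin N₂ → ℝ) →L[ℝ] Y)
    (A₂ : X × (Fin N₂ → ℝ) →L[ℝ] (Fin n₂ → ℝ)) :
    ∃ c : Fredholm X Y → ℝ,
      (∀ D, D ∈ stabFramedSet Θ₁ A₁ → D ∈ stabFramedSet Θ₂ A₂ → ContinuousAt c D) ∧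
      ∀ D (h₁ : D ∈ stabFramedSet Θ₁ A₁) (h₂ : D ∈ stabFramedSet Θ₂ A₂),
        detFrame Θ₁ A₁ ⟨D, h₁⟩ = c D • detFrame Θ₂ A₂ ⟨D, h₂⟩ := by
  by_cases h : n₁ + N₂ = n₂ + N₁
  · refine ⟨fun D => transRatio h ((stabMap Θ₁ D.1).prod A₁).inverse Θ₂ A₂, fun D h₁ _ => ?_,
      fun D h₁ h₂ => stabFrame_eq_smul_stabFrame h₁ h₂ h h₁.inverse_apply⟩
    have e₁ : ContinuousAt (fun D : Fredholm X Y => ((stabMap Θ₁ D.1).prod A₁).inverse) D :=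
      ContinuousAt.comp (f := fun D : Fredholm X Y => stabMap Θ₁ D.1) h₁.continuousAt_inverse
        ((continuous_stabMap Θ₁).comp continuous_subtype_val).continuousAt
    exact ContinuousAt.comp (f := fun D : Fredholm X Y => ((stabMap Θ₁ D.1).prod A₁).inverse)
      (continuous_transRatio h Θ₂ A₂).continuousAt e₁
  -- By the index, a common point would force n₁ + N₂ = n₂ + N₁.
  · exact ⟨0, fun D h₁ h₂ => (h (add_eq_add_of_isFraming h₁ h₂)).elim,
      fun D h₁ h₂ => (h (add_eq_add_of_isFraming h₁ h₂)).elim⟩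

/-- The topology of `det_{X,Y}` glued from the frames given by framed stabilizations. -/
@[reducible]
def detTopology (X Y : Type*) [NormedAddCommGroup X] [NormedSpace ℝ X] [NormedAddCommGroup Y]
    [NormedSpace ℝ Y] : TopologicalSpace (TotalSpace ℝ (detFamily X Y)) :=
  ⨆ i : (Σ (N n : ℕ), ((Fin N → ℝ) →L[ℝ] Y) × (X × (Fin N → ℝ) →L[ℝ] (Fin n → ℝ))),
    TopologicalSpace.coinduced (frameChart (detFrame i.2.2.1 i.2.2.2)) inferInstance

theorem isOpenEmbedding_detFrame (Θ : (Fin N → ℝ) →L[ℝ] Y)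
    (A : X × (Fin N → ℝ) →L[ℝ] (Fin n → ℝ)) :
    @IsOpenEmbedding _ _ _ (detTopology X Y) (frameChart (detFrame Θ A)) := by
  let f : ∀ i : (Σ (N n : ℕ), ((Fin N → ℝ) →L[ℝ] Y) × (X × (Fin N → ℝ) →L[ℝ] (Fin n → ℝ))),
      stabFramedSet i.2.2.1 i.2.2.2 × ℝ → TotalSpace ℝ (detFamily X Y) :=
    fun i => frameChart (detFrame i.2.2.1 i.2.2.2)
  exact isOpenEmbedding_iSup_coinduced f (fun i => frameChart_injective (detFrame_ne_zero _ _))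
    (fun i j s hs => by
      obtain ⟨c, hc, h⟩ := exists_detFrame_eq_smul i.2.2.1 i.2.2.2 j.2.2.1 j.2.2.2
      exact isOpen_preimage_image_frameChart (isOpen_stabFramedSet _ _) (detFrame_ne_zero _ _) c hc
        h hs) ⟨N, n, Θ, A⟩

/-- Pulled back frames of λ(D_Θ) cover the source, and linearity of I_{Θ;D} turns each into a
restriction of a frame that defines the topology of det. -/
theorem isOpenEmbedding_stabChart (Θ : (Fin N → ℝ) →L[ℝ] Y) :
    @IsOpenEmbedding _ _ _ (detTopology X Y) (stabChart (X := X) Θ) := by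
  let _ := detTopology X Y
  let F := stabOn (X := X) Θ (U := stabDomain Θ) subset_rfl
  refine isOpenEmbedding_of_cover (stabChart_injective Θ)
    (fun i : (Σ n, X × (Fin N → ℝ) →L[ℝ] (Fin n → ℝ)) => pullbackFrameChart F (surjFrame i.2))
    (fun i => isOpenEmbedding_pullbackFrameChart (continuous_stabOn Θ subset_rfl)
      (isOpen_framedSet i.2) (surjFrame_ne_zero i.2) finrank_surjDetFamily
      (isOpenEmbedding_surjFrame i.2)) (fun i => ?_) fun p => ?_
  · let V : Set (stabDomain (X := X) Θ) := F ⁻¹' framedSet Y i.2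
    let r : V → stabFramedSet Θ i.2 := fun D => ⟨D.1.1, D.2⟩
    have hr : IsOpenEmbedding r := by
      refine IsOpenEmbedding.of_comp r (isOpen_stabFramedSet Θ i.2).isOpenEmbedding_subtypeVal ?_
      exact (isOpen_stabDomain Θ).isOpenEmbedding_subtypeVal.comp
        ((isOpen_framedSet i.2).preimage (continuous_stabOn Θ subset_rfl)).isOpenEmbedding_subtypeVal
    have e : stabChart Θ ∘ pullbackFrameChart F (surjFrame i.2) =
        frameChart (detFrame Θ i.2) ∘ Prod.map r id := by
      funext p
      exact congrArg (TotalSpace.mk p.1.1.1)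
        (map_smul (stabIso Θ p.1.1.1) p.2 (frame (S := stabMap Θ p.1.1.1.1) p.1.2))
    rw [e]
    exact (isOpenEmbedding_detFrame Θ i.2).comp (hr.prodMap .id)
  · obtain ⟨n, A, hA⟩ := exists_mem_stabFramedSet p.proj.2
    exact ⟨⟨n, A⟩, (mem_range_pullbackFrameChart (surjFrame_ne_zero A) finrank_surjDetFamily).mpr hA⟩

/-- Followed by the chart of Θ₂, the transition becomes the chart of Θ₁, which is continuous; and
the chart of Θ₂ restricted to the overlap is inducing. -/
theorem continuous_transition {N₁ N₂ : ℕ} (Θ₁ : (Fin N₁ → ℝ) →L[ℝ] Y)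
    (Θ₂ : (Fin N₂ → ℝ) →L[ℝ] Y) : Continuous (transition (X := X) Θ₁ Θ₂) := by
  let _ := detTopology X Y
  have h := (isOpenEmbedding_stabChart (X := X) Θ₂).isInducing.comp
    (isInducing_stabRestrict Θ₂ (Set.inter_subset_right (s := stabDomain Θ₁)))
  rw [h.continuous_iff]
  have e : (stabChart Θ₂ ∘ stabRestrict Θ₂ (Set.inter_subset_right (s := stabDomain Θ₁))) ∘
      transition (X := X) Θ₁ Θ₂ =
      stabChart Θ₁ ∘ stabRestrict Θ₁ (Set.inter_subset_left (t := stabDomain Θ₂)) := by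
    funext p
    exact congrArg (TotalSpace.mk p.proj.1) ((stabIso Θ₂ p.proj.1).apply_symm_apply _)
  rw [e]
  exact (isOpenEmbedding_stabChart Θ₁).continuous.comp (isInducing_stabRestrict Θ₁ _).continuous

theorem isLineBundle_detFamily :
    @IsLineBundle (Fredholm X Y) _ (detFamily X Y) _ _ (detTopology X Y) := by
  intro D
  let _ := detTopology X Y
  obtain ⟨N, Θ, hΘ⟩ := exists_mem_stabDomain D
  obtain ⟨n, A, hA⟩ := exists_mem_stabFramedSet hΘ
  exact exists_trivialization_of_frame (isOpen_stabFramedSet Θ A) (detFrame_ne_zero Θ A)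
    finrank_detFamily (isOpenEmbedding_detFrame Θ A) hA

theorem eq_detTopology (τ : TopologicalSpace (TotalSpace ℝ (detFamily X Y)))
    (h : ∀ (N : ℕ) (Θ : (Fin N → ℝ) →L[ℝ] Y), @IsOpenEmbedding _ _ _ τ (stabChart (X := X) Θ)) :
    τ = detTopology X Y := by
  let f : ∀ i : (Σ N : ℕ, (Fin N → ℝ) →L[ℝ] Y),
      StabBundle (X := X) i.2 (U := stabDomain i.2) subset_rfl → TotalSpace ℝ (detFamily X Y) :=
    fun i => stabChart i.2
  have hcov : ∀ p, ∃ i, p ∈ Set.range (f i) := fun p => by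
    obtain ⟨N, Θ, hΘ⟩ := exists_mem_stabDomain p.proj
    exact ⟨⟨N, Θ⟩, mem_range_stabChart hΘ⟩
  exact (@eq_iSup_coinduced _ _ _ _ τ f (fun i => h i.1 i.2) hcov).trans
    (@eq_iSup_coinduced _ _ _ _ (detTopology X Y) f (fun i => isOpenEmbedding_stabChart i.2)
      hcov).symm

end DetBundle

end FredholmDet

end

theorem mainTheorem7 {X Y : Type*} [NormedAddCommGroup X] [NormedSpace ℝ X] [CompleteSpace X]
    [NormedAddCommGroup Y] [NormedSpace ℝ Y] [CompleteSpace Y] :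
    (∀ (N₁ N₂ : ℕ) (Θ₁ : (Fin N₁ → ℝ) →L[ℝ] Y) (Θ₂ : (Fin N₂ → ℝ) →L[ℝ] Y),
      Continuous (FredholmDet.transition (X := X) Θ₁ Θ₂)) ∧
    (∀ (N : ℕ) (Θ : (Fin N → ℝ) →L[ℝ] Y), IsOpen (FredholmDet.stabDomain (X := X) Θ)) ∧
    (∀ D : FredholmDet.Fredholm X Y, ∃ (N : ℕ) (Θ : (Fin N → ℝ) →L[ℝ] Y),
      D ∈ FredholmDet.stabDomain Θ) ∧
    ∃ τ : TopologicalSpace (Bundle.TotalSpace ℝ (FredholmDet.detFamily X Y)),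
      (∀ (N : ℕ) (Θ : (Fin N → ℝ) →L[ℝ] Y),
        Topology.IsOpenEmbedding (FredholmDet.stabChart (X := X) Θ)) ∧
      FredholmDet.IsLineBundle (FredholmDet.detFamily X Y) ∧
      ∀ τ' : TopologicalSpace (Bundle.TotalSpace ℝ (FredholmDet.detFamily X Y)),
        (∀ (N : ℕ) (Θ : (Fin N → ℝ) →L[ℝ] Y),
          @Topology.IsOpenEmbedding _ _ _ τ' (FredholmDet.stabChart (X := X) Θ)) → τ' = τ := by

  exact ⟨fun _ _ => FredholmDet.continuous_transition, fun _ => FredholmDet.isOpen_stabDomain,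
    FredholmDet.exists_mem_stabDomain, FredholmDet.detTopology X Y,
    fun _ => FredholmDet.isOpenEmbedding_stabChart, FredholmDet.isLineBundle_detFamily,
    FredholmDet.eq_detTopology⟩
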